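/- Let $n\ge 1$ and let $D,G\subset\mathbb C^n$ be bounded domains (non-empty, open, connected, bounded sets). Let $m_1,\dots,m_n\ge 1$ be integers with $\gcd(m_1,\dots,m_n)=1$. Suppose that $0\in G$ and that $G$ is $(m_1,\dots,m_n)$-circular, i.e. $(\lambda^{m_1}x_1,\dots,\lambda^{m_n}x_n)\in G$ for every $x\in G$ and every $\lambda\in\mathbb C$ with $|\lambda|=1$. Let $k_D(z,w)$ denote the Bergman kernel of $D$, i.e. the reproducing kernel of the space of holomorphic functions on $D$ that are square integrable with respect to Lebesgue measure: $k_D(\cdot,w)$ belongs to this space and $h(w)=\int_D h(z)\,\overline{k_D(z,w)}\,dz$ for every $w\in D$ and every $h$ in the space. For $K\subset\mathbb C^n$ put $\widetilde K=\{\overline x: x\in K\}$. Assume that for every open set $K$ that is relatively compact in $D$ there is an open set $U\supset\overline D$ such that the function $(z,w)\mapsto k_D(z,\overline w)$ on $D\times\widetilde K$ extends to a holomorphic function on $U\times\widetilde K$. Then every proper holomorphic map $f:D\to G$ extends holomorphically to a neighborhood of $\overline D$: there are an open set $V\supset\overline D$ and a holomorphic map $F:V\to\mathbb C^n$ with $F=f$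 on $D$. -/

import Mathlib

open MeasureTheory Set Metric Filter Topology

/-- The Bergman space of `D ⊆ ℂⁿ`: functions holomorphic on `D` and square integrable on `D` with
respect to Lebesgue measure. (Only the values on `D` matter.) -/
def bergmanSpace {n : ℕ} (D : Set (Fin n → ℂ)) : Set ((Fin n → ℂ) → ℂ) :=
  {h | DifferentiableOn ℂ h D ∧ MemLp h 2 (volume.restrict D)}

/-- `k` is the reproducing kernel of the Bergman space of `D`: for each `w ∈ D` the function
`k(·, w)` is in the Bergman space and `h(w) = ⟨h, k(·, w)⟩ = ∫_D h(z) conj (k(z, w)) dz`. -/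
structure IsBergmanKernel {n : ℕ} (D : Set (Fin n → ℂ))
    (k : (Fin n → ℂ) → (Fin n → ℂ) → ℂ) : Prop where
  mem : ∀ w ∈ D, (fun z => k z w) ∈ bergmanSpace D
  reproducing : ∀ h ∈ bergmanSpace D, ∀ w ∈ D, h w = ∫ z in D, h z * star (k z w)

/-- Mean value property of holomorphic functions over polydiscs. -/
theorem integral_closedBall_of_holomorphic {n : ℕ} {f : (Fin n → ℂ) → ℂ} {D : Set (Fin n → ℂ)}
    (hD : IsOpen D) (hf : DifferentiableOn ℂ f D) {w : Fin n → ℂ} {r : ℝ}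
    (hB : closedBall w r ⊆ D) :
    ∫ z in closedBall w r, f z = (volume.real (closedBall (0 : Fin n → ℂ) r) : ℂ) * f w := by
  set F : ℝ → (Fin n → ℂ) → ℂ := fun θ v => f (w + circleMap 0 1 θ • v) with hF
  have hmem : ∀ (l : ℂ) (v : Fin n → ℂ), ‖l‖ ≤ 1 → v ∈ closedBall (0 : Fin n → ℂ) r →
      w + l • v ∈ D := by
    intro l v hl hv
    apply hB
    rw [mem_closedBall_zero_iff] at hv
    rw [mem_closedBall, dist_eq_norm, add_sub_cancel_left, norm_smul]
    nlinarith [norm_nonneg v, norm_nonneg l]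
  have hc1 : ∀ θ, ‖circleMap 0 1 θ‖ = 1 := by intro θ; simp
  have ha : ∀ θ, ∫ v in closedBall (0 : Fin n → ℂ) r, F θ v = ∫ z in closedBall w r, f z := by
    intro θ
    have hmp : MeasurePreserving (fun v : Fin n → ℂ => w + circleMap 0 1 θ • v) volume volume := by
      refine (measurePreserving_add_left volume w).comp (g := fun x => w + x)
        (f := fun v : Fin n → ℂ => circleMap 0 1 θ • v) ?_
      refine volume_preserving_pi (f := fun _ (z : ℂ) => circleMap 0 1 θ * z) fun i => ?_
      exact (rotation ⟨circleMap 0 1 θ, by simp [Submonoid.unitSphere]⟩).measurePreserving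
    have hne : circleMap 0 1 θ ≠ 0 := by
      intro h; have := hc1 θ; rw [h] at this; simp at this
    have hemb : MeasurableEmbedding (fun v : Fin n → ℂ => w + circleMap 0 1 θ • v) := by
      refine Continuous.measurableEmbedding (by fun_prop) ?_
      intro a b hab
      exact smul_right_injective _ hne (add_left_cancel hab)
    rw [← hmp.setIntegral_preimage_emb hemb f (closedBall w r)]
    have hpre : (fun v : Fin n → ℂ => w + circleMap 0 1 θ • v) ⁻¹' closedBall w r =
        closedBall (0 : Fin n → ℂ) r := by
      ext v
      simp [dist_eq_norm, norm_smul]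
    rw [hpre]
  have hb : ∀ v ∈ closedBall (0 : Fin n → ℂ) r,
      ∫ θ in (0 : ℝ)..2 * Real.pi, F θ v = 2 * Real.pi * f w := by
    intro v hv
    have hd : ∀ l ∈ closedBall (0 : ℂ) |1|, DifferentiableAt ℂ (fun l : ℂ => f (w + l • v)) l := by
      intro l hl
      have : ‖l‖ ≤ 1 := by simpa using hl
      have h1 := (hf _ (hmem l v this hv)).differentiableAt (hD.mem_nhds (hmem l v this hv))
      exact DifferentiableAt.comp (g := f) (f := fun l : ℂ => w + l • v) l h1 (by fun_prop)
    have := circleAverage_of_differentiable_on_off_countable (c := 0) (R := 1)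
      (f := fun l : ℂ => f (w + l • v)) countable_empty
      (fun l hl => (hd l hl).continuousAt.continuousWithinAt)
      (fun l hl => hd l (ball_subset_closedBall hl.1))
    rw [Real.circleAverage_def] at this
    simp only [zero_smul, add_zero] at this
    rw [← this, Complex.real_smul]
    push_cast
    have hpi : (Real.pi : ℂ) ≠ 0 := by exact_mod_cast Real.pi_ne_zero
    field_simp
    rfl
  have hint : Integrable (Function.uncurry F)
      ((volume.restrict (uIoc 0 (2 * Real.pi))).prod
        (volume.restrict (closedBall (0 : Fin n → ℂ) r))) := by
    rw [Measure.prod_restrict, ← Measure.volume_eq_prod]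
    have hcont : ContinuousOn (Function.uncurry F)
        (Icc 0 (2 * Real.pi) ×ˢ closedBall (0 : Fin n → ℂ) r) := by
      refine hf.continuousOn.comp (f := fun p : ℝ × (Fin n → ℂ) => w + circleMap 0 1 p.1 • p.2)
        ?_ ?_
      · have := continuous_circleMap 0 1
        fun_prop
      · intro p hp
        exact hmem _ _ (hc1 _).le hp.2
    refine (hcont.integrableOn_compact (isCompact_Icc.prod (isCompact_closedBall _ _))).mono_set ?_
    refine prod_mono ?_ subset_rfl
    rw [uIoc_of_le (by positivity)]
    exact Ioc_subset_Icc_self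
  have hswap := intervalIntegral_integral_swap hint
  rw [setIntegral_congr_fun measurableSet_closedBall hb] at hswap
  simp only [ha] at hswap
  rw [intervalIntegral.integral_const, setIntegral_const, sub_zero, Complex.real_smul,
    Complex.real_smul] at hswap
  have hpi : (Real.pi : ℂ) ≠ 0 := by exact_mod_cast Real.pi_ne_zero
  push_cast at hswap
  have h2 : (2 * Real.pi : ℂ) ≠ 0 := by simp
  apply mul_left_cancel₀ h2
  rw [hswap]; ring

/-- The normalised indicator of a polydisc; pairing with it evaluates holomorphic functions at the
centre. Auxiliary, used only to prove that the Bergman kernel exists. -/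
noncomputable def bergmanEval {n : ℕ} (D : Set (Fin n → ℂ)) (w : Fin n → ℂ) (r : ℝ) :
    Lp ℂ 2 (volume.restrict D) :=
  ((volume.real (closedBall (0 : Fin n → ℂ) r) : ℂ)⁻¹) •
    indicatorConstLp 2 (measurableSet_closedBall (x := w) (ε := r))
      ((Measure.restrict_apply_le _ _).trans_lt measure_closedBall_lt_top).ne (1 : ℂ)

theorem inner_bergmanEval {n : ℕ} {f : (Fin n → ℂ) → ℂ} {D : Set (Fin n → ℂ)}
    (hD : IsOpen D) (hf : DifferentiableOn ℂ f D) {w : Fin n → ℂ} {r : ℝ} (hr : 0 < r)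
    (hB : closedBall w r ⊆ D) (g : Lp ℂ 2 (volume.restrict D))
    (hg : g =ᵐ[volume.restrict D] f) : inner ℂ (bergmanEval D w r) g = f w := by
  rw [bergmanEval, inner_smul_left, L2.inner_indicatorConstLp_one,
    Measure.restrict_restrict measurableSet_closedBall, inter_eq_left.2 hB]
  have : ∫ z in closedBall w r, g z = ∫ z in closedBall w r, f z :=
    integral_congr_ae (ae_mono (Measure.restrict_mono hB le_rfl) hg)
  rw [this, integral_closedBall_of_holomorphic hD hf hB]
  have h0 : volume.real (closedBall (0 : Fin n → ℂ) r) ≠ 0 :=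
    (ENNReal.toReal_pos (measure_closedBall_pos _ _ hr).ne' measure_closedBall_lt_top.ne).ne'
  have h0' : (volume.real (closedBall (0 : Fin n → ℂ) r) : ℂ) ≠ 0 := by exact_mod_cast h0
  simp only [map_inv₀, Complex.conj_ofReal]
  field_simp

theorem norm_bergmanEval_le {n : ℕ} (D : Set (Fin n → ℂ)) (r : ℝ) :
    ∃ C : ℝ, 0 ≤ C ∧ ∀ w, ‖bergmanEval D w r‖ ≤ C := by
  refine ⟨(volume.real (closedBall (0 : Fin n → ℂ) r))⁻¹ *
    volume.real (closedBall (0 : Fin n → ℂ) r) ^ (1 / (2 : ENNReal).toReal), by positivity, ?_⟩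
  intro w
  rw [bergmanEval, norm_smul, norm_indicatorConstLp (by simp) (by simp)]
  simp only [norm_inv, Complex.norm_real, norm_one, one_mul, Real.norm_eq_abs,
    abs_of_nonneg measureReal_nonneg]
  gcongr
  have : volume.real (closedBall (0 : Fin n → ℂ) r) = volume.real (closedBall w r) := by
    simp only [Measure.real, Measure.addHaar_closedBall_center volume w r]
  rw [this]
  exact ENNReal.toReal_mono measure_closedBall_lt_top.ne (Measure.restrict_apply_le _ _)

/-- `L²` limits of holomorphic functions are holomorphic (up to null sets). -/
theorem exists_holomorphic_of_tendsto {n : ℕ} {D : Set (Fin n → ℂ)} (hD : IsOpen D)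
    {h : ℕ → (Fin n → ℂ) → ℂ} (hh : ∀ k, DifferentiableOn ℂ (h k) D)
    {g : ℕ → Lp ℂ 2 (volume.restrict D)} {g₀ : Lp ℂ 2 (volume.restrict D)}
    (hgh : ∀ k, g k =ᵐ[volume.restrict D] h k) (hg : Tendsto g atTop (𝓝 g₀)) :
    ∃ h₀, DifferentiableOn ℂ h₀ D ∧ g₀ =ᵐ[volume.restrict D] h₀ := by
  have hball : ∀ w ∈ D, ∃ r > 0, closedBall w r ⊆ D := fun w hw =>
    nhds_basis_closedBall.mem_iff.1 (hD.mem_nhds hw)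
  choose! R hR0 hR using hball
  set h₀ : (Fin n → ℂ) → ℂ := fun w => inner ℂ (bergmanEval D w (R w)) g₀ with hh₀
  have hpt : ∀ w ∈ D, Tendsto (fun k => h k w) atTop (𝓝 (h₀ w)) := by
    intro w hw
    have : ∀ k, h k w = inner ℂ (bergmanEval D w (R w)) (g k) := fun k =>
      (inner_bergmanEval hD (hh k) (hR0 w hw) (hR w hw) (g k) (hgh k)).symm
    simp only [this]
    exact tendsto_const_nhds.inner hg
  refine ⟨h₀, ?_, ?_⟩
  · intro x hx
    set r := R x / 4 with hr
    have hr0 : 0 < r := by have := hR0 x hx; positivity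
    have hsub : ∀ y ∈ ball x r, ∀ z ∈ ball y r, closedBall z r ⊆ D := by
      intro y hy z hz u hu
      apply hR x hx
      rw [mem_ball] at hy hz
      rw [mem_closedBall] at hu ⊢
      linarith [dist_triangle u z x, dist_triangle z y x]
    obtain ⟨C, hC0, hC⟩ := norm_bergmanEval_le D r
    have hxD : ball x r ⊆ D := fun y hy =>
      hsub y hy y (mem_ball_self hr0) (mem_closedBall_self hr0.le)
    have hbd : ∀ k l, ∀ y ∈ ball x r, ∀ z ∈ ball y r, ‖h k z - h l z‖ ≤ C * ‖g k - g l‖ := by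
      intro k l y hy z hz
      rw [← inner_bergmanEval hD (hh k) hr0 (hsub y hy z hz) (g k) (hgh k),
        ← inner_bergmanEval hD (hh l) hr0 (hsub y hy z hz) (g l) (hgh l), ← inner_sub_right]
      refine (norm_inner_le_norm _ _).trans ?_
      gcongr
      exact hC z
    have hder : ∀ k l, ∀ y ∈ ball x r,
        ‖fderiv ℂ (h k) y - fderiv ℂ (h l) y‖ ≤ 2 * (C * ‖g k - g l‖) / r := by
      intro k l y hy
      have hy' := hxD hy
      have hbD : ball y r ⊆ D := fun z hz => hsub y hy z hz (mem_closedBall_self hr0.le)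
      rw [← fderiv_sub ((hh k y hy').differentiableAt (hD.mem_nhds hy'))
        ((hh l y hy').differentiableAt (hD.mem_nhds hy'))]
      refine Complex.norm_fderiv_le_div_of_mapsTo_ball
        (((hh k).sub (hh l)).mono hbD) ?_ hr0
      intro z hz
      rw [mem_closedBall, dist_eq_norm]
      refine (norm_sub_le _ _).trans ?_
      have h1 := hbd k l y hy z hz
      have h2 := hbd k l y hy y (mem_ball_self hr0)
      simp only [Pi.sub_apply]
      linarith
    have hcau : UniformCauchySeqOn (fun k => fderiv ℂ (h k)) atTop (ball x r) := by
      rw [Metric.uniformCauchySeqOn_iff]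
      intro ε hε
      obtain ⟨N, hN⟩ := Metric.cauchySeq_iff.1 hg.cauchySeq (ε * r / (2 * (C + 1))) (by positivity)
      refine ⟨N, fun k hk l hl y hy => ?_⟩
      have h1 := hN k hk l hl
      rw [dist_eq_norm] at h1 ⊢
      refine (hder k l y hy).trans_lt ?_
      rw [lt_div_iff₀ (by positivity)] at h1
      rw [div_lt_iff₀ hr0]
      nlinarith [norm_nonneg (g k - g l)]
    have hlim : ∀ y ∈ ball x r, Tendsto (fun k => fderiv ℂ (h k) y) atTop
        (𝓝 (limUnder atTop fun k => fderiv ℂ (h k) y)) := fun y hy =>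
      (hcau.cauchySeq hy).tendsto_limUnder
    have hunif := hcau.tendstoUniformlyOn_of_tendsto hlim
    have := hasFDerivAt_of_tendstoUniformlyOn isOpen_ball hunif
      (fun k y hy => ((hh k y (hxD hy)).differentiableAt (hD.mem_nhds (hxD hy))).hasFDerivAt)
      (fun y hy => hpt y (hxD hy)) (mem_ball_self hr0)
    exact this.differentiableAt.differentiableWithinAt
  · obtain ⟨ns, hns, hae⟩ := (tendstoInMeasure_of_tendsto_Lp hg).exists_seq_tendsto_ae
    have hall : ∀ᵐ z ∂(volume.restrict D), ∀ k, g k z = h k z := ae_all_iff.2 hgh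
    filter_upwards [hae, hall, ae_restrict_mem hD.measurableSet] with z h1 h2 hz
    simp only [h2] at h1
    exact tendsto_nhds_unique h1 ((hpt z hz).comp hns.tendsto_atTop)

theorem exists_isBergmanKernel {n : ℕ} {D : Set (Fin n → ℂ)} (hD : IsOpen D) :
    ∃ k, IsBergmanKernel D k := by
  let A : Submodule ℂ (Lp ℂ 2 (volume.restrict D)) :=
    { carrier := {g | ∃ h, DifferentiableOn ℂ h D ∧ g =ᵐ[volume.restrict D] h}
      add_mem' := by
        rintro a b ⟨f, hf, haf⟩ ⟨g, hg, hbg⟩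
        exact ⟨f + g, hf.add hg, (Lp.coeFn_add a b).trans (haf.add hbg)⟩
      zero_mem' := ⟨0, differentiableOn_const 0, Lp.coeFn_zero _ _ _⟩
      smul_mem' := by
        rintro c a ⟨f, hf, haf⟩
        exact ⟨c • f, hf.const_smul c, (Lp.coeFn_smul c a).trans (haf.const_smul c)⟩ }
  have hA : IsClosed (A : Set (Lp ℂ 2 (volume.restrict D))) := by
    refine IsSeqClosed.isClosed fun g g₀ hg hlim => ?_
    choose h hh hgh using hg
    exact exists_holomorphic_of_tendsto hD hh hgh hlim
  have : CompleteSpace A := hA.completeSpace_coe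
  have hball : ∀ w ∈ D, ∃ r > 0, closedBall w r ⊆ D := fun w hw =>
    nhds_basis_closedBall.mem_iff.1 (hD.mem_nhds hw)
  choose! R hR0 hR using hball
  have hrep : ∀ w, ∃ h, DifferentiableOn ℂ h D ∧
      (A.orthogonalProjectionOnto (bergmanEval D w (R w)) : Lp ℂ 2 (volume.restrict D))
        =ᵐ[volume.restrict D] h := fun w =>
    (A.orthogonalProjectionOnto (bergmanEval D w (R w))).2
  choose κ hκ hκae using hrep
  refine ⟨fun z w => κ w z, ⟨fun w _ => ⟨hκ w, (Lp.memLp _).ae_eq (hκae w)⟩, ?_⟩⟩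
  rintro h ⟨hh, hh2⟩ w hw
  have hmem : hh2.toLp h ∈ A := ⟨h, hh, hh2.coeFn_toLp⟩
  have h1 := inner_bergmanEval hD hh (hR0 w hw) (hR w hw) _ hh2.coeFn_toLp
  have h2 := Submodule.inner_orthogonalProjectionOnto_eq_of_mem_right
    (⟨hh2.toLp h, hmem⟩ : A) (bergmanEval D w (R w))
  rw [← h1, ← h2, Submodule.coe_inner, L2.inner_def]
  refine integral_congr_ae ?_
  filter_upwards [hκae w, hh2.coeFn_toLp] with z hz1 hz2
  rw [hz1, hz2]
  simp

/-- Uniqueness of the Bergman kernel on `D × D`. -/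
theorem IsBergmanKernel.eq {n : ℕ} {D : Set (Fin n → ℂ)}
    {k k' : (Fin n → ℂ) → (Fin n → ℂ) → ℂ} (hk : IsBergmanKernel D k)
    (hk' : IsBergmanKernel D k') {z w : Fin n → ℂ} (hz : z ∈ D) (hw : w ∈ D) :
    k z w = k' z w := by
  have key : ∀ {a b : (Fin n → ℂ) → (Fin n → ℂ) → ℂ}, IsBergmanKernel D a →
      IsBergmanKernel D b → a z w = star (b w z) := by
    intro a b ha hb
    have h1 := hb.reproducing _ (ha.mem w hw) z hz
    have h2 := ha.reproducing _ (hb.mem z hz) w hw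
    rw [h1, h2]
    simp only [Complex.star_def]
    rw [← integral_conj]
    congr 1
    ext u
    simp [mul_comm]
  rw [key hk hk', ← key hk' hk']

open Classical in
/-- The Bergman kernel `k_D(z, w)` of `D`. For open `D` it exists (`exists_isBergmanKernel`) and is
uniquely determined on `D × D` (`IsBergmanKernel.eq`). -/
noncomputable def bergmanKernel {n : ℕ} (D : Set (Fin n → ℂ)) :
    (Fin n → ℂ) → (Fin n → ℂ) → ℂ :=
  if h : ∃ k, IsBergmanKernel D k then h.choose else 0

theorem isBergmanKernel_bergmanKernel {n : ℕ} {D : Set (Fin n → ℂ)} (hD : IsOpen D) :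
    IsBergmanKernel D (bergmanKernel D) := by
  have h := exists_isBergmanKernel hD
  rw [bergmanKernel, dif_pos h]
  exact h.choose_spec

/-- A bounded domain: a nonempty, open, connected and bounded set. -/
structure IsBoundedDomain {n : ℕ} (D : Set (Fin n → ℂ)) : Prop where
  isOpen : IsOpen D
  isConnected : IsConnected D
  isBounded : Bornology.IsBounded D

/-- `G` is `(m₁, …, mₙ)`-circular: `(λ^{m₁} x₁, …, λ^{mₙ} xₙ) ∈ G` for all `|λ| = 1`, `x ∈ G`. -/
def IsQuasiCircular {n : ℕ} (m : Fin n → ℕ) (G : Set (Fin n → ℂ)) : Prop :=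
  ∀ c : ℂ, ‖c‖ = 1 → ∀ x ∈ G, (fun i => c ^ m i * x i) ∈ G

/-- The set `K̃ = {conj x : x ∈ K}`. -/
def conjSet {n : ℕ} (K : Set (Fin n → ℂ)) : Set (Fin n → ℂ) :=
  (fun x => star x) '' K

/-- For every open `K` that is relatively compact in `D` there is an open `U ⊇ closure D` such that
`(z, w) ↦ k_D(z, conj w)`, defined on `D × K̃`, extends to a holomorphic function on `U × K̃`. -/
def BergmanKernelExtends {n : ℕ} (D : Set (Fin n → ℂ)) : Prop :=
  ∀ K : Set (Fin n → ℂ), IsOpen K → IsCompact (closure K) → closure K ⊆ D →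
    ∃ U : Set (Fin n → ℂ), IsOpen U ∧ closure D ⊆ U ∧
      ∃ F : (Fin n → ℂ) × (Fin n → ℂ) → ℂ, DifferentiableOn ℂ F (U ×ˢ conjSet K) ∧
        ∀ z ∈ D, ∀ w ∈ conjSet K, F (z, w) = bergmanKernel D z (star w)

/-- `f` restricts to a proper holomorphic map `D → G`. -/
structure IsProperHolomorphic {n : ℕ} (f : (Fin n → ℂ) → (Fin n → ℂ))
    (D G : Set (Fin n → ℂ)) : Prop where
  mapsTo : MapsTo f D G
  holomorphic : DifferentiableOn ℂ f D
  proper : IsProperMap (mapsTo.restrict f D G)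

/-!
Put `u = det f'`. For `g` in the Bergman space of `D`, the push-forward of `g ū` under the proper
map `f` is a distribution on `G` annihilated by every `∂̄ⱼ`, because the columns of the adjugate of
`f'` are divergence free; by Weyl's lemma it has a holomorphic density `h`. For `g = u` this density
is nonnegative, hence constant, so `u` is square integrable and `∫ |u|² = c vol V` over the preimage
of every open `V ⊆ G`. This also shows that `u` does not vanish identically: otherwise a small
generic perturbation of `f` is proper over a ball, there `c` is its degree, hence at least `1`, but
its determinant is uniformly small.

Let `q` be a weighted homogeneous polynomial. Expanding `h` into weighted homogeneous components
around `0` shows that `∫_G h q̄ = C ∫_{tG} h q̄`, with `tG` a weighted dilate of `G` contained in a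
small ball. Pulling back to `D` and taking `g = k_D(·, z)`, the reproducing property expresses
`u (q ∘ f)` as an integral of `k_D(z, ·)` against a function supported in a compact subset of `D`,
so the hypothesis on the kernel extends `u (q ∘ f)` to a neighbourhood of the closure of `D`.

With `q = zᵢ ^ k` all the functions `u fᵢ ^ k` extend, to `Hₖ` say, and `H₁ ^ k H₀ = H₀ ^ k Hₖ`.
Comparing vanishing orders on complex lines, `H₀` divides `H₁`, and the quotient extends `fᵢ`.
-/

section SeveralComplexVariables

variable {E F X : Type*} [NormedAddCommGroup E] [NormedSpace ℂ E] [NormedAddCommGroup F]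
  [NormedSpace ℂ F]

theorem aestronglyMeasurable_fderiv_apply [MeasurableSpace X] {μ : Measure X} {f : E → X → F}
    {z : E} (hm : ∀ᶠ y in 𝓝 z, AEStronglyMeasurable (f y) μ)
    (hd : ∀ᵐ x ∂μ, DifferentiableAt ℂ (fun y => f y x) z) (v : E) :
    AEStronglyMeasurable (fun x => fderiv ℂ (fun y => f y x) z v) μ := by
  have hlim : Tendsto (fun k : ℕ => z + ((k : ℂ))⁻¹ • v) atTop (𝓝 z) := by
    simpa using tendsto_const_nhds.add
      ((tendsto_inv_atTop_nhds_zero_nat (𝕜 := ℂ)).smul_const v)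
  obtain ⟨N, hN⟩ := eventually_atTop.1 (hlim.eventually hm)
  refine aestronglyMeasurable_of_tendsto_ae atTop
    (f := fun k x => ((k + N : ℕ) : ℂ) • (f (z + ((k + N : ℕ) : ℂ)⁻¹ • v) x - f z x)) ?_ ?_
  · exact fun k => ((hN _ (Nat.le_add_left _ _)).sub hm.self_of_nhds).const_smul _
  · filter_upwards [hd] with x hx
    refine (tendsto_add_atTop_iff_nat N).2 (hx.hasFDerivAt.lim v (c := fun k : ℕ => (k : ℂ)) ?_)
    simpa only [Complex.norm_natCast] using tendsto_natCast_atTop_atTop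

theorem aestronglyMeasurable_clm_of_apply [FiniteDimensional ℂ E] [MeasurableSpace X]
    {μ : Measure X} {φ : X → E →L[ℂ] F} (h : ∀ v, AEStronglyMeasurable (fun x => φ x v) μ) :
    AEStronglyMeasurable φ μ := by
  let b := Module.finBasis ℂ E
  have hsum : φ = fun x => ∑ i, ContinuousLinearMap.smulRightL ℂ E F
      (LinearMap.toContinuousLinearMap (b.coord i)) (φ x (b i)) := by
    ext x v
    conv_lhs => rw [← b.sum_repr v, map_sum]
    simp
  rw [hsum]
  exact Finset.aestronglyMeasurable_fun_sum _ fun i _ =>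
    (ContinuousLinearMap.continuous _).comp_aestronglyMeasurable (h (b i))

/- The Lipschitz bound needed to differentiate under the integral sign is the Schwarz lemma, so a
bound on the values suffices. -/
theorem differentiableOn_integral_of_dominated [FiniteDimensional ℂ E] [MeasurableSpace X]
    {μ : Measure X} {f : E → X → F} {U : Set E} (hU : IsOpen U)
    (hm : ∀ z ∈ U, AEStronglyMeasurable (f z) μ)
    (hd : ∀ᵐ x ∂μ, DifferentiableOn ℂ (fun z => f z x) U)
    (hb : ∀ z ∈ U, ∃ ε > 0, ∃ b : X → ℝ, Integrable b μ ∧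
      ∀ᵐ x ∂μ, ∀ y ∈ ball z ε, y ∈ U → ‖f y x‖ ≤ b x) :
    DifferentiableOn ℂ (fun z => ∫ x, f z x ∂μ) U := by
  intro z hz
  obtain ⟨ε₁, hε₁, b, hbi, hbd⟩ := hb z hz
  obtain ⟨ε₂, hε₂, hεU⟩ := Metric.isOpen_iff.1 hU z hz
  set ε := min ε₁ ε₂
  have hε : 0 < ε := lt_min hε₁ hε₂
  have hsubU : ball z ε ⊆ U := (ball_subset_ball (min_le_right _ _)).trans hεU
  have hsub : ball z ε ⊆ ball z ε₁ := ball_subset_ball (min_le_left _ _)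
  have hdz : ∀ᵐ x ∂μ, DifferentiableAt ℂ (fun y => f y x) z := by
    filter_upwards [hd] with x hx using hx.differentiableAt (hU.mem_nhds hz)
  have hmeas : AEStronglyMeasurable (fun x => fderiv ℂ (fun y => f y x) z) μ :=
    aestronglyMeasurable_clm_of_apply
      (aestronglyMeasurable_fderiv_apply (eventually_of_mem (hU.mem_nhds hz) hm) hdz)
  have hint : Integrable (f z) μ :=
    hbi.mono' (hm z hz) (by filter_upwards [hbd] with x hx using hx z (mem_ball_self hε₁) hz)
  have hlip : ∀ᵐ x ∂μ, ∀ y ∈ ball z ε, ‖f y x - f z x‖ ≤ (b x + b x) / ε * ‖y - z‖ := by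
    filter_upwards [hbd, hd] with x hx hdx y hy
    have hmaps : MapsTo (fun y => f y x) (ball z ε) (closedBall (f z x) (b x + b x)) := by
      intro y hy
      rw [mem_closedBall, dist_eq_norm]
      exact (norm_sub_le _ _).trans
        (add_le_add (hx y (hsub hy) (hsubU hy)) (hx z (mem_ball_self hε₁) hz))
    simpa only [dist_eq_norm] using
      Complex.dist_le_div_mul_dist_of_mapsTo_ball (hdx.mono hsubU) hmaps hy
  exact (hasFDerivAt_integral_of_dominated_loc_of_lip' (ball_mem_nhds z hε)
    (fun y hy => hm y (hsubU hy)) hint hmeas hlip ((hbi.add hbi).div_const _)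
    (hdz.mono fun x hx => hx.hasFDerivAt)).2.differentiableAt.differentiableWithinAt

theorem differentiableOn_setIntegral_of_continuousOn [FiniteDimensional ℂ E] [TopologicalSpace X]
    [T2Space X] [SecondCountableTopology X] [MeasurableSpace X] [BorelSpace X] {μ : Measure X}
    {f : E → X → F} {a : X → ℂ} {U : Set E} {K : Set X} (hU : IsOpen U) (hK : IsCompact K)
    (hc : ContinuousOn (Function.uncurry f) (U ×ˢ K))
    (hd : ∀ x ∈ K, DifferentiableOn ℂ (fun z => f z x) U) (ha : IntegrableOn a K μ) :
    DifferentiableOn ℂ (fun z => ∫ x in K, a x • f z x ∂μ) U := by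
  have : ProperSpace E := FiniteDimensional.proper ℂ E
  refine differentiableOn_integral_of_dominated hU ?_ ?_ ?_
  · refine fun z hz => ha.aestronglyMeasurable.smul
      (ContinuousOn.aestronglyMeasurable ?_ hK.measurableSet)
    exact hc.comp (f := fun x => (z, x)) (by fun_prop) fun x hx => ⟨hz, hx⟩
  · filter_upwards [ae_restrict_mem hK.measurableSet] with x hx using (hd x hx).const_smul _
  · intro z hz
    obtain ⟨ε, hε, hεU⟩ := nhds_basis_closedBall.mem_iff.1 (hU.mem_nhds hz)
    obtain ⟨C, hC⟩ := ((isCompact_closedBall z ε).prod hK).exists_bound_of_continuousOn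
      (hc.mono (prod_mono hεU le_rfl))
    refine ⟨ε, hε, fun x => ‖a x‖ * C, ha.norm.mul_const C, ?_⟩
    filter_upwards [ae_restrict_mem hK.measurableSet] with x hx y hy _
    rw [norm_smul]
    gcongr
    exact hC (y, x) ⟨ball_subset_closedBall hy, hx⟩

theorem differentiableOn_circleIntegral [FiniteDimensional ℂ E] {f : E → ℂ → F} {U : Set E}
    {c : ℂ} {R : ℝ} (hU : IsOpen U) (hR : 0 ≤ R)
    (hc : ContinuousOn (Function.uncurry f) (U ×ˢ sphere c R))
    (hd : ∀ ζ ∈ sphere c R, DifferentiableOn ℂ (fun z => f z ζ) U) :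
    DifferentiableOn ℂ (fun z => ∮ ζ in C(c, R), f z ζ) U := by
  have hmem : ∀ θ, circleMap c R θ ∈ sphere c R := circleMap_mem_sphere c hR
  have := continuous_circleMap c R
  simp only [circleIntegral, intervalIntegral.integral_of_le Real.two_pi_pos.le,
    ← integral_Icc_eq_integral_Ioc]
  refine differentiableOn_setIntegral_of_continuousOn (f := fun z θ => f z (circleMap c R θ)) hU
    isCompact_Icc ?_ (fun θ _ => hd _ (hmem θ)) (ContDiff.continuous_deriv_one
      (contDiff_circleMap c R)).integrableOn_Icc
  exact hc.comp (f := fun p : E × ℝ => (p.1, circleMap c R p.2)) (by fun_prop)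
    fun p hp => ⟨hp.1, hmem _⟩

theorem differentiableOn_circleAverage [FiniteDimensional ℂ E] {f : E → ℂ → F} {U : Set E}
    {c : ℂ} {R : ℝ} (hU : IsOpen U) (hR : 0 < R)
    (hc : ContinuousOn (Function.uncurry f) (U ×ˢ sphere c R))
    (hd : ∀ ζ ∈ sphere c R, DifferentiableOn ℂ (fun z => f z ζ) U) :
    DifferentiableOn ℂ (fun z => Real.circleAverage (f z) c R) U := by
  have hinv : ContinuousOn (fun p : E × ℂ => (p.2 - c)⁻¹) (U ×ˢ sphere c R) :=
    (continuousOn_snd.sub continuousOn_const).inv₀ fun p hp =>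
      sub_ne_zero.2 (ne_of_mem_sphere hp.2 hR.ne')
  simp only [Real.circleAverage_eq_circleIntegral hR.ne']
  exact (differentiableOn_circleIntegral (f := fun z ζ => (ζ - c)⁻¹ • f z ζ) hU hR.le
    (hinv.smul hc) fun ζ hζ => (hd ζ hζ).const_smul _).const_smul _

theorem fderiv_apply_eq_circleIntegral [CompleteSpace F] {h : E → F} {U : Set E} (hU : IsOpen U)
    (hh : DifferentiableOn ℂ h U) {z v : E} {R : ℝ} (hR : 0 < R)
    (hzv : ∀ ζ ∈ closedBall (0 : ℂ) R, z + ζ • v ∈ U) :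
    fderiv ℂ h z v = (2 * Real.pi * Complex.I : ℂ)⁻¹ •
      ∮ ζ in C(0, R), (1 / (ζ - 0) ^ 2) • h (z + ζ • v) := by
  have hline : DiffContOnCl ℂ (fun ζ : ℂ => h (z + ζ • v)) (ball 0 R) := by
    refine DifferentiableOn.diffContOnCl_ball (U := closedBall 0 R) ?_ le_rfl
    exact hh.comp (f := fun ζ : ℂ => z + ζ • v) (by fun_prop) hzv
  have hz : z ∈ U := by simpa using hzv 0 (mem_closedBall_self hR.le)
  have hderiv : deriv (fun ζ : ℂ => h (z + ζ • v)) 0 = fderiv ℂ h z v :=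
    (hh.differentiableAt (hU.mem_nhds hz)).hasFDerivAt.hasLineDerivAt v |>.deriv
  rw [← hderiv, hline.deriv_eq_smul_circleIntegral hR, inv_smul_smul₀ Complex.two_pi_I_ne_zero]

theorem differentiableOn_fderiv_apply [FiniteDimensional ℂ E] [CompleteSpace F] {h : E → F}
    {U : Set E} (hU : IsOpen U) (hh : DifferentiableOn ℂ h U) (v : E) :
    DifferentiableOn ℂ (fun z => fderiv ℂ h z v) U := by
  intro z₀ hz₀
  obtain ⟨r, hr, hrU⟩ := Metric.isOpen_iff.1 hU z₀ hz₀
  obtain ⟨R, hR, hRv⟩ : ∃ R : ℝ, 0 < R ∧ R * ‖v‖ < r / 2 := by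
    refine ⟨r / 2 / (‖v‖ + 1), by positivity, ?_⟩
    rw [div_mul_eq_mul_div, div_lt_iff₀ (by positivity)]
    nlinarith [norm_nonneg v]
  have hmem : ∀ z ∈ ball z₀ (r / 2), ∀ ζ ∈ closedBall (0 : ℂ) R, z + ζ • v ∈ U := by
    intro z hz ζ hζ
    apply hrU
    rw [mem_ball, dist_eq_norm] at hz ⊢
    rw [mem_closedBall_zero_iff] at hζ
    calc ‖z + ζ • v - z₀‖ = ‖(z - z₀) + ζ • v‖ := by congr 1; abel
      _ ≤ ‖z - z₀‖ + ‖ζ‖ * ‖v‖ := (norm_add_le _ _).trans (by rw [norm_smul])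
      _ < r := by nlinarith [norm_nonneg v, norm_nonneg ζ]
  have hz₀' : ball z₀ (r / 2) ∈ 𝓝 z₀ := ball_mem_nhds z₀ (by positivity)
  have hcauchy : DifferentiableOn ℂ (fun z => (2 * Real.pi * Complex.I : ℂ)⁻¹ •
      ∮ ζ in C(0, R), (1 / (ζ - 0) ^ 2) • h (z + ζ • v)) (ball z₀ (r / 2)) := by
    refine (differentiableOn_circleIntegral isOpen_ball hR.le ?_ fun ζ hζ => ?_).const_smul _
    · refine ContinuousOn.smul ?_ (hh.continuousOn.comp (f := fun p : E × ℂ => p.1 + p.2 • v)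
        (by fun_prop) fun p hp => hmem _ hp.1 _ (sphere_subset_closedBall hp.2))
      refine continuousOn_const.div (by fun_prop) fun p hp => pow_ne_zero 2 ?_
      exact sub_ne_zero.2 (ne_of_mem_sphere hp.2 hR.ne')
    · exact (hh.comp (f := fun z => z + ζ • v) (by fun_prop) fun z hz =>
        hmem z hz ζ (sphere_subset_closedBall hζ)).const_smul _
  refine ((hcauchy.differentiableAt hz₀').congr_of_eventuallyEq ?_).differentiableWithinAt
  filter_upwards [hz₀'] with z hz using fderiv_apply_eq_circleIntegral hU hh hR (hmem z hz)

theorem contDiffOn_of_differentiableOn_complex [FiniteDimensional ℂ E] [CompleteSpace F]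
    {h : E → F} {U : Set E} (hU : IsOpen U) (hh : DifferentiableOn ℂ h U) (k : ℕ) :
    ContDiffOn ℂ k h U := by
  induction k generalizing h with
  | zero => exact contDiffOn_zero.2 hh.continuousOn
  | succ k ih =>
    rw [Nat.cast_succ, contDiffOn_succ_iff_fderiv_of_isOpen hU]
    exact ⟨hh, by simp, contDiffOn_clm_apply.2 fun v => ih (differentiableOn_fderiv_apply hU hh v)⟩

theorem differentiableOn_fderiv [FiniteDimensional ℂ E] [CompleteSpace F] {h : E → F}
    {U : Set E} (hU : IsOpen U) (hh : DifferentiableOn ℂ h U) :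
    DifferentiableOn ℂ (fderiv ℂ h) U :=
  ((contDiffOn_succ_iff_fderiv_of_isOpen (n := 1) hU).1
    (contDiffOn_of_differentiableOn_complex hU hh 2)).2.2.differentiableOn one_ne_zero

theorem fderiv_fderiv_apply_comm [FiniteDimensional ℂ E] [CompleteSpace F] {h : E → F}
    {U : Set E} (hU : IsOpen U) (hh : DifferentiableOn ℂ h U) {z : E} (hz : z ∈ U) (v w : E) :
    fderiv ℂ (fun x => fderiv ℂ h x v) z w = fderiv ℂ (fun x => fderiv ℂ h x w) z v := by
  have hd : DifferentiableAt ℂ (fderiv ℂ h) z :=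
    (differentiableOn_fderiv hU hh).differentiableAt (hU.mem_nhds hz)
  have hsymm : IsSymmSndFDerivAt ℂ h z :=
    ((contDiffOn_of_differentiableOn_complex hU hh 2).contDiffAt (hU.mem_nhds hz))
      |>.isSymmSndFDerivAt (by simp)
  simpa [fderiv_clm_apply hd (differentiableAt_const _)] using hsymm w v

theorem eqOn_of_convex_of_eventuallyEq_holomorphic [CompleteSpace F] {f g : E → F} {U : Set E}
    (hU : IsOpen U) (hUc : Convex ℝ U) (hf : DifferentiableOn ℂ f U)
    (hg : DifferentiableOn ℂ g U) {y : E} (hy : y ∈ U) (h : f =ᶠ[𝓝 y] g) : EqOn f g U := by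
  intro z hz
  let line : ℂ → E := AffineMap.lineMap y z
  have hline : Continuous line := AffineMap.lineMap_continuous
  have hconv : Convex ℝ (line ⁻¹' U) :=
    (hUc.translate_preimage_left y).linear_preimage
      ((LinearMap.toSpanSingleton ℂ E (z - y)).restrictScalars ℝ)
  have hanalytic : ∀ k : E → F, DifferentiableOn ℂ k U → AnalyticOnNhd ℂ (k ∘ line) (line ⁻¹' U) :=
    fun k hk => (hk.comp (AffineMap.lineMap y z : ℂ →ᵃ[ℂ] E).differentiableOn
      fun _ hζ => hζ).analyticOnNhd (hU.preimage hline)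
  have hev : f ∘ line =ᶠ[𝓝 0] g ∘ line :=
    (hline.tendsto' 0 y (AffineMap.lineMap_apply_zero _ _)).eventually h
  simpa [line] using (hanalytic f hf).eqOn_of_preconnected_of_eventuallyEq (hanalytic g hg)
    hconv.isPreconnected (by simpa [line] using hy) hev (show (1 : ℂ) ∈ _ by simpa [line] using hz)

theorem eqOn_of_preconnected_of_eventuallyEq_holomorphic [CompleteSpace F] {f g : E → F}
    {U : Set E} (hU : IsOpen U) (hUc : IsPreconnected U) (hf : DifferentiableOn ℂ f U)
    (hg : DifferentiableOn ℂ g U) {z₀ : E} (hz₀ : z₀ ∈ U) (h : f =ᶠ[𝓝 z₀] g) : EqOn f g U := by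
  have hopen : IsOpen {z | f =ᶠ[𝓝 z] g} := isOpen_setOfPred_eventually_nhds
  have hsub : U ⊆ {z | f =ᶠ[𝓝 z] g} := by
    refine hUc.subset_of_closure_inter_subset hopen ⟨z₀, hz₀, h⟩ ?_
    rintro x ⟨hx, hxU⟩
    obtain ⟨r, hr, hrU⟩ := Metric.isOpen_iff.1 hU x hxU
    obtain ⟨y, hyx, hy⟩ := mem_closure_iff_nhds.1 hx _ (ball_mem_nhds x hr)
    exact (eqOn_of_convex_of_eventuallyEq_holomorphic isOpen_ball (convex_ball x r)
      (hf.mono hrU) (hg.mono hrU) hyx hy).eventuallyEq_of_mem (ball_mem_nhds x hr)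
  exact fun z hz => (hsub hz).self_of_nhds

theorem subset_closure_ne_zero_of_holomorphic [CompleteSpace F] {f : E → F} {U : Set E}
    (hU : IsOpen U) (hUc : IsPreconnected U) (hf : DifferentiableOn ℂ f U) {z₀ : E} (hz₀ : z₀ ∈ U)
    (h : f z₀ ≠ 0) : U ⊆ closure {z ∈ U | f z ≠ 0} := by
  intro x hx
  by_contra hcl
  have hzero : f =ᶠ[𝓝 x] fun _ => 0 := by
    filter_upwards [isClosed_closure.isOpen_compl.mem_nhds hcl, hU.mem_nhds hx] with z hz hzU
    exact by_contra fun h0 => hz (subset_closure ⟨hzU, h0⟩)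
  exact h (eqOn_of_preconnected_of_eventuallyEq_holomorphic hU hUc hf
    (differentiableOn_const 0) hx hzero hz₀)

end SeveralComplexVariables

section Dbar

variable {E F : Type*} [NormedAddCommGroup E] [NormedSpace ℂ E] [NormedAddCommGroup F]
  [NormedSpace ℂ F]

theorem map_complex_smul_eq_re_add_im (L : E →L[ℝ] ℂ) (c : ℂ) (v : E) :
    L (c • v) = c.re * L v + c.im * L (Complex.I • v) := by
  have hc : c • v = c.re • v + c.im • Complex.I • v := by
    conv_lhs => rw [← Complex.re_add_im c, add_smul, mul_smul]
    simp only [Complex.coe_smul]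
  simp only [hc, map_add, map_smul, Complex.real_smul]

/-- Twice the conjugate-linear part of a real-linear functional. For the real derivative of a
function this is `2 ∂̄`; it vanishes exactly when the functional is complex linear. -/
noncomputable def dbar (L : E →L[ℝ] ℂ) : E →ₗ⋆[ℂ] ℂ where
  toFun v := L v + Complex.I * L (Complex.I • v)
  map_add' v w := by simp only [smul_add, map_add]; ring
  map_smul' c v := by
    have hI : L (Complex.I • Complex.I • v) = -L v := by
      rw [smul_smul, Complex.I_mul_I, neg_one_smul, map_neg]
    have hc : (starRingEnd ℂ) c = c.re - c.im * Complex.I := by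
      apply Complex.ext <;> simp
    rw [smul_comm Complex.I c v, map_complex_smul_eq_re_add_im L c v,
      map_complex_smul_eq_re_add_im L c, hI, hc, smul_eq_mul]
    linear_combination (c.im * L (Complex.I • v)) * Complex.I_sq

theorem dbar_apply (L : E →L[ℝ] ℂ) (v : E) : dbar L v = L v + Complex.I * L (Complex.I • v) := rfl

theorem differentiableAt_complex_of_dbar_eq_zero {h : E → ℂ} {L : E →L[ℝ] ℂ} {x : E}
    (hL : HasFDerivAt h L x) (h0 : dbar L = 0) : DifferentiableAt ℂ h x := by
  have hI : ∀ v, L (Complex.I • v) = Complex.I * L v := fun v => by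
    have hv : L v + Complex.I * L (Complex.I • v) = 0 := LinearMap.congr_fun h0 v
    linear_combination (-Complex.I) * hv + L (Complex.I • v) * Complex.I_sq
  let L' : E →L[ℂ] ℂ :=
    { toFun := L
      map_add' := map_add L
      map_smul' := fun c v => by
        rw [map_complex_smul_eq_re_add_im, hI, RingHom.id_apply, smul_eq_mul]
        linear_combination L v * Complex.re_add_im c
      cont := L.cont }
  exact (hasFDerivAt_of_restrictScalars ℝ (f' := L') hL rfl).differentiableAt

theorem dbar_fderiv_mul {φ ψ : E → ℂ} {w : E} (hφ : DifferentiableAt ℝ φ w)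
    (hψ : DifferentiableAt ℝ ψ w) (v : E) :
    dbar (fderiv ℝ (fun z => φ z * ψ z) w) v =
      φ w * dbar (fderiv ℝ ψ w) v + ψ w * dbar (fderiv ℝ φ w) v := by
  rw [fderiv_fun_mul hφ hψ]
  simp only [dbar_apply, add_apply, smul_apply, smul_eq_mul]
  ring

theorem dbar_fderiv_of_differentiableAt {g : E → ℂ} {w : E} (hg : DifferentiableAt ℂ g w) :
    dbar (fderiv ℝ g w) = 0 := by
  ext v
  rw [hg.fderiv_restrictScalars ℝ]
  simp only [dbar_apply, ContinuousLinearMap.coe_restrictScalars', map_smul, smul_eq_mul,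
    LinearMap.zero_apply]
  linear_combination fderiv ℂ g w v * Complex.I_sq

theorem dbar_fderiv_star {g : E → ℂ} {w : E} (hg : DifferentiableAt ℂ g w) (v : E) :
    dbar (fderiv ℝ (fun z => star (g z)) w) v = 2 * star (fderiv ℂ g w v) := by
  have hstar : HasFDerivAt (fun z => star (g z))
      ((Complex.conjCLE : ℂ →L[ℝ] ℂ).comp ((fderiv ℂ g w).restrictScalars ℝ)) w :=
    (Complex.conjCLE : ℂ →L[ℝ] ℂ).hasFDerivAt.comp w (hg.hasFDerivAt.restrictScalars ℝ)
  rw [hstar.fderiv]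
  simp only [dbar_apply, ContinuousLinearMap.comp_apply, ContinuousLinearMap.coe_restrictScalars',
    map_smul, smul_eq_mul, ContinuousLinearEquiv.coe_coe, Complex.conjCLE_apply, map_mul,
    Complex.conj_I, Complex.star_def]
  linear_combination (-(starRingEnd ℂ) (fderiv ℂ g w v)) * Complex.I_sq

theorem dbar_fderiv_comp {ψ : F → ℂ} {f : E → F} {w : E} (hψ : DifferentiableAt ℝ ψ (f w))
    (hf : DifferentiableAt ℂ f w) (v : E) :
    dbar (fderiv ℝ (fun z => ψ (f z)) w) v = dbar (fderiv ℝ ψ (f w)) (fderiv ℂ f w v) := by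
  have hcomp : HasFDerivAt (fun z => ψ (f z))
      ((fderiv ℝ ψ (f w)).comp ((fderiv ℂ f w).restrictScalars ℝ)) w :=
    hψ.hasFDerivAt.comp w (hf.hasFDerivAt.restrictScalars ℝ)
  simp only [hcomp.fderiv, dbar_apply, ContinuousLinearMap.comp_apply,
    ContinuousLinearMap.coe_restrictScalars', map_smul]

end Dbar

section CircularMollifier

variable {n : ℕ}

/-- A continuous function `ψ` with compact support contained in `G`: a test function on `G`. -/
structure IsCompactlySupportedIn (G : Set (Fin n → ℂ)) (ψ : (Fin n → ℂ) → ℂ) : Prop where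
  continuous : Continuous ψ
  hasCompactSupport : HasCompactSupport ψ
  tsupport_subset : tsupport ψ ⊆ G

theorem IsCompactlySupportedIn.integrable {G : Set (Fin n → ℂ)} {ψ : (Fin n → ℂ) → ℂ}
    (hψ : IsCompactlySupportedIn G ψ) : Integrable ψ :=
  hψ.continuous.integrable_of_hasCompactSupport hψ.hasCompactSupport

theorem exists_isCompactlySupportedIn_eqOn_one {G K : Set (Fin n → ℂ)} (hG : IsOpen G)
    (hK : IsCompact K) (hKG : K ⊆ G) :
    ∃ χ : (Fin n → ℂ) → ℂ, IsCompactlySupportedIn G χ ∧ EqOn χ 1 K ∧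
      ∀ x, ‖χ x‖ ≤ 1 ∧ χ x = ‖χ x‖ := by
  obtain ⟨χ, hχ1, hχc, hχG, hχ01⟩ := exists_continuousMap_one_of_isCompact_subset_isOpen hK hG hKG
  have hsub : tsupport (fun x => (χ x : ℂ)) ⊆ tsupport χ := by
    refine closure_mono fun x hx h => hx ?_
    simp only [h, Complex.ofReal_zero]
  refine ⟨fun x => (χ x : ℂ), ⟨by fun_prop, hχc.of_isClosed_subset (isClosed_tsupport _) hsub,
    hsub.trans hχG⟩, fun x hx => by simp [hχ1 hx], fun x => ?_⟩
  rw [Complex.norm_real, Real.norm_of_nonneg (hχ01 x).1]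
  exact ⟨(hχ01 x).2, rfl⟩

/-- A nonnegative `C¹` function of integral `1`, supported in the closed `ε`-ball and invariant
under multiplication by unimodular scalars. It is complex-valued, nonnegativity being expressed by
`ρ v = ‖ρ v‖`. -/
structure IsCircularMollifier (ρ : (Fin n → ℂ) → ℂ) (ε : ℝ) : Prop where
  contDiff : ContDiff ℝ 1 ρ
  nonneg : ∀ v, ρ v = ‖ρ v‖
  circular : ∀ (c : ℂ) v, ‖c‖ = 1 → ρ (c • v) = ρ v
  support_subset : Function.support ρ ⊆ closedBall 0 ε
  integral_eq : ∫ v, ρ v = 1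

theorem exists_isCircularMollifier (n : ℕ) {ε : ℝ} (hε : 0 < ε) :
    ∃ ρ : (Fin n → ℂ) → ℂ, IsCircularMollifier ρ ε := by
  let p : (Fin n → ℂ) → ℝ := fun v => Real.smoothTransition (1 - (∑ i, ‖v i‖ ^ 2) / ε ^ 2)
  have hp : ContDiff ℝ 1 p := by
    refine (Real.smoothTransition.contDiff (n := 1)).comp ?_
    refine contDiff_const.sub (ContDiff.div_const (ContDiff.sum fun i _ => ?_) _)
    exact (contDiff_apply ℝ ℂ i).norm_sq ℝ
  have hp0 : ∀ v, 0 ≤ p v := fun v => Real.smoothTransition.nonneg _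
  have hps : Function.support p ⊆ closedBall 0 ε := by
    intro v hv
    rw [mem_closedBall_zero_iff, pi_norm_le_iff_of_nonneg hε.le]
    intro i
    by_contra! hlt
    refine hv (Real.smoothTransition.zero_of_nonpos ?_)
    have hle : ‖v i‖ ^ 2 ≤ ∑ i, ‖v i‖ ^ 2 :=
      Finset.single_le_sum (f := fun i => ‖v i‖ ^ 2) (fun _ _ => by positivity) (Finset.mem_univ i)
    have hε2 : ε ^ 2 ≤ ‖v i‖ ^ 2 := by gcongr
    rw [sub_nonpos, one_le_div (by positivity)]
    linarith
  have hpc : HasCompactSupport p :=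
    HasCompactSupport.intro (isCompact_closedBall 0 ε) fun v hv =>
      Function.notMem_support.1 fun h => hv (hps h)
  have hpos : 0 < ∫ v, p v := by
    refine hp.continuous.integral_pos_of_hasCompactSupport_nonneg_nonzero (x := 0) hpc hp0 ?_
    simp [p]
  refine ⟨fun v => (((∫ v, p v)⁻¹ * p v : ℝ) : ℂ), ?_, fun v => ?_, fun c v hc => ?_,
    fun v hv => hps fun h => hv ?_, ?_⟩
  · exact Complex.ofRealCLM.contDiff.comp (contDiff_const.mul hp)
  · rw [Complex.norm_real, Real.norm_of_nonneg (mul_nonneg (inv_nonneg.2 hpos.le) (hp0 v))]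
  · simp [p, hc]
  · simp [h]
  · rw [integral_complex_ofReal, integral_const_mul, inv_mul_cancel₀ hpos.ne',
      Complex.ofReal_one]

namespace IsCircularMollifier

variable {ρ : (Fin n → ℂ) → ℂ} {ε : ℝ}

theorem apply_eq_zero (hρ : IsCircularMollifier ρ ε) {v : Fin n → ℂ} (hv : v ∉ closedBall 0 ε) :
    ρ v = 0 :=
  Function.notMem_support.1 fun h => hv (hρ.support_subset h)

theorem apply_sub_eq_zero (hρ : IsCircularMollifier ρ ε) {y z : Fin n → ℂ} (h : ε < dist y z) :
    ρ (y - z) = 0 :=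
  hρ.apply_eq_zero (by rwa [mem_closedBall_zero_iff, ← dist_eq_norm, not_le])

theorem tsupport_subset (hρ : IsCircularMollifier ρ ε) : tsupport ρ ⊆ closedBall 0 ε :=
  closure_minimal hρ.support_subset isClosed_closedBall

theorem fderiv_sub_eq_zero (hρ : IsCircularMollifier ρ ε) {y z : Fin n → ℂ} (h : ε < dist y z) :
    fderiv ℝ ρ (y - z) = 0 :=
  Function.notMem_support.1 fun hsupp => h.not_ge <| by
    rw [dist_eq_norm, ← mem_closedBall_zero_iff]
    exact hρ.tsupport_subset (support_fderiv_subset ℝ hsupp)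

theorem hasCompactSupport (hρ : IsCircularMollifier ρ ε) : HasCompactSupport ρ :=
  HasCompactSupport.intro (isCompact_closedBall 0 ε) fun _ => hρ.apply_eq_zero

theorem integrable (hρ : IsCircularMollifier ρ ε) : Integrable ρ :=
  hρ.contDiff.continuous.integrable_of_hasCompactSupport hρ.hasCompactSupport

theorem exists_bound (hρ : IsCircularMollifier ρ ε) : ∃ M, 0 ≤ M ∧ ∀ v, ‖ρ v‖ ≤ M :=
  have ⟨M, hM⟩ := hρ.hasCompactSupport.exists_bound_of_continuous hρ.contDiff.continuous
  ⟨M, (norm_nonneg _).trans (hM 0), hM⟩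

theorem apply_neg (hρ : IsCircularMollifier ρ ε) (v : Fin n → ℂ) : ρ (-v) = ρ v := by
  simpa only [neg_one_smul] using hρ.circular (-1) v (by simp)

theorem apply_sub_comm (hρ : IsCircularMollifier ρ ε) (y z : Fin n → ℂ) :
    ρ (y - z) = ρ (z - y) := by
  rw [← hρ.apply_neg, neg_sub]

theorem isCompactlySupportedIn_comp_const_sub (hρ : IsCircularMollifier ρ ε)
    {G : Set (Fin n → ℂ)} {y : Fin n → ℂ} (hG : closedBall y ε ⊆ G) :
    IsCompactlySupportedIn G fun z => ρ (y - z) := by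
  have htsupport : tsupport (fun z => ρ (y - z)) ⊆ closedBall y ε := by
    refine closure_minimal (fun z hz => ?_) isClosed_closedBall
    rw [mem_closedBall']
    exact not_lt.1 fun h => hz (hρ.apply_sub_eq_zero h)
  exact ⟨hρ.contDiff.continuous.comp (by fun_prop),
    (isCompact_closedBall y ε).of_isClosed_subset (isClosed_tsupport _) htsupport,
    htsupport.trans hG⟩

theorem norm_integral_mul_sub_le (hρ : IsCircularMollifier ρ ε) {g : (Fin n → ℂ) → ℂ}
    (hg : Continuous g) {z : Fin n → ℂ} {c : ℂ} {η : ℝ} (h : ∀ y ∈ closedBall z ε, ‖g y - c‖ ≤ η) :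
    ‖(∫ y, g y * ρ (y - z)) - c‖ ≤ η := by
  have hρz : Integrable fun y => ρ (y - z) := hρ.integrable.comp_sub_right z
  have hnorm : ∫ y, ‖ρ (y - z)‖ = 1 := by
    have hint := hρ.integral_eq
    rw [← integral_sub_right_eq_self _ z,
      integral_congr_ae (Eventually.of_forall fun y => hρ.nonneg (y - z)),
      integral_complex_ofReal] at hint
    exact_mod_cast hint
  have hgρ : Integrable fun y => g y * ρ (y - z) := by
    refine Continuous.integrable_of_hasCompactSupport
      (hg.mul (hρ.contDiff.continuous.comp (continuous_sub_right z)))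
      (HasCompactSupport.mul_left ?_)
    exact hρ.hasCompactSupport.comp_homeomorph (Homeomorph.subRight z)
  have hsub : (∫ y, g y * ρ (y - z)) - c = ∫ y, (g y - c) * ρ (y - z) := by
    simp only [sub_mul]
    rw [integral_sub hgρ (hρz.const_mul c), integral_const_mul,
      integral_sub_right_eq_self ρ, hρ.integral_eq, mul_one]
  calc ‖(∫ y, g y * ρ (y - z)) - c‖ = ‖∫ y, (g y - c) * ρ (y - z)‖ := by rw [hsub]
    _ ≤ ∫ y, η * ‖ρ (y - z)‖ := by
        refine norm_integral_le_of_norm_le (hρz.norm.const_mul η)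
          (Eventually.of_forall fun y => ?_)
        rw [norm_mul]
        by_cases hy : y ∈ closedBall z ε
        · gcongr
          exact h y hy
        · rw [hρ.apply_sub_eq_zero (not_le.1 hy), norm_zero, mul_zero, mul_zero]
    _ = η := by rw [integral_const_mul, hnorm, mul_one]

theorem tendsto_integral_mul {ρ : ℕ → (Fin n → ℂ) → ℂ} {ε : ℕ → ℝ}
    (hρ : ∀ k, IsCircularMollifier (ρ k) (ε k)) (hε : Tendsto ε atTop (𝓝 0))
    {ψ : (Fin n → ℂ) → ℂ} (hψ : Continuous ψ) (z : Fin n → ℂ) :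
    Tendsto (fun k => ∫ y, ψ y * ρ k (y - z)) atTop (𝓝 (ψ z)) := by
  rw [Metric.tendsto_nhds]
  intro η hη
  obtain ⟨δ, hδ, hδψ⟩ := Metric.continuous_iff.1 hψ z (η / 2) (by positivity)
  filter_upwards [hε.eventually_lt_const hδ] with k hk
  rw [dist_eq_norm]
  refine ((hρ k).norm_integral_mul_sub_le hψ fun y hy => ?_).trans_lt (half_lt_self hη)
  rw [← dist_eq_norm]
  exact (hδψ y ((mem_closedBall.1 hy).trans_lt hk)).le

end IsCircularMollifier

theorem integral_comp_unit_smul (g : (Fin n → ℂ) → ℂ) {c : ℂ} (hc : ‖c‖ = 1) :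
    ∫ v, g (c • v) = ∫ v, g v := by
  have hmp : MeasurePreserving (fun v : Fin n → ℂ => c • v) volume volume :=
    volume_preserving_pi (f := fun _ (z : ℂ) => c * z) fun _ =>
      (rotation ⟨c, by simp [Submonoid.unitSphere, hc]⟩).measurePreserving
  have hne : c ≠ 0 := norm_ne_zero_iff.1 (hc ▸ one_ne_zero)
  exact hmp.integral_comp
    (Continuous.measurableEmbedding (by fun_prop) (smul_right_injective _ hne)) g

theorem intervalIntegral_comp_add_circleMap_smul {f : (Fin n → ℂ) → ℂ} {D : Set (Fin n → ℂ)}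
    (hD : IsOpen D) (hf : DifferentiableOn ℂ f D) {w v : Fin n → ℂ}
    (hv : ∀ l : ℂ, ‖l‖ ≤ 1 → w + l • v ∈ D) :
    ∫ θ in (0 : ℝ)..2 * Real.pi, f (w + circleMap 0 1 θ • v) = 2 * Real.pi * f w := by
  have hd : ∀ l ∈ closedBall (0 : ℂ) |1|, DifferentiableAt ℂ (fun l : ℂ => f (w + l • v)) l := by
    intro l hl
    have hmem := hv l (by simpa using hl)
    exact DifferentiableAt.comp (g := f) (f := fun l : ℂ => w + l • v) l
      ((hf _ hmem).differentiableAt (hD.mem_nhds hmem)) (by fun_prop)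
  have haverage := circleAverage_of_differentiable_on_off_countable (c := 0) (R := 1)
    (f := fun l : ℂ => f (w + l • v)) countable_empty
    (fun l hl => (hd l hl).continuousAt.continuousWithinAt)
    (fun l hl => hd l (ball_subset_closedBall hl.1))
  simp only [Real.circleAverage_def, zero_smul, add_zero] at haverage
  rw [← haverage, Complex.real_smul]
  push_cast
  field_simp

theorem add_smul_mem_closedBall {E : Type*} [SeminormedAddCommGroup E] [NormedSpace ℂ E]
    {w v : E} {r : ℝ} {l : ℂ} (hl : ‖l‖ ≤ 1) (hv : v ∈ closedBall 0 r) :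
    w + l • v ∈ closedBall w r := by
  rw [mem_closedBall, dist_eq_norm, add_sub_cancel_left, norm_smul]
  exact (mul_le_of_le_one_left (norm_nonneg v) hl).trans (mem_closedBall_zero_iff.1 hv)

theorem integrable_uncurry_mul_comp_add_circleMap_smul {f ρ : (Fin n → ℂ) → ℂ}
    {D : Set (Fin n → ℂ)} (hf : ContinuousOn f D) {w : Fin n → ℂ} {r : ℝ}
    (hB : closedBall w r ⊆ D) (hρ : Continuous ρ) :
    Integrable (Function.uncurry fun (θ : ℝ) v => ρ v * f (w + circleMap 0 1 θ • v))
      ((volume.restrict (uIoc 0 (2 * Real.pi))).prod (volume.restrict (closedBall 0 r))) := by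
  rw [Measure.prod_restrict, ← Measure.volume_eq_prod]
  have hcont : ContinuousOn (Function.uncurry fun (θ : ℝ) v =>
      ρ v * f (w + circleMap 0 1 θ • v)) (Icc 0 (2 * Real.pi) ×ˢ closedBall 0 r) := by
    have := continuous_circleMap 0 1
    exact (by fun_prop : ContinuousOn (fun p : ℝ × (Fin n → ℂ) => ρ p.2) _).mul
      (hf.comp (f := fun p : ℝ × (Fin n → ℂ) => w + circleMap 0 1 p.1 • p.2)
        (by fun_prop) fun p hp => hB (add_smul_mem_closedBall (by simp) hp.2))
  refine (hcont.integrableOn_compact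
    (isCompact_Icc.prod (isCompact_closedBall _ _))).mono_set (prod_mono ?_ subset_rfl)
  rw [uIoc_of_le (by positivity)]
  exact Ioc_subset_Icc_self

theorem integral_mul_of_circular {f ρ : (Fin n → ℂ) → ℂ} {D : Set (Fin n → ℂ)}
    (hD : IsOpen D) (hf : DifferentiableOn ℂ f D) {w : Fin n → ℂ} {r : ℝ}
    (hB : closedBall w r ⊆ D) (hρ : Continuous ρ)
    (hc : ∀ (c : ℂ) v, ‖c‖ = 1 → ρ (c • v) = ρ v) (hs : Function.support ρ ⊆ closedBall 0 r) :
    ∫ v, ρ v * f (w + v) = (∫ v, ρ v) * f w := by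
  set B := closedBall (0 : Fin n → ℂ) r
  have hset : ∀ g : (Fin n → ℂ) → ℂ, ∫ v in B, ρ v * g v = ∫ v, ρ v * g v := fun g =>
    setIntegral_eq_integral_of_forall_compl_eq_zero fun v hv => by
      rw [Function.notMem_support.1 fun h => hv (hs h), zero_mul]
  have hrotate (θ : ℝ) :
      ∫ v in B, ρ v * f (w + circleMap 0 1 θ • v) = ∫ v, ρ v * f (w + v) := by
    have hθ : ‖circleMap 0 1 θ‖ = 1 := by simp
    rw [hset, ← integral_comp_unit_smul (fun v => ρ v * f (w + v)) hθ]
    simp only [hc _ _ hθ]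
  have hpi : (2 * Real.pi : ℂ) ≠ 0 := by simp
  refine mul_left_cancel₀ hpi ?_
  calc 2 * Real.pi * ∫ v, ρ v * f (w + v)
      = ∫ θ in (0 : ℝ)..2 * Real.pi, ∫ v in B, ρ v * f (w + circleMap 0 1 θ • v) := by
        simp only [hrotate, intervalIntegral.integral_const, sub_zero, Complex.real_smul]
        push_cast
        rfl
    _ = ∫ v in B, ∫ θ in (0 : ℝ)..2 * Real.pi, ρ v * f (w + circleMap 0 1 θ • v) :=
        intervalIntegral_integral_swap
          (integrable_uncurry_mul_comp_add_circleMap_smul hf.continuousOn hB hρ)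
    _ = ∫ v in B, ρ v * (2 * Real.pi * f w) := by
        refine setIntegral_congr_fun measurableSet_closedBall fun v hv => ?_
        simp only [intervalIntegral.integral_const_mul]
        rw [intervalIntegral_comp_add_circleMap_smul hD hf fun l hl =>
          hB (add_smul_mem_closedBall hl hv)]
    _ = 2 * Real.pi * ((∫ v, ρ v) * f w) := by
        rw [hset fun _ => 2 * Real.pi * f w, integral_mul_const]
        ring

end CircularMollifier

theorem norm_smul_le_of_norm_le_of_mem {X Y F : Type*} [NormedAddCommGroup F]
    [NormedSpace ℂ F] {f : X → Y} {a : X → ℂ} {K : Set Y} {b : X → ℝ}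
    (hb : ∀ x, 0 ≤ b x) (hab : ∀ x, f x ∈ K → ‖a x‖ ≤ b x) {M : ℝ} (hM : 0 ≤ M) {x : X} {φ : F}
    (hφ : ‖φ‖ ≤ M) (hφ0 : f x ∉ K → φ = 0) : ‖a x • φ‖ ≤ M * b x := by
  by_cases hx : f x ∈ K
  · rw [norm_smul, mul_comm]
    exact mul_le_mul hφ (hab x hx) (norm_nonneg _) hM
  · rw [hφ0 hx, smul_zero, norm_zero]
    exact mul_nonneg hM (hb x)

section Weyl

variable {n : ℕ} {X : Type*} [MeasurableSpace X] {μ : Measure X} {f : X → Fin n → ℂ} {a : X → ℂ}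
  {G K : Set (Fin n → ℂ)}

/-- The push-forward `f_* (a μ)` is a complex Radon measure on `G`, stated without assuming that `f`
maps into `G`: the pairing of `a μ` with `ψ ∘ f` converges for every test function `ψ` on `G`. -/
structure IsRadonPushforward (μ : Measure X) (f : X → Fin n → ℂ) (a : X → ℂ)
    (G : Set (Fin n → ℂ)) : Prop where
  aestronglyMeasurable_map : AEStronglyMeasurable f μ
  aestronglyMeasurable_weight : AEStronglyMeasurable a μ
  integrable : ∀ ψ, IsCompactlySupportedIn G ψ → Integrable (fun x => a x * ψ (f x)) μ

/-- The complex Radon measure `f_* (a μ)` satisfies `∂̄ (f_* (a μ)) = 0` on `G` in the sense of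
distributions. -/
structure IsDbarClosedPushforward (μ : Measure X) (f : X → Fin n → ℂ) (a : X → ℂ)
    (G : Set (Fin n → ℂ)) : Prop extends IsRadonPushforward μ f a G where
  integral_dbar : ∀ ψ, IsCompactlySupportedIn G ψ → ContDiff ℝ 1 ψ → ∀ v,
    ∫ x, a x * dbar (fderiv ℝ ψ (f x)) v ∂μ = 0

theorem IsRadonPushforward.exists_integrable_bound (ha : IsRadonPushforward μ f a G)
    (hG : IsOpen G) (hK : IsCompact K) (hKG : K ⊆ G) :
    ∃ b : X → ℝ, Integrable b μ ∧ (∀ x, 0 ≤ b x) ∧ ∀ x, f x ∈ K → ‖a x‖ ≤ b x := by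
  obtain ⟨χ, hχ, hχ1, -⟩ := exists_isCompactlySupportedIn_eqOn_one hG hK hKG
  refine ⟨fun x => ‖a x * χ (f x)‖, (ha.integrable χ hχ).norm, fun x => norm_nonneg _,
    fun x hx => ?_⟩
  simp [hχ1 hx]

theorem isOpen_setOf_closedBall_subset {E : Type*} [PseudoMetricSpace E] (G : Set E) (ε : ℝ) :
    IsOpen {y | ∃ s > ε, closedBall y s ⊆ G} := by
  rw [Metric.isOpen_iff]
  rintro y ⟨s, hs, hsG⟩
  refine ⟨(s - ε) / 2, by linarith, fun z hz => ⟨ε + (s - ε) / 2, by linarith, ?_⟩⟩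
  refine (closedBall_subset_closedBall' ?_).trans hsG
  rw [mem_ball] at hz
  linarith

/-- Mollification `y ↦ ∫ a ρ(y - f)` of the complex measure `f_* (a μ)`. -/
noncomputable def pushMollify (μ : Measure X) (f : X → Fin n → ℂ) (a : X → ℂ)
    (ρ : (Fin n → ℂ) → ℂ) (y : Fin n → ℂ) : ℂ :=
  ∫ x, a x * ρ (y - f x) ∂μ

variable {ρ σ : (Fin n → ℂ) → ℂ} {ε δ s : ℝ} {y : Fin n → ℂ}

theorem hasFDerivAt_pushMollify (ha : IsRadonPushforward μ f a G) (hG : IsOpen G)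
    (hρ : IsCircularMollifier ρ ε) (hs : ε < s) (hsG : closedBall y s ⊆ G) :
    Integrable (fun x => a x • fderiv ℝ ρ (y - f x)) μ ∧
      HasFDerivAt (pushMollify μ f a ρ) (∫ x, a x • fderiv ℝ ρ (y - f x) ∂μ) y := by
  obtain ⟨b, hb, hb0, hab⟩ := ha.exists_integrable_bound hG (isCompact_closedBall y s) hsG
  have hρd : Continuous (fderiv ℝ ρ) := hρ.contDiff.continuous_fderiv (by simp)
  obtain ⟨C, hC⟩ := (hρ.hasCompactSupport.fderiv (𝕜 := ℝ)).exists_bound_of_continuous hρd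
  have hC0 : 0 ≤ C := (norm_nonneg _).trans (hC 0)
  have hfar {z : Fin n → ℂ} {x : X} (hz : z ∈ ball y (s - ε)) (hx : f x ∉ closedBall y s) :
      ε < dist z (f x) := by
    rw [mem_closedBall, not_le] at hx
    rw [mem_ball] at hz
    linarith [dist_triangle_left (f x) y z]
  have hbound : ∀ x, ∀ z ∈ ball y (s - ε), ‖a x • fderiv ℝ ρ (z - f x)‖ ≤ C * b x :=
    fun x z hz => norm_smul_le_of_norm_le_of_mem hb0 hab hC0 (hC _)
      fun hx => hρ.fderiv_sub_eq_zero (hfar hz hx)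
  have hy : y ∈ ball y (s - ε) := mem_ball_self (sub_pos.2 hs)
  have hsub : ∀ z, AEStronglyMeasurable (fun x => z - f x) μ := fun z =>
    aestronglyMeasurable_const.sub ha.aestronglyMeasurable_map
  have hmeas' : AEStronglyMeasurable (fun x => a x • fderiv ℝ ρ (y - f x)) μ :=
    ha.aestronglyMeasurable_weight.smul (hρd.comp_aestronglyMeasurable (hsub y))
  refine ⟨(hb.const_mul C).mono' hmeas' (Eventually.of_forall fun x => hbound x y hy),
    hasFDerivAt_integral_of_dominated_of_fderiv_le (𝕜 := ℝ)
      (F := fun y x => a x * ρ (y - f x)) (F' := fun y x => a x • fderiv ℝ ρ (y - f x))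
      (bound := fun x => C * b x) (ball_mem_nhds y (sub_pos.2 hs)) ?_ ?_ hmeas'
      (Eventually.of_forall hbound) (hb.const_mul C) (Eventually.of_forall fun x z _ => ?_)⟩
  · exact Eventually.of_forall fun z => ha.aestronglyMeasurable_weight.mul
      (hρ.contDiff.continuous.comp_aestronglyMeasurable (hsub z))
  · exact ha.integrable _ (hρ.isCompactlySupportedIn_comp_const_sub
      ((closedBall_subset_closedBall hs.le).trans hsG))
  · exact (((hρ.contDiff.differentiable (by simp) (z - f x)).hasFDerivAt).comp z
      ((hasFDerivAt_id z).sub_const (f x))).const_smul (a x)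

theorem differentiableOn_pushMollify (ha : IsDbarClosedPushforward μ f a G) (hG : IsOpen G)
    (hρ : IsCircularMollifier ρ ε) :
    DifferentiableOn ℂ (pushMollify μ f a ρ) {y | ∃ s > ε, closedBall y s ⊆ G} := by
  rintro y ⟨s, hs, hsG⟩
  obtain ⟨hint, hderiv⟩ := hasFDerivAt_pushMollify ha.toIsRadonPushforward hG hρ hs hsG
  refine (differentiableAt_complex_of_dbar_eq_zero hderiv ?_).differentiableWithinAt
  ext v
  have hfderiv : ∀ x, fderiv ℝ (fun z => ρ (y - z)) (f x) = -fderiv ℝ ρ (y - f x) := by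
    intro x
    have hderiv := ((hρ.contDiff.differentiable (by simp) (y - f x)).hasFDerivAt).comp (f x)
      ((hasFDerivAt_id (f x)).const_sub y)
    simpa [Function.comp_def] using hderiv.fderiv
  have hclosed := ha.integral_dbar _ (hρ.isCompactlySupportedIn_comp_const_sub
    ((closedBall_subset_closedBall hs.le).trans hsG))
    (hρ.contDiff.comp (contDiff_const.sub contDiff_id)) v
  have hintv : ∀ v, Integrable (fun x => a x * fderiv ℝ ρ (y - f x) v) μ := fun v =>
    hint.apply_continuousLinearMap v
  have happly : ∀ v, (∫ x, a x • fderiv ℝ ρ (y - f x) ∂μ) v =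
      ∫ x, a x * fderiv ℝ ρ (y - f x) v ∂μ :=
    ContinuousLinearMap.integral_apply hint
  rw [dbar_apply, happly, happly, ← integral_const_mul,
    ← integral_add (hintv _) ((hintv _).const_mul _), LinearMap.zero_apply, ← neg_eq_zero,
    ← integral_neg, ← hclosed]
  refine integral_congr_ae (Eventually.of_forall fun x => ?_)
  simp only [hfderiv, dbar_apply, neg_apply]
  ring

theorem integrable_prod_mollifier [SFinite μ] (ha : IsRadonPushforward μ f a G) (hG : IsOpen G)
    (hK : IsCompact K) (hKG : K ⊆ G) (hρ : IsCircularMollifier ρ ε) {φ : (Fin n → ℂ) → ℂ}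
    (hφ : Integrable φ) (hφK : ∀ v, φ v ≠ 0 → closedBall v ε ⊆ K) :
    Integrable (Function.uncurry fun v x => φ v * (a x * ρ (v - f x))) (volume.prod μ) := by
  obtain ⟨b, hb, hb0, hab⟩ := ha.exists_integrable_bound hG hK hKG
  obtain ⟨M, hM0, hM⟩ := hρ.exists_bound
  refine ((hφ.norm.mul_prod hb).const_mul M).mono' ?_ (Eventually.of_forall ?_)
  · refine hφ.aestronglyMeasurable.comp_fst.mul (ha.aestronglyMeasurable_weight.comp_snd.mul ?_)
    exact hρ.contDiff.continuous.comp_aestronglyMeasurable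
      (measurable_fst.aestronglyMeasurable.sub ha.aestronglyMeasurable_map.comp_snd)
  · rintro ⟨v, x⟩
    by_cases hv : φ v = 0
    · simp [hv]
    have hρK : f x ∉ K → ρ (v - f x) = 0 := fun hx =>
      hρ.apply_sub_eq_zero <| by
        rw [dist_comm]
        exact not_le.1 fun h => hx (hφK v hv h)
    calc ‖φ v * (a x • ρ (v - f x))‖ = ‖φ v‖ * ‖a x • ρ (v - f x)‖ := norm_mul _ _
      _ ≤ ‖φ v‖ * (M * b x) := by
        gcongr
        exact norm_smul_le_of_norm_le_of_mem hb0 hab hM0 (hM _) hρK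
      _ = M * (‖φ v‖ * b x) := by ring

theorem integral_mul_pushMollify [SFinite μ] (ha : IsRadonPushforward μ f a G) (hG : IsOpen G)
    (hK : IsCompact K) (hKG : K ⊆ G) (hρ : IsCircularMollifier ρ ε) {φ : (Fin n → ℂ) → ℂ}
    (hφ : Integrable φ) (hφK : ∀ v, φ v ≠ 0 → closedBall v ε ⊆ K) :
    ∫ v, φ v * pushMollify μ f a ρ v = ∫ x, a x * (∫ v, φ v * ρ (v - f x)) ∂μ := by
  simp only [pushMollify, ← integral_const_mul]
  rw [integral_integral_swap (integrable_prod_mollifier ha hG hK hKG hρ hφ hφK)]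
  simp only [mul_left_comm]

theorem pushMollify_eq_integral_mul (ha : IsDbarClosedPushforward μ f a G) (hG : IsOpen G)
    (hρ : IsCircularMollifier ρ ε) (hσ : IsCircularMollifier σ δ) (hs : ε + δ < s)
    (hsG : closedBall y s ⊆ G) :
    pushMollify μ f a ρ y = ∫ v, σ (v - y) * pushMollify μ f a ρ v := by
  rw [← integral_add_left_eq_self _ y]
  simp only [add_sub_cancel_left]
  rw [integral_mul_of_circular (isOpen_setOf_closedBall_subset G ε)
    (differentiableOn_pushMollify ha hG hρ) (r := δ) (fun z hz => ?_)
    hσ.contDiff.continuous hσ.circular hσ.support_subset, hσ.integral_eq, one_mul]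
  refine ⟨s - δ, by linarith, (closedBall_subset_closedBall' ?_).trans hsG⟩
  rw [mem_closedBall] at hz
  linarith

theorem pushMollify_eq_pushMollify [SFinite μ] (ha : IsDbarClosedPushforward μ f a G)
    (hG : IsOpen G) (hρ : IsCircularMollifier ρ ε) (hσ : IsCircularMollifier σ δ) (hs : ε + δ < s)
    (hsG : closedBall y s ⊆ G) :
    pushMollify μ f a ρ y = pushMollify μ f a σ y := by
  have hpair {ρ σ : (Fin n → ℂ) → ℂ} {ε δ : ℝ} (hρ : IsCircularMollifier ρ ε)
      (hσ : IsCircularMollifier σ δ) (hs : ε + δ < s) :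
      pushMollify μ f a ρ y = ∫ x, a x * (∫ v, σ (v - y) * ρ (v - f x)) ∂μ := by
    rw [pushMollify_eq_integral_mul ha hG hρ hσ hs hsG]
    refine integral_mul_pushMollify ha.toIsRadonPushforward hG (isCompact_closedBall y s) hsG hρ
      (hσ.integrable.comp_sub_right y) fun v hv => closedBall_subset_closedBall' ?_
    have hvy := not_lt.1 fun h => hv (hσ.apply_sub_eq_zero h)
    linarith
  rw [hpair hρ hσ hs, hpair hσ hρ (by linarith)]
  refine integral_congr_ae (Eventually.of_forall fun x => congrArg (a x * ·) ?_)
  -- The point reflection `v ↦ y + f x - v` exchanges the centres `y` and `f x`.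
  rw [← integral_sub_left_eq_self (fun v => σ (v - y) * ρ (v - f x)) volume (y + f x)]
  refine integral_congr_ae (Eventually.of_forall fun v => ?_)
  have hy : y + f x - v - y = f x - v := by abel
  have hx : y + f x - v - f x = y - v := by abel
  simp only [hy, hx]
  rw [hσ.apply_sub_comm, hρ.apply_sub_comm, mul_comm]

theorem exists_holomorphic_eq_pushMollify [SFinite μ] (ha : IsDbarClosedPushforward μ f a G)
    (hG : IsOpen G) :
    ∃ h, DifferentiableOn ℂ h G ∧ ∀ ⦃ρ ε y s⦄, IsCircularMollifier ρ ε → 0 < ε → ε < s →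
      closedBall y s ⊆ G → pushMollify μ f a ρ y = h y := by
  choose! ρ hρ using fun ε (hε : 0 < ε) => exists_isCircularMollifier n hε
  choose! R hR0 hR using fun y (hy : y ∈ G) => nhds_basis_closedBall.mem_iff.1 (hG.mem_nhds hy)
  set h : (Fin n → ℂ) → ℂ := fun y => pushMollify μ f a (ρ (R y / 3)) y
  have heq : ∀ ⦃σ ε y s⦄, IsCircularMollifier σ ε → 0 < ε → ε < s → closedBall y s ⊆ G →
      pushMollify μ f a σ y = h y := by
    intro σ ε y s hσ hε hεs hs
    have hRy := hR0 y (hs (mem_closedBall_self (hε.trans hεs).le))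
    have hδ : 0 < min (s - ε) (R y) / 3 := by
      have : 0 < min (s - ε) (R y) := lt_min (sub_pos.2 hεs) hRy
      positivity
    have hδs := min_le_left (s - ε) (R y)
    have hδR := min_le_right (s - ε) (R y)
    -- Radii `ε` and `R y / 3` are compared through a third one small enough for both.
    calc pushMollify μ f a σ y = pushMollify μ f a (ρ (min (s - ε) (R y) / 3)) y :=
          pushMollify_eq_pushMollify ha hG hσ (hρ _ hδ) (by linarith) hs
      _ = h y := pushMollify_eq_pushMollify ha hG (hρ _ hδ) (hρ _ (by positivity)) (by linarith)
          (hR y (hs (mem_closedBall_self (hε.trans hεs).le)))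
  refine ⟨h, fun y hy => ?_, heq⟩
  have hRy := hR0 y hy
  have hmem : y ∈ {z | ∃ s > R y / 3, closedBall z s ⊆ G} := ⟨R y, by linarith, hR y hy⟩
  have hdiff := (differentiableOn_pushMollify ha hG (hρ (R y / 3) (by positivity)) y
    hmem).differentiableAt ((isOpen_setOf_closedBall_subset _ _).mem_nhds hmem)
  refine (hdiff.congr_of_eventuallyEq ?_).differentiableWithinAt
  filter_upwards [ball_mem_nhds y (by positivity : 0 < R y / 3)] with z hz
  refine (heq (s := 2 * R y / 3) (hρ (R y / 3) (by positivity)) (by positivity) (by linarith)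
    ((closedBall_subset_closedBall' ?_).trans (hR y hy))).symm
  rw [mem_ball] at hz
  linarith

theorem tendsto_integral_mul_integral_mollifier [SFinite μ] (ha : IsRadonPushforward μ f a G)
    (hG : IsOpen G) {ψ : (Fin n → ℂ) → ℂ} (hψ : IsCompactlySupportedIn G ψ) {r : ℝ}
    (hrG : cthickening r (tsupport ψ) ⊆ G) {ρ : ℕ → (Fin n → ℂ) → ℂ} {ε : ℕ → ℝ}
    (hρ : ∀ k, IsCircularMollifier (ρ k) (ε k)) (hεr : ∀ k, ε k ≤ r)
    (hε : Tendsto ε atTop (𝓝 0)) :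
    Tendsto (fun k => ∫ x, a x * (∫ v, ψ v * ρ k (v - f x)) ∂μ) atTop
      (𝓝 (∫ x, a x * ψ (f x) ∂μ)) := by
  have hK : IsCompact (cthickening r (tsupport ψ)) := hψ.hasCompactSupport.isCompact.cthickening
  have hball : ∀ {v}, v ∈ tsupport ψ → ∀ k, closedBall v (ε k) ⊆ cthickening r (tsupport ψ) :=
    fun hv k => (closedBall_subset_closedBall (hεr k)).trans (closedBall_subset_cthickening hv r)
  obtain ⟨b, hb, hb0, hab⟩ := ha.exists_integrable_bound hG hK hrG
  obtain ⟨C, hC⟩ := hψ.hasCompactSupport.exists_bound_of_continuous hψ.continuous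
  have hbound : ∀ k z, ‖∫ v, ψ v * ρ k (v - z)‖ ≤ C := fun k z => by
    simpa only [sub_zero] using (hρ k).norm_integral_mul_sub_le (c := 0) hψ.continuous
      fun v _ => by simpa only [sub_zero] using hC v
  have hzero : ∀ k z, z ∉ cthickening r (tsupport ψ) → ∫ v, ψ v * ρ k (v - z) = 0 := by
    refine fun k z hz => integral_eq_zero_of_ae (Eventually.of_forall fun v => ?_)
    by_cases hv : v ∈ tsupport ψ
    · have hdist : ε k < dist v z := by
        rw [dist_comm]
        exact not_le.1 fun h => hz (hball hv k h)
      simp only [(hρ k).apply_sub_eq_zero hdist, mul_zero, Pi.zero_apply]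
    · simp only [image_eq_zero_of_notMem_tsupport hv, zero_mul, Pi.zero_apply]
  refine tendsto_integral_of_dominated_convergence (fun x => C * b x) (fun k => ?_)
    (hb.const_mul C) (fun k => Eventually.of_forall fun x => ?_)
    (Eventually.of_forall fun x =>
      (IsCircularMollifier.tendsto_integral_mul hρ hε hψ.continuous (f x)).const_mul _)
  · have hint := (integrable_prod_mollifier ha hG hK hrG (hρ k) hψ.integrable fun v hv =>
      hball (subset_tsupport ψ hv) k).integral_prod_right
    refine hint.aestronglyMeasurable.congr (Eventually.of_forall fun x => ?_)
    simp only [Function.uncurry, mul_left_comm (ψ _), integral_const_mul]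
  · exact norm_smul_le_of_norm_le_of_mem hb0 hab ((norm_nonneg _).trans (hC 0)) (hbound k (f x))
      (hzero k (f x))

/-- **Weyl's lemma** for `∂̄`. -/
theorem IsDbarClosedPushforward.exists_holomorphic_density [SFinite μ]
    (ha : IsDbarClosedPushforward μ f a G) (hG : IsOpen G) :
    ∃ h : (Fin n → ℂ) → ℂ, DifferentiableOn ℂ h G ∧ ∀ ψ, IsCompactlySupportedIn G ψ →
      ∫ x, a x * ψ (f x) ∂μ = ∫ y, h y * ψ y := by
  obtain ⟨h, hh, heq⟩ := exists_holomorphic_eq_pushMollify ha hG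
  refine ⟨h, hh, fun ψ hψ => ?_⟩
  obtain ⟨r, hr, hrG⟩ := hψ.hasCompactSupport.isCompact.exists_cthickening_subset_open hG
    hψ.tsupport_subset
  have hε0 (k : ℕ) : 0 < r / (k + 2) := by positivity
  have hεr (k : ℕ) : r / (k + 2) < r :=
    div_lt_self hr (by linarith [(Nat.cast_nonneg k : (0 : ℝ) ≤ k)])
  have hε : Tendsto (fun k : ℕ => r / ((k : ℝ) + 2)) atTop (𝓝 0) :=
    tendsto_const_nhds.div_atTop (tendsto_atTop_add_const_right _ _ tendsto_natCast_atTop_atTop)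
  choose ρ hρ using fun k => exists_isCircularMollifier n (hε0 k)
  refine tendsto_nhds_unique (tendsto_integral_mul_integral_mollifier ha.toIsRadonPushforward hG hψ
    hrG hρ (fun k => (hεr k).le) hε) (tendsto_const_nhds.congr fun k => ?_)
  rw [← integral_mul_pushMollify ha.toIsRadonPushforward hG
    hψ.hasCompactSupport.isCompact.cthickening hrG (hρ k) hψ.integrable fun v hv =>
      (closedBall_subset_closedBall (hεr k).le).trans
        (closedBall_subset_cthickening (subset_tsupport ψ hv) r)]
  refine integral_congr_ae (Eventually.of_forall fun y => ?_)
  by_cases hy : y ∈ tsupport ψ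
  · simp only [heq (hρ k) (hε0 k) (hεr k) ((closedBall_subset_cthickening hy r).trans hrG),
      mul_comm]
  · simp only [image_eq_zero_of_notMem_tsupport hy, mul_zero, zero_mul]

end Weyl

section Jacobian

theorem fderiv_det_eq_sum {ι 𝕜 E : Type*} [Fintype ι] [DecidableEq ι] [NontriviallyNormedField 𝕜]
    [NormedAddCommGroup E] [NormedSpace 𝕜 E] {M : E → Matrix ι ι 𝕜} {w : E}
    (hM : ∀ i j, DifferentiableAt 𝕜 (fun z => M z i j) w) (v : E) :
    fderiv 𝕜 (fun z => (M z).det) w v =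
      ∑ l, ((M w).updateCol l fun k => fderiv 𝕜 (fun z => M z k l) w v).det := by
  have hleibniz : HasFDerivAt (fun z => (M z).det) (∑ σ : Equiv.Perm ι,
      ((Equiv.Perm.sign σ : ℤ) : 𝕜) • ∑ l, (∏ m ∈ Finset.univ.erase l, M w (σ m) m) •
        fderiv 𝕜 (fun z => M z (σ l) l) w) w := by
    simp only [Matrix.det_apply']
    exact HasFDerivAt.fun_sum fun σ _ => HasFDerivAt.const_mul
      (HasFDerivAt.finsetProd fun l _ => (hM (σ l) l).hasFDerivAt) _
  rw [hleibniz.fderiv]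
  simp only [Matrix.det_apply', sum_apply, smul_apply, smul_eq_mul]
  rw [Finset.sum_comm]
  refine Finset.sum_congr rfl fun σ _ => ?_
  rw [Finset.mul_sum]
  refine Finset.sum_congr rfl fun l _ => ?_
  rw [← Finset.mul_prod_erase Finset.univ _ (Finset.mem_univ l), Matrix.updateCol_self,
    mul_comm (∏ m ∈ _, _)]
  congr 2
  exact Finset.prod_congr rfl fun m hm => by rw [Matrix.updateCol_ne (Finset.ne_of_mem_erase hm)]

theorem differentiableOn_det {ι 𝕜 E : Type*} [Fintype ι] [DecidableEq ι]
    [NontriviallyNormedField 𝕜] [NormedAddCommGroup E] [NormedSpace 𝕜 E] {M : E → Matrix ι ι 𝕜}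
    {D : Set E} (hM : ∀ i j, DifferentiableOn 𝕜 (fun z => M z i j) D) :
    DifferentiableOn 𝕜 (fun z => (M z).det) D := by
  simp only [Matrix.det_apply']
  refine DifferentiableOn.fun_sum fun σ _ => DifferentiableOn.const_mul (fun z hz => ?_) _
  exact (HasFDerivWithinAt.finsetProd fun l _ =>
    (hM (σ l) l z hz).hasFDerivWithinAt).differentiableWithinAt

theorem differentiableOn_updateCol {ι 𝕜 E : Type*} [DecidableEq ι] [NontriviallyNormedField 𝕜]
    [NormedAddCommGroup E] [NormedSpace 𝕜 E] {M : E → Matrix ι ι 𝕜} {D : Set E}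
    (hM : ∀ i j, DifferentiableOn 𝕜 (fun z => M z i j) D) (i : ι) (b : ι → 𝕜) (k l : ι) :
    DifferentiableOn 𝕜 (fun z => (M z).updateCol i b k l) D := by
  by_cases h : l = i
  · simp only [h, Matrix.updateCol_self]
    exact differentiableOn_const _
  · simp only [Matrix.updateCol_ne h]
    exact hM k l

theorem adjugate_apply_eq_det_updateCol {ι R : Type*} [Fintype ι] [DecidableEq ι] [CommRing R]
    (A : Matrix ι ι R) (i j : ι) : A.adjugate i j = (A.updateCol i (Pi.single j 1)).det := by
  rw [← Matrix.transpose_apply A.adjugate, Matrix.adjugate_transpose, Matrix.adjugate_apply,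
    Matrix.updateRow_transpose, Matrix.det_transpose]

theorem det_updateCol_updateCol_swap {ι R : Type*} [Fintype ι] [DecidableEq ι] [CommRing R]
    (A : Matrix ι ι R) {i l : ι} (hil : i ≠ l) (b c : ι → R) :
    ((A.updateCol i b).updateCol l c).det = -((A.updateCol l b).updateCol i c).det := by
  have hswap : (A.updateCol i b).updateCol l c =
      ((A.updateCol l b).updateCol i c).submatrix id (Equiv.swap i l) := by
    ext k m
    rw [Matrix.submatrix_apply, id]
    rcases eq_or_ne m i with rfl | hmi
    · rw [Equiv.swap_apply_left, Matrix.updateCol_ne hil, Matrix.updateCol_self,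
        Matrix.updateCol_ne hil.symm, Matrix.updateCol_self]
    rcases eq_or_ne m l with rfl | hml
    · rw [Equiv.swap_apply_right, Matrix.updateCol_self, Matrix.updateCol_self]
    · rw [Equiv.swap_apply_of_ne_of_ne hmi hml, Matrix.updateCol_ne hml,
        Matrix.updateCol_ne hmi, Matrix.updateCol_ne hmi, Matrix.updateCol_ne hml]
  rw [hswap, Matrix.det_permute', Equiv.Perm.sign_swap hil]
  simp

variable {n : ℕ} {f : (Fin n → ℂ) → (Fin n → ℂ)} {D : Set (Fin n → ℂ)} {w : Fin n → ℂ}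

/-- The complex Jacobian matrix of `f` at `w`. -/
noncomputable def jacobianMatrix (f : (Fin n → ℂ) → (Fin n → ℂ)) (w : Fin n → ℂ) :
    Matrix (Fin n) (Fin n) ℂ :=
  Matrix.of fun i j => fderiv ℂ (fun z => f z i) w (Pi.single j 1)

theorem fderiv_apply_eq_jacobianMatrix (hf : DifferentiableAt ℂ f w) (i j : Fin n) :
    fderiv ℂ f w (Pi.single j 1) i = jacobianMatrix f w i j := by
  rw [jacobianMatrix, Matrix.of_apply, (hasFDerivAt_pi'.1 hf.hasFDerivAt i).fderiv]
  rfl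

theorem toLin'_jacobianMatrix (hf : DifferentiableAt ℂ f w) :
    Matrix.toLin' (jacobianMatrix f w) = (fderiv ℂ f w : (Fin n → ℂ) →ₗ[ℂ] (Fin n → ℂ)) := by
  refine (Pi.basisFun ℂ (Fin n)).ext fun j => ?_
  ext i
  rw [Pi.basisFun_apply, Matrix.toLin'_apply, Matrix.mulVec_single_one]
  exact (fderiv_apply_eq_jacobianMatrix hf i j).symm

theorem differentiableOn_jacobianMatrix_apply (hD : IsOpen D) (hf : DifferentiableOn ℂ f D)
    (i j : Fin n) : DifferentiableOn ℂ (fun w => jacobianMatrix f w i j) D :=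
  differentiableOn_fderiv_apply hD (differentiableOn_pi.1 hf i) _

theorem differentiableOn_det_jacobianMatrix (hD : IsOpen D) (hf : DifferentiableOn ℂ f D) :
    DifferentiableOn ℂ (fun w => (jacobianMatrix f w).det) D :=
  differentiableOn_det (differentiableOn_jacobianMatrix_apply hD hf)

theorem differentiableOn_adjugate_jacobianMatrix (hD : IsOpen D) (hf : DifferentiableOn ℂ f D)
    (i j : Fin n) : DifferentiableOn ℂ (fun w => (jacobianMatrix f w).adjugate i j) D := by
  simp only [adjugate_apply_eq_det_updateCol]
  exact differentiableOn_det
    (differentiableOn_updateCol (differentiableOn_jacobianMatrix_apply hD hf) _ _)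

theorem sum_adjugate_jacobianMatrix_smul_fderiv (hf : DifferentiableAt ℂ f w) (j : Fin n) :
    ∑ i, (jacobianMatrix f w).adjugate i j • fderiv ℂ f w (Pi.single i 1) =
      (jacobianMatrix f w).det • (Pi.single j 1 : Fin n → ℂ) := by
  ext k
  have hmul := congrFun₂ (Matrix.mul_adjugate (jacobianMatrix f w)) k j
  simp only [Matrix.mul_apply, Matrix.smul_apply, Matrix.one_apply, smul_eq_mul] at hmul
  simp only [Finset.sum_apply, Pi.smul_apply, smul_eq_mul, fderiv_apply_eq_jacobianMatrix hf,
    Pi.single_apply, mul_comm (Matrix.adjugate _ _ _), hmul]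

/-- The **Piola identity**. -/
theorem sum_fderiv_adjugate_jacobianMatrix_eq_zero (hD : IsOpen D) (hf : DifferentiableOn ℂ f D)
    (j : Fin n) (hw : w ∈ D) :
    ∑ i, fderiv ℂ (fun z => (jacobianMatrix f z).adjugate i j) w (Pi.single i 1) = 0 := by
  set J := jacobianMatrix f w
  let H : Fin n → Fin n → Fin n → ℂ := fun i l k =>
    fderiv ℂ (fun z => jacobianMatrix f z k l) w (Pi.single i 1)
  have hH : ∀ i l, H i l = H l i := fun i l => funext fun k =>
    fderiv_fderiv_apply_comm hD (differentiableOn_pi.1 hf k) hw _ _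
  let a : Fin n → Fin n → ℂ := fun i l =>
    if i = l then 0 else ((J.updateCol i (Pi.single j 1)).updateCol l (H i l)).det
  have ha_antisymm : ∀ i l, a i l = -a l i := by
    intro i l
    by_cases h : i = l
    · simp [a, h]
    · simp only [a, if_neg h, if_neg (Ne.symm h), hH i l]
      exact det_updateCol_updateCol_swap J h _ _
  have hderiv : ∀ i, fderiv ℂ (fun z => (jacobianMatrix f z).adjugate i j) w (Pi.single i 1) =
      ∑ l, a i l := by
    intro i
    simp only [adjugate_apply_eq_det_updateCol]
    rw [fderiv_det_eq_sum (fun k l => (differentiableOn_updateCol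
      (differentiableOn_jacobianMatrix_apply hD hf) i _ k l w hw).differentiableAt
        (hD.mem_nhds hw)) (Pi.single i 1)]
    refine Finset.sum_congr rfl fun l _ => ?_
    by_cases h : i = l
    · subst h
      simp only [a, if_true, Matrix.updateCol_self]
      exact Matrix.det_eq_zero_of_column_eq_zero i fun k => by simp
    · simp only [a, if_neg h, Matrix.updateCol_ne (Ne.symm h), H, J]
  have hneg : ∑ i, ∑ l, a i l = -∑ i, ∑ l, a i l := by
    conv_lhs => rw [Finset.sum_comm]
    simp only [← Finset.sum_neg_distrib]
    exact Finset.sum_congr rfl fun i _ => Finset.sum_congr rfl fun l _ => ha_antisymm l i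
  simp only [hderiv]
  exact CharZero.eq_neg_self_iff.1 hneg

end Jacobian

section PushforwardOfProperMap

theorem contDiff_indicator_of_eq_zero {𝕜 E F : Type*} [NontriviallyNormedField 𝕜]
    [NormedAddCommGroup E] [NormedSpace 𝕜 E] [NormedAddCommGroup F] [NormedSpace 𝕜 F] {k : ℕ}
    {D K : Set E} {h : E → F} (hD : IsOpen D) (hK : IsClosed K) (hKD : K ⊆ D)
    (hh : ContDiffOn 𝕜 k h D) (h0 : ∀ w ∈ D \ K, h w = 0) : ContDiff 𝕜 k (D.indicator h) := by
  refine contDiff_iff_contDiffAt.2 fun w => ?_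
  by_cases hw : w ∈ K
  · refine (hh.contDiffAt (hD.mem_nhds (hKD hw))).congr_of_eventuallyEq ?_
    filter_upwards [hD.mem_nhds (hKD hw)] with z hz using indicator_of_mem hz h
  · refine (contDiffAt_const (c := (0 : F))).congr_of_eventuallyEq ?_
    filter_upwards [hK.isOpen_compl.mem_nhds hw] with z hz
    exact indicator_apply_eq_zero.2 fun hzD => h0 z ⟨hzD, hz⟩

theorem integral_fderiv_apply_eq_zero {E : Type*} [NormedAddCommGroup E] [NormedSpace ℝ E]
    [FiniteDimensional ℝ E] [MeasurableSpace E] [BorelSpace E] {μ : Measure E}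
    [μ.IsAddHaarMeasure] {h : E → ℂ} (hh : ContDiff ℝ 1 h) (hc : HasCompactSupport h) (v : E) :
    Integrable (fun w => fderiv ℝ h w v) μ ∧ ∫ w, fderiv ℝ h w v ∂μ = 0 := by
  have hint : Integrable (fun w => fderiv ℝ h w v) μ :=
    ((hh.continuous_fderiv one_ne_zero).clm_apply continuous_const).integrable_of_hasCompactSupport
      (hc.fderiv_apply (𝕜 := ℝ) v)
  refine ⟨hint, ?_⟩
  have hparts := integral_mul_fderiv_eq_neg_fderiv_mul_of_integrable (μ := μ)
    (f := fun _ : E => (1 : ℂ)) (g := h) (v := v) (by simp) (by simpa using hint)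
    (by simpa using hh.continuous.integrable_of_hasCompactSupport hc)
    (fun x _ => differentiableAt_const _) (fun x _ => hh.differentiable one_ne_zero x)
  simpa using hparts

theorem setIntegral_dbar_fderiv_eq_zero {E : Type*} [NormedAddCommGroup E] [NormedSpace ℂ E]
    [FiniteDimensional ℝ E] [MeasurableSpace E] [BorelSpace E] {μ : Measure E}
    [μ.IsAddHaarMeasure] {D K : Set E} {h : E → ℂ} (hD : IsOpen D) (hK : IsCompact K)
    (hKD : K ⊆ D) (hh : ContDiffOn ℝ 1 h D) (h0 : ∀ w ∈ D \ K, h w = 0) (v : E) :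
    IntegrableOn (fun w => dbar (fderiv ℝ h w) v) D μ ∧
      ∫ w in D, dbar (fderiv ℝ h w) v ∂μ = 0 := by
  have hsmooth : ContDiff ℝ 1 (D.indicator h) :=
    contDiff_indicator_of_eq_zero hD hK.isClosed hKD hh h0
  have hsub : Function.support (D.indicator h) ⊆ K := fun w hw => by
    by_contra hwK
    exact hw (indicator_apply_eq_zero.2 fun hwD => h0 w ⟨hwD, hwK⟩)
  have hsupp : HasCompactSupport (D.indicator h) :=
    HasCompactSupport.of_support_subset_isCompact hK hsub
  have htsupp : tsupport (D.indicator h) ⊆ K := closure_minimal hsub hK.isClosed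
  have hin : ∀ w ∈ D, dbar (fderiv ℝ (D.indicator h) w) v = dbar (fderiv ℝ h w) v :=
    fun w hw => by
      rw [(eqOn_indicator.eventuallyEq_of_mem (hD.mem_nhds hw)).fderiv_eq]
  have hout : ∀ w ∉ D, dbar (fderiv ℝ (D.indicator h) w) v = 0 := fun w hw => by
    have hwK : w ∉ tsupport (D.indicator h) := fun hws => hw (hKD (htsupp hws))
    rw [fderiv_of_notMem_tsupport ℝ hwK, dbar_apply]
    simp only [zero_apply, mul_zero, add_zero]
  obtain ⟨hint, hzero⟩ := integral_fderiv_apply_eq_zero (μ := μ) hsmooth hsupp v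
  obtain ⟨hintI, hzeroI⟩ := integral_fderiv_apply_eq_zero (μ := μ) hsmooth hsupp (Complex.I • v)
  refine ⟨(hint.add (hintI.const_mul Complex.I)).integrableOn.congr_fun hin hD.measurableSet, ?_⟩
  rw [← setIntegral_congr_fun hD.measurableSet hin,
    setIntegral_eq_integral_of_forall_compl_eq_zero hout]
  simp only [dbar_apply]
  rw [integral_add hint (hintI.const_mul _), integral_const_mul, hzero, hzeroI, mul_zero, add_zero]

variable {n : ℕ} {D G : Set (Fin n → ℂ)} {f : (Fin n → ℂ) → (Fin n → ℂ)} {g ψ : (Fin n → ℂ) → ℂ}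

theorem IsProperHolomorphic.isCompact_inter_preimage (hf : IsProperHolomorphic f D G)
    {K : Set (Fin n → ℂ)} (hK : IsCompact K) (hKG : K ⊆ G) : IsCompact (D ∩ f ⁻¹' K) := by
  have hKcompact : IsCompact ((↑) ⁻¹' K : Set G) := by
    rw [Subtype.isCompact_iff, Subtype.image_preimage_coe, inter_eq_right.2 hKG]
    exact hK
  convert (hf.proper.isCompact_preimage hKcompact).image continuous_subtype_val using 1
  ext w
  simp [and_comm]

theorem sum_dbar_fderiv_adjugate_jacobianMatrix (hD : IsOpen D) (hf : DifferentiableOn ℂ f D)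
    (hg : DifferentiableOn ℂ g D) (hψ : Differentiable ℝ ψ) {w : Fin n → ℂ} (hw : w ∈ D)
    (j : Fin n) :
    ∑ i, dbar (fderiv ℝ
        (fun z => g z * star ((jacobianMatrix f z).adjugate i j) * ψ (f z)) w) (Pi.single i 1) =
      g w * star (jacobianMatrix f w).det * dbar (fderiv ℝ ψ (f w)) (Pi.single j 1) := by
  have hfw := hf.differentiableAt (hD.mem_nhds hw)
  have hgw := hg.differentiableAt (hD.mem_nhds hw)
  have hψw : DifferentiableAt ℝ (fun z => ψ (f z)) w :=
    (hψ _).comp w (hfw.restrictScalars ℝ)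
  have hterm : ∀ i, dbar (fderiv ℝ
      (fun z => g z * star ((jacobianMatrix f z).adjugate i j) * ψ (f z)) w) (Pi.single i 1) =
      2 * g w * ψ (f w) *
          star (fderiv ℂ (fun z => (jacobianMatrix f z).adjugate i j) w (Pi.single i 1)) +
        g w * dbar (fderiv ℝ ψ (f w))
          ((jacobianMatrix f w).adjugate i j • fderiv ℂ f w (Pi.single i 1)) := by
    intro i
    have hadj := (differentiableOn_adjugate_jacobianMatrix hD hf i j).differentiableAt
      (hD.mem_nhds hw)
    have hstar : DifferentiableAt ℝ (fun z => star ((jacobianMatrix f z).adjugate i j)) w :=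
      Complex.conjCLE.differentiableAt.comp w (hadj.restrictScalars ℝ)
    rw [dbar_fderiv_mul ((hgw.restrictScalars ℝ).fun_mul hstar) hψw,
      dbar_fderiv_mul (hgw.restrictScalars ℝ) hstar, dbar_fderiv_of_differentiableAt hgw,
      dbar_fderiv_star hadj, dbar_fderiv_comp (hψ _) hfw, map_smulₛₗ, LinearMap.zero_apply,
      starRingEnd_apply, smul_eq_mul]
    ring
  simp only [hterm, Finset.sum_add_distrib, ← Finset.mul_sum, ← star_sum, ← map_sum]
  rw [sum_fderiv_adjugate_jacobianMatrix_eq_zero hD hf j hw,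
    sum_adjugate_jacobianMatrix_smul_fderiv hfw, map_smulₛₗ, star_zero, mul_zero, zero_add,
    starRingEnd_apply, smul_eq_mul, mul_assoc]

theorem IsProperHolomorphic.integral_dbar_eq_zero (hf : IsProperHolomorphic f D G)
    (hD : IsOpen D) (hg : DifferentiableOn ℂ g D) (hψ : IsCompactlySupportedIn G ψ)
    (hψ1 : ContDiff ℝ 1 ψ) (v : Fin n → ℂ) :
    ∫ w in D, g w * star (jacobianMatrix f w).det * dbar (fderiv ℝ ψ (f w)) v = 0 := by
  have hC1 : ∀ {F : Type} [NormedAddCommGroup F] [NormedSpace ℂ F] [CompleteSpace F]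
      {k : (Fin n → ℂ) → F}, DifferentiableOn ℂ k D → ContDiffOn ℝ 1 k D := fun hk =>
    (contDiffOn_of_differentiableOn_complex hD hk 1).restrict_scalars ℝ
  let H : Fin n → Fin n → (Fin n → ℂ) → ℂ := fun i j z =>
    g z * star ((jacobianMatrix f z).adjugate i j) * ψ (f z)
  have hH : ∀ i j, ContDiffOn ℝ 1 (H i j) D := fun i j =>
    ((hC1 hg).mul (Complex.conjCLE.contDiff.comp_contDiffOn
      (hC1 (differentiableOn_adjugate_jacobianMatrix hD hf.holomorphic i j)))).mul
      (hψ1.comp_contDiffOn (hC1 hf.holomorphic))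
  have hH0 : ∀ i j, ∀ w ∈ D \ (D ∩ f ⁻¹' tsupport ψ), H i j w = 0 := fun i j w hw => by
    have hfw : f w ∉ tsupport ψ := fun h => hw.2 ⟨hw.1, h⟩
    simp only [H, image_eq_zero_of_notMem_tsupport hfw, mul_zero]
  have hdiv := fun i j => setIntegral_dbar_fderiv_eq_zero (μ := volume) hD
    (hf.isCompact_inter_preimage hψ.hasCompactSupport.isCompact hψ.tsupport_subset)
    inter_subset_left (hH i j) (hH0 i j) (Pi.single i 1)
  have hv : ∀ w ∈ D, g w * star (jacobianMatrix f w).det * dbar (fderiv ℝ ψ (f w)) v =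
      ∑ j, star (v j) * ∑ i, dbar (fderiv ℝ (H i j) w) (Pi.single i 1) := by
    intro w hw
    simp only [H, sum_dbar_fderiv_adjugate_jacobianMatrix hD hf.holomorphic hg
      (hψ1.differentiable one_ne_zero) hw, mul_left_comm (star _), ← Finset.mul_sum]
    conv_lhs => rw [pi_eq_sum_univ' v, map_sum]
    simp only [map_smulₛₗ, starRingEnd_apply, smul_eq_mul]
  rw [setIntegral_congr_fun hD.measurableSet hv, integral_finsetSum _ fun j _ =>
    (integrable_finsetSum _ fun i _ => (hdiv i j).1).const_mul _]
  refine Finset.sum_eq_zero fun j _ => ?_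
  rw [integral_const_mul, integral_finsetSum _ fun i _ => (hdiv i j).1,
    Finset.sum_eq_zero fun i _ => (hdiv i j).2, mul_zero]

theorem IsProperHolomorphic.integrableOn_mul_comp (hf : IsProperHolomorphic f D G)
    (hD : IsOpen D) {a : (Fin n → ℂ) → ℂ} (ha : ContinuousOn a D)
    (hψ : IsCompactlySupportedIn G ψ) : IntegrableOn (fun w => a w * ψ (f w)) D := by
  have hcont : ContinuousOn (fun w => a w * ψ (f w)) D :=
    ha.mul (hψ.continuous.comp_continuousOn hf.holomorphic.continuousOn)
  have hcompact := hf.isCompact_inter_preimage hψ.hasCompactSupport.isCompact hψ.tsupport_subset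
  refine ((hcont.mono inter_subset_left).integrableOn_compact hcompact).of_forall_sdiff_eq_zero
    hD.measurableSet fun x hx => ?_
  have hfx : f x ∉ tsupport ψ := fun h => hx.2 ⟨hx.1, h⟩
  rw [image_eq_zero_of_notMem_tsupport hfx, mul_zero]

theorem IsProperHolomorphic.exists_holomorphic_density (hf : IsProperHolomorphic f D G)
    (hD : IsOpen D) (hG : IsOpen G) (hg : DifferentiableOn ℂ g D) :
    ∃ h : (Fin n → ℂ) → ℂ, DifferentiableOn ℂ h G ∧ ∀ ψ, IsCompactlySupportedIn G ψ →
      ∫ w in D, g w * star (jacobianMatrix f w).det * ψ (f w) = ∫ y, h y * ψ y := by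
  have hweight : ContinuousOn (fun w => g w * star (jacobianMatrix f w).det) D :=
    hg.continuousOn.mul (continuous_star.comp_continuousOn
      (differentiableOn_det_jacobianMatrix hD hf.holomorphic).continuousOn)
  refine IsDbarClosedPushforward.exists_holomorphic_density ⟨⟨?_, ?_, ?_⟩, ?_⟩ hG
  · exact hf.holomorphic.continuousOn.aestronglyMeasurable hD.measurableSet
  · exact hweight.aestronglyMeasurable hD.measurableSet
  · exact fun ψ hψ => hf.integrableOn_mul_comp hD hweight hψ
  · exact fun ψ hψ hψ1 => hf.integral_dbar_eq_zero hD hg hψ hψ1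

end PushforwardOfProperMap

section TestFunctions

variable {n : ℕ} {G : Set (Fin n → ℂ)}

theorem exists_isCompactlySupportedIn_eventually_eq_one (hG : IsOpen G) :
    ∃ χ : ℕ → (Fin n → ℂ) → ℂ, (∀ k, IsCompactlySupportedIn G (χ k)) ∧
      (∀ k x, ‖χ k x‖ ≤ 1 ∧ χ k x = ‖χ k x‖) ∧ ∀ x ∈ G, ∀ᶠ k in atTop, χ k x = 1 := by
  obtain ⟨F, hFclosed, hFG, hFunion, hFmono⟩ := hG.exists_iUnion_isClosed
  choose χ hχ hχ_one hχ_le using fun k : ℕ => exists_isCompactlySupportedIn_eqOn_one hG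
    ((isCompact_closedBall 0 (k : ℝ)).inter_right (hFclosed k))
    (inter_subset_right.trans (hFG k))
  refine ⟨χ, hχ, hχ_le, fun x hx => ?_⟩
  rw [← hFunion, mem_iUnion] at hx
  obtain ⟨N, hN⟩ := hx
  filter_upwards [eventually_ge_atTop N, eventually_ge_atTop ⌈‖x‖⌉₊] with k hkN hkx
  exact hχ_one k ⟨mem_closedBall_zero_iff.2 (Nat.ceil_le.1 hkx), hFmono hkN hN⟩

theorem IsCompactlySupportedIn.apply_eq_zero {ψ : (Fin n → ℂ) → ℂ}
    (hψ : IsCompactlySupportedIn G ψ) {y : Fin n → ℂ} (hy : y ∉ G) : ψ y = 0 :=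
  image_eq_zero_of_notMem_tsupport fun h => hy (hψ.tsupport_subset h)

theorem IsCompactlySupportedIn.mono {V : Set (Fin n → ℂ)} {ψ : (Fin n → ℂ) → ℂ}
    (hψ : IsCompactlySupportedIn V ψ) (hVG : V ⊆ G) : IsCompactlySupportedIn G ψ :=
  ⟨hψ.continuous, hψ.hasCompactSupport, hψ.tsupport_subset.trans hVG⟩

theorem IsCompactlySupportedIn.norm {ψ : (Fin n → ℂ) → ℂ} (hψ : IsCompactlySupportedIn G ψ) :
    IsCompactlySupportedIn G fun y => (‖ψ y‖ : ℂ) := by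
  have hsupp : tsupport (fun y => (‖ψ y‖ : ℂ)) ⊆ tsupport ψ :=
    closure_mono fun y hy h0 => hy (by simp only [h0, norm_zero, Complex.ofReal_zero])
  exact ⟨Complex.continuous_ofReal.comp hψ.continuous.norm,
    hψ.hasCompactSupport.mono' ((subset_tsupport _).trans hsupp),
    hsupp.trans hψ.tsupport_subset⟩

theorem IsCompactlySupportedIn.mul_continuousOn {ψ a : (Fin n → ℂ) → ℂ}
    (hψ : IsCompactlySupportedIn G ψ) (hG : IsOpen G) (ha : ContinuousOn a G) :
    IsCompactlySupportedIn G fun y => ψ y * a y := by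
  have hsupp : tsupport (fun y => ψ y * a y) ⊆ tsupport ψ :=
    closure_mono fun y hy h0 => hy (by simp only [h0, zero_mul])
  refine ⟨continuous_of_tsupport fun y hy => ?_,
    hψ.hasCompactSupport.mono' ((subset_tsupport _).trans hsupp), hsupp.trans hψ.tsupport_subset⟩
  exact hψ.continuous.continuousAt.mul
    (ha.continuousAt (hG.mem_nhds (hψ.tsupport_subset (hsupp hy))))

theorem lintegral_le_of_tendsto_of_le {X : Type*} [MeasurableSpace X] {μ : Measure X}
    {F : ℕ → X → ENNReal} {F₀ : X → ENNReal} {M : ENNReal} (hF : ∀ k, AEMeasurable (F k) μ)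
    (hM : ∀ k, ∫⁻ x, F k x ∂μ ≤ M) (hlim : ∀ᵐ x ∂μ, Tendsto (fun k => F k x) atTop (𝓝 (F₀ x))) :
    ∫⁻ x, F₀ x ∂μ ≤ M :=
  calc ∫⁻ x, F₀ x ∂μ = ∫⁻ x, liminf (fun k => F k x) atTop ∂μ :=
        lintegral_congr_ae (hlim.mono fun _ hx => hx.liminf_eq.symm)
    _ ≤ liminf (fun k => ∫⁻ x, F k x ∂μ) atTop := lintegral_liminf_le' hF
    _ ≤ M := liminf_le_of_frequently_le' (Frequently.of_forall hM)

theorem measure_le_of_forall_lintegral_enorm_le {α β : Measure (Fin n → ℂ)} (hG : IsOpen G)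
    (h : ∀ ψ, IsCompactlySupportedIn G ψ → ∫⁻ y, ‖ψ y‖ₑ ∂α ≤ ∫⁻ y, ‖ψ y‖ₑ ∂β) : α G ≤ β G := by
  obtain ⟨χ, hχ, hχ_le, hχ_one⟩ := exists_isCompactlySupportedIn_eventually_eq_one hG
  have hβ : ∀ k, ∫⁻ y, ‖χ k y‖ₑ ∂β ≤ β G := fun k => by
    rw [← lintegral_indicator_one hG.measurableSet]
    refine lintegral_mono fun y => ?_
    by_cases hy : y ∈ G
    · rw [indicator_of_mem hy]
      exact (enorm_le_iff_norm_le.2 ((hχ_le k y).1.trans_eq (norm_one (α := ℂ)).symm)).trans_eq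
        enorm_one
    · rw [(hχ k).apply_eq_zero hy, enorm_zero]
      exact zero_le
  rw [← lintegral_indicator_one hG.measurableSet (μ := α)]
  refine lintegral_le_of_tendsto_of_le
    (fun k => (hχ k).continuous.enorm.measurable.aemeasurable)
    (fun k => (h _ (hχ k)).trans (hβ k)) (Eventually.of_forall fun y => ?_)
  refine tendsto_const_nhds.congr' ?_
  by_cases hy : y ∈ G
  · filter_upwards [hχ_one y hy] with k hk
    rw [hk, indicator_of_mem hy, enorm_one, Pi.one_apply]
  · filter_upwards with k
    rw [(hχ k).apply_eq_zero hy, indicator_of_notMem hy, enorm_zero]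

theorem exists_continuousOn_tendsto_mul_norm {X : Type*} [TopologicalSpace X] {s : Set X}
    {h : X → ℂ} (hh : ContinuousOn h s) :
    ∃ a : ℕ → X → ℂ, (∀ k, ContinuousOn (a k) s) ∧ (∀ k x, ‖a k x‖ ≤ 1) ∧
      (∀ k x, h x * a k x = ‖h x * a k x‖) ∧
      ∀ x, Tendsto (fun k => ‖h x * a k x‖) atTop (𝓝 ‖h x‖) := by
  let δ : ℕ → ℝ := fun k => 1 / ((k : ℝ) + 1)
  have hpos : ∀ k x, 0 < ‖h x‖ + δ k := fun k x =>
    add_pos_of_nonneg_of_pos (norm_nonneg _) Nat.one_div_pos_of_nat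
  let a : ℕ → X → ℂ := fun k x => star (h x) / ((‖h x‖ + δ k : ℝ) : ℂ)
  have ha : ∀ k x, h x * a k x = ((‖h x‖ ^ 2 / (‖h x‖ + δ k) : ℝ) : ℂ) := fun k x => by
    simp only [a, ← mul_div_assoc, Complex.star_def, Complex.mul_conj', Complex.ofReal_div,
      Complex.ofReal_pow]
  have hnorm : ∀ k x, ‖h x * a k x‖ = ‖h x‖ ^ 2 / (‖h x‖ + δ k) := fun k x => by
    rw [ha, Complex.norm_real, Real.norm_of_nonneg (div_nonneg (sq_nonneg _) (hpos k x).le)]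
  refine ⟨a, fun k => ?_, fun k x => ?_, fun k x => by rw [hnorm, ha], fun x => ?_⟩
  · exact (continuous_star.comp_continuousOn hh).div
      (Complex.continuous_ofReal.comp_continuousOn (hh.norm.add continuousOn_const))
      fun x _ => Complex.ofReal_ne_zero.2 (hpos k x).ne'
  · rw [norm_div, norm_star, Complex.norm_real, Real.norm_of_nonneg (hpos k x).le]
    exact div_le_one_of_le₀ (le_add_of_nonneg_right Nat.one_div_pos_of_nat.le) (hpos k x).le
  · simp only [hnorm]
    rcases eq_or_ne (h x) 0 with h0 | h0
    · simp only [h0, norm_zero, ne_eq, OfNat.ofNat_ne_zero, not_false_eq_true, zero_pow,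
        zero_div, tendsto_const_nhds]
    · have hlim : Tendsto (fun k => ‖h x‖ + δ k) atTop (𝓝 (‖h x‖ + 0)) :=
        tendsto_const_nhds.add tendsto_one_div_add_atTop_nhds_zero_nat
      rw [add_zero] at hlim
      have hquot : Tendsto (fun k => ‖h x‖ * ‖h x‖ / (‖h x‖ + δ k)) atTop
          (𝓝 (‖h x‖ * ‖h x‖ / ‖h x‖)) :=
        tendsto_const_nhds.div hlim (norm_ne_zero_iff.2 h0)
      simpa only [sq, mul_self_div_self] using hquot

theorem integrableOn_of_norm_integral_mul_le (hG : IsOpen G) {h : (Fin n → ℂ) → ℂ}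
    (hh : ContinuousOn h G) {M : ℝ} (hM : ∀ ψ, IsCompactlySupportedIn G ψ →
      (∀ y, ‖ψ y‖ ≤ 1) → ‖∫ y, h y * ψ y‖ ≤ M) : IntegrableOn h G := by
  obtain ⟨χ, hχ, hχ_le, hχ_one⟩ := exists_isCompactlySupportedIn_eventually_eq_one hG
  obtain ⟨a, ha, ha_le, ha_nonneg, ha_lim⟩ := exists_continuousOn_tendsto_mul_norm hh
  have hψ : ∀ k, IsCompactlySupportedIn G fun y => χ k y * a k y := fun k =>
    (hχ k).mul_continuousOn hG (ha k)
  have hint : ∀ k, Integrable fun y => h y * (χ k y * a k y) := fun k => by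
    simpa only [mul_comm] using ((hψ k).mul_continuousOn hG hh).integrable
  have hnonneg : ∀ k y, h y * (χ k y * a k y) = ‖h y * (χ k y * a k y)‖ := fun k y => by
    rw [mul_left_comm, norm_mul, Complex.ofReal_mul, ← ha_nonneg, ← (hχ_le k y).2]
  have hbound : ∀ k, ∫⁻ y in G, ‖h y * (χ k y * a k y)‖ₑ ≤ ENNReal.ofReal M := fun k => by
    refine (setLIntegral_le_lintegral _ _).trans ?_
    rw [← ofReal_integral_norm_eq_lintegral_enorm (hint k)]
    refine ENNReal.ofReal_le_ofReal (le_trans (le_of_eq ?_) (hM _ (hψ k) fun y => ?_))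
    · rw [integral_congr_ae (Eventually.of_forall (hnonneg k)), integral_complex_ofReal,
        Complex.norm_real, Real.norm_of_nonneg (integral_nonneg fun _ => norm_nonneg _)]
    · rw [norm_mul]
      exact mul_le_one₀ (hχ_le k y).1 (norm_nonneg _) (ha_le k y)
  refine ⟨hh.aestronglyMeasurable hG.measurableSet, (lintegral_le_of_tendsto_of_le
    (fun k => (hint k).1.enorm.restrict) hbound ?_).trans_lt ENNReal.ofReal_lt_top⟩
  filter_upwards [ae_restrict_mem hG.measurableSet] with y hy
  simp only [← ofReal_norm]
  refine ENNReal.tendsto_ofReal ((ha_lim y).congr' ?_)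
  filter_upwards [hχ_one y hy] with k hk
  rw [hk, one_mul]

end TestFunctions

section PushforwardMeasure

variable {n : ℕ} {D G : Set (Fin n → ℂ)} {f : (Fin n → ℂ) → (Fin n → ℂ)}

theorem exists_eq_const_of_star_eq {h : (Fin n → ℂ) → ℂ} (hG : IsOpen G)
    (hGc : IsPreconnected G) (hh : DifferentiableOn ℂ h G) (hreal : ∀ y ∈ G, star (h y) = h y) :
    ∃ c, ∀ y ∈ G, h y = c := by
  refine hG.exists_is_const_of_fderiv_eq_zero hGc hh fun y hy => ?_
  have hd : DifferentiableAt ℂ h y := (hh y hy).differentiableAt (hG.mem_nhds hy)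
  have hstar : (fun z => star (h z)) =ᶠ[𝓝 y] h := (hG.eventually_mem hy).mono hreal
  refine ContinuousLinearMap.ext fun v => ?_
  have hdbar := dbar_fderiv_star hd v
  rw [hstar.fderiv_eq, dbar_fderiv_of_differentiableAt hd, LinearMap.zero_apply, eq_comm,
    mul_eq_zero, star_eq_zero] at hdbar
  exact hdbar.resolve_left two_ne_zero

theorem eq_norm_of_forall_integral_mul_eq_norm {h : (Fin n → ℂ) → ℂ} (hG : IsOpen G)
    (hh : DifferentiableOn ℂ h G)
    (hnonneg : ∀ ψ, IsCompactlySupportedIn G ψ → (∀ y, ψ y = ‖ψ y‖) →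
      ∫ y, h y * ψ y = ‖∫ y, h y * ψ y‖) {y : Fin n → ℂ} (hy : y ∈ G) : h y = ‖h y‖ := by
  obtain ⟨r, hr, hrG⟩ := nhds_basis_closedBall.mem_iff.1 (hG.mem_nhds hy)
  obtain ⟨ρ, hρ⟩ := exists_isCircularMollifier n hr
  have hmean : ∫ z, h z * ρ (y - z) = h y := by
    rw [← one_mul (h y), ← hρ.integral_eq, ← integral_mul_of_circular hG hh hrG
      hρ.contDiff.continuous hρ.circular hρ.support_subset, ← integral_add_left_eq_self _ y]
    refine integral_congr_ae (Eventually.of_forall fun v => ?_)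
    simp only [hρ.apply_sub_comm y, add_sub_cancel_left, mul_comm]
  rw [← hmean]
  exact hnonneg _ (hρ.isCompactlySupportedIn_comp_const_sub hrG) fun z => hρ.nonneg (y - z)

theorem IsProperHolomorphic.exists_integral_det_mul_star_det (hf : IsProperHolomorphic f D G)
    (hD : IsOpen D) (hG : IsOpen G) (hGc : IsPreconnected G) :
    ∃ c : NNReal, ∀ ψ, IsCompactlySupportedIn G ψ →
      ∫ w in D, (jacobianMatrix f w).det * star (jacobianMatrix f w).det * ψ (f w) =
        (c : ℝ) * ∫ y, ψ y := by
  obtain ⟨h, hh, hhψ⟩ :=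
    hf.exists_holomorphic_density hD hG (differentiableOn_det_jacobianMatrix hD hf.holomorphic)
  have hnonneg : ∀ y ∈ G, h y = ‖h y‖ := fun y hy => by
    refine eq_norm_of_forall_integral_mul_eq_norm hG hh (fun ψ hψ hψ_nonneg => ?_) hy
    have hreal : ∀ w, (jacobianMatrix f w).det * star (jacobianMatrix f w).det * ψ (f w) =
        ((‖(jacobianMatrix f w).det‖ ^ 2 * ‖ψ (f w)‖ : ℝ) : ℂ) := fun w => by
      rw [hψ_nonneg (f w), Complex.star_def, Complex.mul_conj', Complex.norm_real, norm_norm,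
        Complex.ofReal_mul, Complex.ofReal_pow]
    simp only [← hhψ ψ hψ, hreal, integral_complex_ofReal, Complex.norm_real]
    rw [Real.norm_of_nonneg (integral_nonneg fun w => by positivity)]
  obtain ⟨c, hc⟩ := exists_eq_const_of_star_eq hG hGc hh fun y hy => by
    rw [hnonneg y hy, Complex.star_def, Complex.conj_ofReal]
  refine ⟨‖c‖₊, fun ψ hψ => ?_⟩
  rw [hhψ ψ hψ, ← integral_const_mul]
  refine integral_congr_ae (Eventually.of_forall fun y => ?_)
  by_cases hy : y ∈ G
  · simp only [coe_nnnorm, ← hc y hy, ← hnonneg y hy]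
  · simp only [hψ.apply_eq_zero hy, mul_zero]

theorem IsProperHolomorphic.exists_lintegral_enorm_det_sq_mul (hf : IsProperHolomorphic f D G)
    (hD : IsOpen D) (hG : IsOpen G) (hGc : IsPreconnected G) :
    ∃ c : NNReal, ∀ ψ, IsCompactlySupportedIn G ψ →
      ∫⁻ w in D, ‖(jacobianMatrix f w).det‖ₑ ^ 2 * ‖ψ (f w)‖ₑ = c * ∫⁻ y, ‖ψ y‖ₑ := by
  obtain ⟨c, hc⟩ := hf.exists_integral_det_mul_star_det hD hG hGc
  have hu := (differentiableOn_det_jacobianMatrix hD hf.holomorphic).continuousOn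
  refine ⟨c, fun ψ hψ => ?_⟩
  let F : (Fin n → ℂ) → ℂ := fun w =>
    (jacobianMatrix f w).det * star (jacobianMatrix f w).det * ψ (f w)
  have hF : IntegrableOn F D :=
    hf.integrableOn_mul_comp hD (hu.mul (continuous_star.comp_continuousOn hu)) hψ
  have hnorm : ∫ w in D, ‖F w‖ = c * ∫ y, ‖ψ y‖ := by
    rw [← Complex.ofReal_inj, ← integral_complex_ofReal, Complex.ofReal_mul,
      ← integral_complex_ofReal, ← hc _ hψ.norm]
    refine integral_congr_ae (Eventually.of_forall fun w => ?_)
    simp only [F, norm_mul, Complex.norm_real, norm_norm, Complex.ofReal_mul, Complex.star_def,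
      Complex.mul_conj', sq]
  calc ∫⁻ w in D, ‖(jacobianMatrix f w).det‖ₑ ^ 2 * ‖ψ (f w)‖ₑ = ∫⁻ w in D, ‖F w‖ₑ := by
        simp only [F, Complex.star_def, enorm_mul, enorm_eq_iff_norm_eq.2 (Complex.norm_conj _), sq]
    _ = ENNReal.ofReal (∫ w in D, ‖F w‖) := (ofReal_integral_norm_eq_lintegral_enorm hF).symm
    _ = c * ∫⁻ y, ‖ψ y‖ₑ := by
        rw [hnorm, ENNReal.ofReal_mul c.coe_nonneg, ENNReal.ofReal_coe_nnreal,
          ofReal_integral_norm_eq_lintegral_enorm hψ.integrable]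

theorem IsProperHolomorphic.exists_setLIntegral_enorm_det_sq (hf : IsProperHolomorphic f D G)
    (hD : IsOpen D) (hG : IsOpen G) (hGc : IsPreconnected G) :
    ∃ c : NNReal, ∀ V, IsOpen V → V ⊆ G →
      ∫⁻ w in D ∩ f ⁻¹' V, ‖(jacobianMatrix f w).det‖ₑ ^ 2 = c * volume V := by
  obtain ⟨c, hc⟩ := hf.exists_lintegral_enorm_det_sq_mul hD hG hGc
  have hu : AEMeasurable (fun w => ‖(jacobianMatrix f w).det‖ₑ ^ 2) (volume.restrict D) :=
    ((differentiableOn_det_jacobianMatrix hD hf.holomorphic).continuousOn.aestronglyMeasurable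
      hD.measurableSet).enorm.pow_const 2
  have hf_meas : AEMeasurable f (volume.restrict D) :=
    hf.holomorphic.continuousOn.aemeasurable hD.measurableSet
  let ν := (volume.restrict D).withDensity fun w => ‖(jacobianMatrix f w).det‖ₑ ^ 2
  have hf_ν : AEMeasurable f ν := hf_meas.mono_ac (withDensity_absolutelyContinuous _ _)
  have hmap : ∀ φ : (Fin n → ℂ) → ENNReal, Measurable φ → ∫⁻ y, φ y ∂(ν.map f) =
      ∫⁻ w in D, ‖(jacobianMatrix f w).det‖ₑ ^ 2 * φ (f w) := fun φ hφ => by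
    rw [lintegral_map' hφ.aemeasurable hf_ν]
    exact lintegral_withDensity_eq_lintegral_mul₀ hu (hφ.comp_aemeasurable hf_meas)
  have hψ : ∀ ψ, IsCompactlySupportedIn G ψ →
      ∫⁻ y, ‖ψ y‖ₑ ∂(ν.map f) = ∫⁻ y, ‖ψ y‖ₑ ∂((c : ENNReal) • volume) := fun ψ hψ => by
    rw [hmap _ hψ.continuous.enorm.measurable, hc ψ hψ, lintegral_smul_measure, smul_eq_mul]
  refine ⟨c, fun V hV hVG => ?_⟩
  have hV_eq : ν.map f V = ((c : ENNReal) • volume) V := le_antisymm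
    (measure_le_of_forall_lintegral_enorm_le hV fun ψ h => (hψ ψ (h.mono hVG)).le)
    (measure_le_of_forall_lintegral_enorm_le hV fun ψ h => (hψ ψ (h.mono hVG)).ge)
  have hpre := (hf.holomorphic.continuousOn.isOpen_inter_preimage hD hV).measurableSet
  rw [Measure.smul_apply, smul_eq_mul] at hV_eq
  rw [← hV_eq, ← lintegral_indicator_one hV.measurableSet,
    hmap _ (measurable_one.indicator hV.measurableSet), ← lintegral_indicator hD.measurableSet,
    ← lintegral_indicator hpre]
  refine lintegral_congr fun w => ?_
  by_cases hw : w ∈ D <;> by_cases hfw : f w ∈ V <;> simp [hw, hfw]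

end PushforwardMeasure

section Multiplicity

variable {n : ℕ} {D G : Set (Fin n → ℂ)} {f : (Fin n → ℂ) → (Fin n → ℂ)} {w p : Fin n → ℂ}

theorem det_fderiv_real_eq_norm_det_sq (hf : DifferentiableAt ℂ f w) :
    (fderiv ℝ f w).det = ‖(jacobianMatrix f w).det‖ ^ 2 := by
  rw [hf.fderiv_restrictScalars ℝ, ← Complex.normSq_eq_norm_sq, ← Algebra.norm_complex_apply,
    ← LinearMap.det_toLin', toLin'_jacobianMatrix hf]
  exact LinearMap.det_restrictScalars

theorem setLIntegral_enorm_det_sq_eq_volume_image {N : Set (Fin n → ℂ)} (hD : IsOpen D)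
    (hf : DifferentiableOn ℂ f D) (hN : MeasurableSet N) (hND : N ⊆ D) (hinj : InjOn f N) :
    ∫⁻ w in N, ‖(jacobianMatrix f w).det‖ₑ ^ 2 = volume (f '' N) := by
  have hd : ∀ w ∈ N, DifferentiableAt ℂ f w := fun w hw =>
    hf.differentiableAt (hD.mem_nhds (hND hw))
  rw [← lintegral_abs_det_fderiv_eq_addHaar_image volume hN (fun w hw =>
    ((hd w hw).restrictScalars ℝ).hasFDerivAt.hasFDerivWithinAt) hinj]
  refine setLIntegral_congr_fun hN fun w hw => ?_
  rw [det_fderiv_real_eq_norm_det_sq (hd w hw), abs_of_nonneg (by positivity),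
    ENNReal.ofReal_pow (norm_nonneg _), ofReal_norm]

theorem exists_isOpen_injOn_isOpen_image (hD : IsOpen D) (hf : DifferentiableOn ℂ f D)
    (hp : p ∈ D) (hdet : (jacobianMatrix f p).det ≠ 0) :
    ∃ N, IsOpen N ∧ p ∈ N ∧ N ⊆ D ∧ InjOn f N ∧ ∀ N' ⊆ N, IsOpen N' → IsOpen (f '' N') := by
  have hsmooth : ContDiffOn ℝ 1 f D := contDiffOn_pi.2 fun i =>
    (contDiffOn_of_differentiableOn_complex hD (differentiableOn_pi.1 hf i) 1).restrict_scalars ℝ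
  have hstrict : HasStrictFDerivAt f (fderiv ℝ f p) p :=
    (hsmooth.contDiffAt (hD.mem_nhds hp)).hasStrictFDerivAt one_ne_zero
  have hdet_real : (fderiv ℝ f p).det ≠ 0 := by
    rw [det_fderiv_real_eq_norm_det_sq (hf.differentiableAt (hD.mem_nhds hp))]
    exact pow_ne_zero 2 (norm_ne_zero_iff.2 hdet)
  rw [← (fderiv ℝ f p).coe_toContinuousLinearEquivOfDetNeZero hdet_real] at hstrict
  let e := hstrict.toOpenPartialHomeomorph f
  exact ⟨D ∩ e.source, hD.inter e.open_source,
    ⟨hp, hstrict.mem_toOpenPartialHomeomorph_source⟩, inter_subset_left,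
    e.injOn.mono inter_subset_right, fun N' hN' hN'_open =>
      e.isOpen_image_of_subset_source hN'_open (hN'.trans inter_subset_right)⟩

theorem one_le_of_forall_setLIntegral_enorm_det_sq {c : NNReal} (hD : IsOpen D) (hG : IsOpen G)
    (hf : DifferentiableOn ℂ f D)
    (hc : ∀ V, IsOpen V → V ⊆ G →
      ∫⁻ w in D ∩ f ⁻¹' V, ‖(jacobianMatrix f w).det‖ₑ ^ 2 = c * volume V)
    (hp : p ∈ D) (hpG : f p ∈ G) (hdet : (jacobianMatrix f p).det ≠ 0) : 1 ≤ c := by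
  obtain ⟨N, hN, hpN, hND, hinj, himage⟩ := exists_isOpen_injOn_isOpen_image hD hf hp hdet
  let N' := N ∩ f ⁻¹' (G ∩ ball (f p) 1)
  have hN'N : N' ⊆ N := inter_subset_left
  have hN' : IsOpen N' :=
    (hf.continuousOn.mono hND).isOpen_inter_preimage hN (hG.inter isOpen_ball)
  have hV : IsOpen (f '' N') := himage N' hN'N hN'
  have hVG : f '' N' ⊆ G := image_subset_iff.2 fun w hw => hw.2.1
  have hV_pos : volume (f '' N') ≠ 0 :=
    (hV.measure_pos volume ⟨f p, p, ⟨hpN, hpG, mem_ball_self one_pos⟩, rfl⟩).ne'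
  have hV_ball : f '' N' ⊆ ball (f p) 1 := image_subset_iff.2 fun w hw => hw.2.2
  have hV_fin : volume (f '' N') ≠ ⊤ := ((measure_mono hV_ball).trans_lt measure_ball_lt_top).ne
  have hle : 1 * volume (f '' N') ≤ c * volume (f '' N') :=
    calc 1 * volume (f '' N') = ∫⁻ w in N', ‖(jacobianMatrix f w).det‖ₑ ^ 2 := by
          rw [one_mul, setLIntegral_enorm_det_sq_eq_volume_image hD hf hN'.measurableSet
            (hN'N.trans hND) (hinj.mono hN'N)]
      _ ≤ ∫⁻ w in D ∩ f ⁻¹' (f '' N'), ‖(jacobianMatrix f w).det‖ₑ ^ 2 :=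
          lintegral_mono_set fun w hw => ⟨hND hw.1, mem_image_of_mem f hw⟩
      _ = c * volume (f '' N') := hc _ hV hVG
  exact_mod_cast (ENNReal.mul_le_mul_iff_left hV_pos hV_fin).1 hle

theorem jacobianMatrix_add_smul_sub (hf : DifferentiableAt ℂ f w) (t : ℂ) (p : Fin n → ℂ) :
    jacobianMatrix (fun z => f z + t • (z - p)) w = jacobianMatrix f w + t • 1 := by
  ext i j
  have hderiv : HasFDerivAt (fun z : Fin n → ℂ => f z i + t * (z i - p i))
      (fderiv ℂ (fun z => f z i) w +
        t • (ContinuousLinearMap.proj i : (Fin n → ℂ) →L[ℂ] ℂ)) w :=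
    (differentiableAt_pi.1 hf i).hasFDerivAt.add
      (((hasFDerivAt_apply i w).sub_const (p i)).const_mul t)
  simp [jacobianMatrix, hderiv.fderiv, Matrix.one_apply, Pi.single_apply]

theorem eventually_nhdsNE_det_add_smul_one_ne_zero (J : Matrix (Fin n) (Fin n) ℂ) :
    ∀ᶠ t : ℂ in 𝓝[≠] 0, (J + t • 1).det ≠ 0 := by
  have hfin : {t : ℂ | (-J).charpoly.IsRoot t}.Finite :=
    Polynomial.finite_setOfPred_isRoot (Matrix.charpoly_monic _).ne_zero
  filter_upwards [hfin.eventually_cofinite_notMem.filter_mono (nhdsNE_le_cofinite 0)] with t ht h0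
  refine ht ?_
  rw [Polynomial.IsRoot, Matrix.eval_charpoly, sub_neg_eq_add, add_comm,
    Matrix.scalar_apply, ← Matrix.smul_one_eq_diagonal, h0]

theorem eventually_forall_enorm_det_add_smul_one_sq_lt {K : Set (Fin n → ℂ)} (hK : IsCompact K)
    (hD : IsOpen D) (hf : DifferentiableOn ℂ f D) (hKD : K ⊆ D)
    (hzero : ∀ w ∈ K, (jacobianMatrix f w).det = 0) {ε : ENNReal} (hε : 0 < ε) :
    ∀ᶠ t : ℂ in 𝓝 0, ∀ w ∈ K, ‖(jacobianMatrix f w + t • 1).det‖ₑ ^ 2 < ε := by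
  refine hK.eventually_forall_of_forall_eventually fun w hw => ?_
  have hJ : ContinuousAt (jacobianMatrix f) w :=
    continuousAt_pi.2 fun i => continuousAt_pi.2 fun j =>
      (differentiableOn_jacobianMatrix_apply hD hf i j).continuousOn.continuousAt
        (hD.mem_nhds (hKD hw))
  have hJt : ContinuousAt (fun q : ℂ × (Fin n → ℂ) =>
      jacobianMatrix f q.2 + q.1 • (1 : Matrix (Fin n) (Fin n) ℂ)) (0, w) :=
    (hJ.comp_of_eq continuousAt_snd rfl).add (continuousAt_fst.smul continuousAt_const)
  have hdet : ContinuousAt (fun q : ℂ × (Fin n → ℂ) =>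
      ‖(jacobianMatrix f q.2 + q.1 • (1 : Matrix (Fin n) (Fin n) ℂ)).det‖ₑ ^ 2) (0, w) :=
    (ENNReal.continuous_pow 2).continuousAt.comp
      (continuous_id.matrix_det.enorm.continuousAt.comp hJt)
  refine hdet.eventually_lt continuousAt_const ?_
  simpa [hzero w hw] using hε

theorem exists_perturbation_of_det_jacobianMatrix_eq_zero {K : Set (Fin n → ℂ)} (hK : IsCompact K)
    (hD : IsOpen D) (hf : DifferentiableOn ℂ f D) (hKD : K ⊆ D) (hp : p ∈ D)
    (hzero : ∀ w ∈ D, (jacobianMatrix f w).det = 0) {r : ℝ} (hr : 0 < r) {ε : ENNReal}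
    (hε : 0 < ε) :
    ∃ F : (Fin n → ℂ) → (Fin n → ℂ), DifferentiableOn ℂ F D ∧ F p = f p ∧
      (jacobianMatrix F p).det ≠ 0 ∧
      ∀ w ∈ K, dist (f w) (F w) < r ∧ ‖(jacobianMatrix F w).det‖ₑ ^ 2 < ε := by
  have hclose : ∀ᶠ t : ℂ in 𝓝 0, ∀ w ∈ K, ‖t • (w - p)‖ < r := by
    refine hK.eventually_forall_of_forall_eventually fun w _ => ?_
    have hcont : Continuous fun q : ℂ × (Fin n → ℂ) => ‖q.1 • (q.2 - p)‖ := by fun_prop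
    exact hcont.continuousAt.eventually_lt continuousAt_const (by simpa using hr)
  have hsmall := eventually_forall_enorm_det_add_smul_one_sq_lt hK hD hf hKD
    (fun w hw => hzero w (hKD hw)) hε
  obtain ⟨t, ⟨ht_close, ht_small⟩, ht_ne⟩ :=
    (((hclose.and hsmall).filter_mono nhdsWithin_le_nhds).and
      (eventually_nhdsNE_det_add_smul_one_ne_zero (jacobianMatrix f p))).exists
  have hJ : ∀ w ∈ D, jacobianMatrix (fun z => f z + t • (z - p)) w = jacobianMatrix f w + t • 1 :=
    fun w hw => jacobianMatrix_add_smul_sub (hf.differentiableAt (hD.mem_nhds hw)) t p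
  refine ⟨fun w => f w + t • (w - p), hf.add (by fun_prop), ?_, ?_, fun w hw => ⟨?_, ?_⟩⟩
  · simp only [sub_self, smul_zero, add_zero]
  · rwa [hJ p hp]
  · simpa only [dist_self_add_right] using ht_close w hw
  · rw [hJ w (hKD hw)]
    exact ht_small w hw

theorem IsProperHolomorphic.of_isCompact_inter_preimage (hm : MapsTo f D G)
    (hf : DifferentiableOn ℂ f D)
    (hK : ∀ K, IsCompact K → K ⊆ G → IsCompact (D ∩ f ⁻¹' K)) : IsProperHolomorphic f D G := by
  refine ⟨hm, hf, isProperMap_iff_isCompact_preimage.2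
    ⟨hf.continuousOn.mapsToRestrict hm, fun K hKc => ?_⟩⟩
  rw [Subtype.isCompact_iff]
  convert hK _ (hKc.image continuous_subtype_val) (Subtype.coe_image_subset G K) using 1
  ext w
  constructor
  · rintro ⟨x, hx, rfl⟩
    exact ⟨x.2, _, hx, rfl⟩
  · rintro ⟨hw, y, hy, hyw⟩
    exact ⟨⟨w, hw⟩, by rwa [mem_preimage, show hm.restrict f D G ⟨w, hw⟩ = y from
      Subtype.ext hyw.symm], rfl⟩

theorem IsProperHolomorphic.perturb {F : (Fin n → ℂ) → (Fin n → ℂ)} {y₀ : Fin n → ℂ} {r : ℝ}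
    (hf : IsProperHolomorphic f D G) (hF : DifferentiableOn ℂ F D)
    (hr : closedBall y₀ (2 * r) ⊆ G)
    (hdist : ∀ w ∈ D ∩ f ⁻¹' closedBall y₀ (2 * r), dist (f w) (F w) < r) :
    IsProperHolomorphic F (D ∩ f ⁻¹' ball y₀ (2 * r) ∩ F ⁻¹' ball y₀ r) (ball y₀ r) := by
  refine .of_isCompact_inter_preimage (fun w hw => hw.2)
    (hF.mono fun w hw => hw.1.1) fun K hK hKr => ?_
  have hcompact := hf.isCompact_inter_preimage (isCompact_closedBall y₀ (2 * r)) hr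
  have hsub : D ∩ f ⁻¹' closedBall y₀ (2 * r) ⊆ D := inter_subset_left
  convert hcompact.of_isClosed_subset ((hF.continuousOn.mono hsub).preimage_isClosed_of_isClosed
    hcompact.isClosed hK.isClosed) inter_subset_left using 1
  ext w
  constructor
  · rintro ⟨⟨⟨hwD, hfw⟩, -⟩, hFw⟩
    exact ⟨⟨hwD, ball_subset_closedBall hfw⟩, hFw⟩
  · rintro ⟨hw, hFw⟩
    have hFr : dist (F w) y₀ < r := hKr hFw
    have hfr : dist (f w) y₀ < 2 * r := by
      linarith [dist_triangle (f w) (F w) y₀, hdist w hw]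
    exact ⟨⟨⟨hw.1, hfr⟩, hFr⟩, hFw⟩

theorem IsProperHolomorphic.exists_det_jacobianMatrix_ne_zero (hf : IsProperHolomorphic f D G)
    (hD : IsOpen D) (hG : IsOpen G) (hDne : D.Nonempty) :
    ∃ w ∈ D, (jacobianMatrix f w).det ≠ 0 := by
  by_contra! hzero
  obtain ⟨p, hp⟩ := hDne
  obtain ⟨r', hr', hr'G⟩ := nhds_basis_closedBall.mem_iff.1 (hG.mem_nhds (hf.mapsTo hp))
  obtain ⟨r, rfl⟩ : ∃ r, r' = 2 * r := ⟨r' / 2, by ring⟩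
  have hr : 0 < r := by linarith
  let K := D ∩ f ⁻¹' closedBall (f p) (2 * r)
  have hK : IsCompact K := hf.isCompact_inter_preimage (isCompact_closedBall _ _) hr'G
  have hKD : K ⊆ D := inter_subset_left
  obtain ⟨ε, hε, hεK⟩ : ∃ ε > 0, ε * volume K < volume (ball (f p) r) :=
    ENNReal.exists_pos_mul_lt hK.measure_lt_top.ne (measure_ball_pos volume _ hr).ne'
  obtain ⟨F, hF, hFp, hdet, hFK⟩ := exists_perturbation_of_det_jacobianMatrix_eq_zero hK hD
    hf.holomorphic hKD hp hzero hr hε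
  let Ω := D ∩ f ⁻¹' ball (f p) (2 * r) ∩ F ⁻¹' ball (f p) r
  have hΩK : Ω ⊆ K := fun w hw => ⟨hw.1.1, ball_subset_closedBall hw.1.2⟩
  have hf_open := hf.holomorphic.continuousOn.isOpen_inter_preimage hD
    (isOpen_ball (x := f p) (ε := 2 * r))
  have hΩ : IsOpen Ω :=
    (hF.continuousOn.mono inter_subset_left).isOpen_inter_preimage hf_open isOpen_ball
  have hpΩ : p ∈ Ω := ⟨⟨hp, mem_ball_self hr'⟩, by rw [mem_preimage, hFp]; exact mem_ball_self hr⟩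
  have hFproper : IsProperHolomorphic F Ω (ball (f p) r) :=
    hf.perturb hF hr'G fun w hw => (hFK w hw).1
  obtain ⟨c, hc⟩ := hFproper.exists_setLIntegral_enorm_det_sq hΩ isOpen_ball
    (convex_ball _ _).isPreconnected
  have hc1 : 1 ≤ c := one_le_of_forall_setLIntegral_enorm_det_sq hΩ isOpen_ball
    hFproper.holomorphic hc hpΩ (hFproper.mapsTo hpΩ) hdet
  refine hεK.not_ge ?_
  calc volume (ball (f p) r) ≤ c * volume (ball (f p) r) :=
        le_mul_of_one_le_left zero_le (by exact_mod_cast hc1)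
    _ = ∫⁻ w in Ω ∩ F ⁻¹' ball (f p) r, ‖(jacobianMatrix F w).det‖ₑ ^ 2 :=
        (hc _ isOpen_ball subset_rfl).symm
    _ ≤ ∫⁻ _ in K, ε :=
        (lintegral_mono_set (inter_subset_left.trans hΩK)).trans
          (setLIntegral_mono measurable_const fun w hw => (hFK w hw).2.le)
    _ = ε * volume K := setLIntegral_const _ _

end Multiplicity

section TransformationFormula

variable {n : ℕ} {D G : Set (Fin n → ℂ)} {f : (Fin n → ℂ) → (Fin n → ℂ)}

theorem IsProperHolomorphic.det_jacobianMatrix_mem_bergmanSpace (hf : IsProperHolomorphic f D G)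
    (hD : IsOpen D) (hG : IsOpen G) (hGc : IsPreconnected G) (hGb : Bornology.IsBounded G) :
    (fun w => (jacobianMatrix f w).det) ∈ bergmanSpace D := by
  obtain ⟨c, hc⟩ := hf.exists_setLIntegral_enorm_det_sq hD hG hGc
  have hu := differentiableOn_det_jacobianMatrix hD hf.holomorphic
  have hfin := hc G hG Subset.rfl
  rw [inter_eq_left.2 (show D ⊆ f ⁻¹' G from hf.mapsTo)] at hfin
  refine ⟨hu, hu.continuousOn.aestronglyMeasurable hD.measurableSet, ?_⟩
  rw [eLpNorm_lt_top_iff_lintegral_rpow_enorm_lt_top two_ne_zero ENNReal.ofNat_ne_top]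
  simp only [ENNReal.toReal_ofNat, ENNReal.rpow_ofNat, hfin]
  exact ENNReal.mul_lt_top ENNReal.coe_lt_top hGb.measure_lt_top

theorem integrableOn_mul_star_of_mem_bergmanSpace {g u : (Fin n → ℂ) → ℂ}
    (hg : g ∈ bergmanSpace D) (hu : u ∈ bergmanSpace D) :
    IntegrableOn (fun w => g w * star (u w)) D :=
  hg.2.integrable_mul hu.2.star

theorem exists_isCompactlySupportedIn_tendsto_of_bounded {V : Set (Fin n → ℂ)} (hV : IsOpen V)
    {s : (Fin n → ℂ) → ℂ} (hs : ContinuousOn s V) {B : ℝ} (hB : ∀ y ∈ V, ‖s y‖ ≤ B) :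
    ∃ φ : ℕ → (Fin n → ℂ) → ℂ, (∀ k, IsCompactlySupportedIn V (φ k)) ∧
      (∀ k y, ‖φ k y‖ ≤ max B 0) ∧ ∀ y ∈ V, Tendsto (fun k => φ k y) atTop (𝓝 (s y)) := by
  obtain ⟨χ, hχ, hχ_le, hχ_one⟩ := exists_isCompactlySupportedIn_eventually_eq_one hV
  have hφ : ∀ k, IsCompactlySupportedIn V fun y => χ k y * s y := fun k =>
    (hχ k).mul_continuousOn hV hs
  refine ⟨fun k y => χ k y * s y, hφ, fun k y => ?_, fun y hy => ?_⟩
  · by_cases hy : y ∈ V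
    · rw [norm_mul]
      exact (mul_le_of_le_one_left (norm_nonneg _) (hχ_le k y).1).trans
        ((hB y hy).trans (le_max_left _ _))
    · exact (norm_eq_zero.2 ((hφ k).apply_eq_zero hy)).trans_le (le_max_right _ _)
  · refine tendsto_const_nhds.congr' ((hχ_one y hy).mono fun k hk => ?_)
    simp only [hk, one_mul]

theorem tendsto_integral_mul_of_bounded {X : Type*} [MeasurableSpace X] {μ : Measure X}
    {F s : X → ℂ} {φ : ℕ → X → ℂ} {B : ℝ} (hF : Integrable F μ)
    (hφ : ∀ k, AEStronglyMeasurable (φ k) μ) (hB : ∀ k x, ‖φ k x‖ ≤ B)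
    (hlim : ∀ᵐ x ∂μ, Tendsto (fun k => φ k x) atTop (𝓝 (s x))) :
    Tendsto (fun k => ∫ x, F x * φ k x ∂μ) atTop (𝓝 (∫ x, F x * s x ∂μ)) :=
  tendsto_integral_of_dominated_convergence (fun x => ‖F x‖ * B) (fun k => hF.1.mul (hφ k))
    (hF.norm.mul_const B)
    (fun k => Eventually.of_forall fun x => by
      rw [norm_mul]; exact mul_le_mul_of_nonneg_left (hB k x) (norm_nonneg _))
    (hlim.mono fun x hx => hx.const_mul (F x))

theorem IsProperHolomorphic.exists_integrable_holomorphic_density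
    (hf : IsProperHolomorphic f D G) (hD : IsOpen D) (hG : IsOpen G) (hGc : IsPreconnected G)
    (hGb : Bornology.IsBounded G) {g : (Fin n → ℂ) → ℂ} (hg : g ∈ bergmanSpace D) :
    ∃ h, DifferentiableOn ℂ h G ∧ IntegrableOn h G ∧ ∀ ψ, IsCompactlySupportedIn G ψ →
      ∫ w in D, g w * star (jacobianMatrix f w).det * ψ (f w) = ∫ y, h y * ψ y := by
  obtain ⟨h, hh, hgh⟩ := hf.exists_holomorphic_density hD hG hg.1
  have hgu := integrableOn_mul_star_of_mem_bergmanSpace hg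
    (hf.det_jacobianMatrix_mem_bergmanSpace hD hG hGc hGb)
  refine ⟨h, hh, integrableOn_of_norm_integral_mul_le hG hh.continuousOn
    (M := ∫ w in D, ‖g w * star (jacobianMatrix f w).det‖) fun ψ hψ hψ_le => ?_, hgh⟩
  rw [← hgh ψ hψ]
  refine norm_integral_le_of_norm_le hgu.norm (Eventually.of_forall fun w => ?_)
  rw [norm_mul]
  exact mul_le_of_le_one_right (norm_nonneg _) (hψ_le _)

theorem IsProperHolomorphic.exists_setIntegral_preimage_eq (hf : IsProperHolomorphic f D G)
    (hD : IsOpen D) (hG : IsOpen G) (hGc : IsPreconnected G) (hGb : Bornology.IsBounded G)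
    {g : (Fin n → ℂ) → ℂ} (hg : g ∈ bergmanSpace D) :
    ∃ h, DifferentiableOn ℂ h G ∧ IntegrableOn h G ∧
      ∀ V ⊆ G, IsOpen V → ∀ s : (Fin n → ℂ) → ℂ, ContinuousOn s V → ∀ B, (∀ y ∈ V, ‖s y‖ ≤ B) →
        ∫ w in D ∩ f ⁻¹' V, g w * star (jacobianMatrix f w).det * s (f w) =
          ∫ y in V, h y * s y := by
  obtain ⟨h, hh, hh_int, hgh⟩ := hf.exists_integrable_holomorphic_density hD hG hGc hGb hg
  have hgu := integrableOn_mul_star_of_mem_bergmanSpace hg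
    (hf.det_jacobianMatrix_mem_bergmanSpace hD hG hGc hGb)
  refine ⟨h, hh, hh_int, fun V hVG hV s hs B hB => ?_⟩
  obtain ⟨φ, hφ, hφ_le, hφ_lim⟩ := exists_isCompactlySupportedIn_tendsto_of_bounded hV hs hB
  have hpre : IsOpen (D ∩ f ⁻¹' V) := hf.holomorphic.continuousOn.isOpen_inter_preimage hD hV
  have hfm : AEMeasurable f (volume.restrict (D ∩ f ⁻¹' V)) :=
    (hf.holomorphic.continuousOn.mono inter_subset_left).aemeasurable hpre.measurableSet
  have hD_lim := tendsto_integral_mul_of_bounded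
    (hgu.mono_set (inter_subset_left (t := f ⁻¹' V)))
    (fun k => ((hφ k).continuous.measurable.comp_aemeasurable hfm).aestronglyMeasurable)
    (fun k w => hφ_le k (f w))
    ((ae_restrict_mem hpre.measurableSet).mono fun w hw => hφ_lim (f w) hw.2)
  have hG_lim := tendsto_integral_mul_of_bounded (hh_int.mono_set hVG)
    (fun k => (hφ k).continuous.aestronglyMeasurable) hφ_le
    ((ae_restrict_mem hV.measurableSet).mono hφ_lim)
  refine tendsto_nhds_unique hD_lim (hG_lim.congr fun k => ?_)
  rw [setIntegral_eq_integral_of_forall_compl_eq_zero fun y hy => by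
      rw [(hφ k).apply_eq_zero hy, mul_zero],
    ← hgh _ ((hφ k).mono hVG)]
  refine setIntegral_eq_of_subset_of_forall_sdiff_eq_zero hD.measurableSet inter_subset_left
    fun w hw => ?_
  simp only [(hφ k).apply_eq_zero fun hfw => hw.2 ⟨hw.1, hfw⟩, mul_zero]

end TransformationFormula

theorem circleAverage_eq_of_differentiableAt_annulus {F : Type*} [NormedAddCommGroup F]
    [NormedSpace ℂ F] [CompleteSpace F] {φ : ℂ → F} {c : ℂ} {r R : ℝ} (hr : 0 < r) (hrR : r ≤ R)
    (hφ : ∀ z ∈ closedBall c R \ ball c r, DifferentiableAt ℂ φ z) :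
    Real.circleAverage φ c r = Real.circleAverage φ c R := by
  have hd : ∀ z ∈ closedBall c R \ ball c r, DifferentiableAt ℂ (fun z => (z - c)⁻¹ • φ z) z := by
    rintro z ⟨hzR, hzr⟩
    have hzc : z - c ≠ 0 := fun h => hzr (sub_eq_zero.1 h ▸ mem_ball_self hr)
    exact ((differentiableAt_id.sub_const c).inv hzc).smul (hφ z ⟨hzR, hzr⟩)
  rw [Real.circleAverage_eq_circleIntegral hr.ne',
    Real.circleAverage_eq_circleIntegral (hr.trans_le hrR).ne',
    Complex.circleIntegral_eq_of_differentiable_on_annulus_off_countable hr hrR countable_empty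
      (fun z hz => (hd z hz).continuousAt.continuousWithinAt)
      fun z hz => hd z ⟨ball_subset_closedBall hz.1.1,
        fun h => hz.1.2 (ball_subset_closedBall h)⟩]

section WeightedDilation

variable {n : ℕ} (m : Fin n → ℕ)

/-- The weighted action `x ↦ (c ^ m₁ * x₁, …, c ^ mₙ * xₙ)` of a scalar `c`. -/
def weightedDilation (c : ℂ) (x : Fin n → ℂ) : Fin n → ℂ :=
  fun i => c ^ m i * x i

theorem weightedDilation_weightedDilation (c c' : ℂ) (x : Fin n → ℂ) :
    weightedDilation m c (weightedDilation m c' x) = weightedDilation m (c * c') x :=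
  funext fun i => by simp only [weightedDilation, mul_pow, mul_assoc]

theorem weightedDilation_one (x : Fin n → ℂ) : weightedDilation m 1 x = x :=
  funext fun i => by simp only [weightedDilation, one_pow, one_mul]

theorem image_weightedDilation_eq_preimage {c : ℂ} (hc : c ≠ 0) (G : Set (Fin n → ℂ)) :
    weightedDilation m c '' G = weightedDilation m c⁻¹ ⁻¹' G := by
  refine congrFun (image_eq_preimage_of_inverse (fun x => ?_) fun x => ?_) G
  · rw [weightedDilation_weightedDilation, inv_mul_cancel₀ hc, weightedDilation_one]
  · rw [weightedDilation_weightedDilation, mul_inv_cancel₀ hc, weightedDilation_one]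

theorem continuous_uncurry_weightedDilation :
    Continuous fun p : ℂ × (Fin n → ℂ) => weightedDilation m p.1 p.2 := by
  unfold weightedDilation
  fun_prop

theorem differentiable_weightedDilation (c : ℂ) : Differentiable ℂ (weightedDilation m c) := by
  unfold weightedDilation
  fun_prop

theorem differentiable_weightedDilation_left (x : Fin n → ℂ) :
    Differentiable ℂ fun c => weightedDilation m c x := by
  unfold weightedDilation
  fun_prop

theorem isOpen_image_weightedDilation {c : ℂ} (hc : c ≠ 0) {G : Set (Fin n → ℂ)} (hG : IsOpen G) :
    IsOpen (weightedDilation m c '' G) := by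
  rw [image_weightedDilation_eq_preimage m hc]
  exact hG.preimage (differentiable_weightedDilation m _).continuous

theorem weightedDilation_injective {c : ℂ} (hc : c ≠ 0) :
    Function.Injective (weightedDilation m c) :=
  Function.LeftInverse.injective (g := weightedDilation m c⁻¹) fun x => by
    rw [weightedDilation_weightedDilation, inv_mul_cancel₀ hc, weightedDilation_one]

theorem measurableEmbedding_weightedDilation {c : ℂ} (hc : c ≠ 0) :
    MeasurableEmbedding (weightedDilation m c) :=
  (differentiable_weightedDilation m c).continuous.measurableEmbedding
    (weightedDilation_injective m hc)

variable {m}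

theorem norm_weightedDilation_le (hm : ∀ i, 0 < m i) {c : ℂ} (hc : ‖c‖ ≤ 1) (x : Fin n → ℂ) :
    ‖weightedDilation m c x‖ ≤ ‖c‖ * ‖x‖ := by
  refine (pi_norm_le_iff_of_nonneg (by positivity)).2 fun i => ?_
  simp only [weightedDilation, norm_mul, norm_pow]
  exact mul_le_mul (pow_le_of_le_one (norm_nonneg c) hc (hm i).ne') (norm_le_pi_norm x i)
    (norm_nonneg _) (norm_nonneg c)

theorem weightedDilation_mem_ball (hm : ∀ i, 0 < m i) {c : ℂ} (hc : ‖c‖ ≤ 1) {x : Fin n → ℂ}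
    {r : ℝ} (hx : x ∈ ball 0 r) : weightedDilation m c x ∈ ball 0 r := by
  rw [mem_ball_zero_iff] at hx ⊢
  exact ((norm_weightedDilation_le hm hc x).trans
    (mul_le_of_le_one_left (norm_nonneg x) hc)).trans_lt hx

theorem exists_mapsTo_weightedDilation_closedBall (hm : ∀ i, 0 < m i) {G : Set (Fin n → ℂ)}
    (hG : Bornology.IsBounded G) {r : ℝ} (hr : 0 < r) :
    ∃ t : ℝ, 0 < t ∧ t ≤ 1 ∧ MapsTo (weightedDilation m t) G (closedBall 0 r) := by
  obtain ⟨M, hM_pos, hM⟩ := hG.exists_pos_norm_le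
  have ht : 0 < min 1 (r / M) := lt_min one_pos (div_pos hr hM_pos)
  have ht_norm : ‖((min 1 (r / M) : ℝ) : ℂ)‖ = min 1 (r / M) := by
    rw [Complex.norm_real, Real.norm_of_nonneg ht.le]
  refine ⟨min 1 (r / M), ht, min_le_left _ _, fun x hx => mem_closedBall_zero_iff.2 ?_⟩
  calc ‖weightedDilation m (min 1 (r / M) : ℝ) x‖ ≤ min 1 (r / M) * ‖x‖ := by
        simpa only [ht_norm] using
          norm_weightedDilation_le hm (ht_norm.trans_le (min_le_left _ _)) x
    _ ≤ r / M * M := mul_le_mul (min_le_right _ _) (hM x hx) (norm_nonneg x) (div_pos hr hM_pos).le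
    _ = r := div_mul_cancel₀ r hM_pos.ne'

variable {G : Set (Fin n → ℂ)}

theorem exists_integral_comp_weightedDilation_eq (m : Fin n → ℕ) (hG : IsOpen G) {t : ℝ}
    (ht : t ≠ 0) : ∃ C : ℂ, ∀ k : (Fin n → ℂ) → ℂ,
      ∫ z in G, k (weightedDilation m t z) = C * ∫ z in weightedDilation m t '' G, k z := by
  have ht' : (t : ℂ) ≠ 0 := Complex.ofReal_ne_zero.2 ht
  let A : (Fin n → ℂ) →L[ℝ] (Fin n → ℂ) :=
    ContinuousLinearMap.pi fun i => ((t : ℂ) ^ m i) • ContinuousLinearMap.proj i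
  have hA : ⇑A = weightedDilation m t := rfl
  have hA_det : A.det ≠ 0 := fun h0 =>
    (LinearMap.bot_lt_ker_of_det_eq_zero (f := (A : (Fin n → ℂ) →ₗ[ℝ] (Fin n → ℂ))) h0).ne'
      (LinearMap.ker_eq_bot.2 (weightedDilation_injective m ht'))
  refine ⟨((|A.det| : ℝ) : ℂ)⁻¹, fun k => ?_⟩
  rw [← hA, integral_image_eq_integral_abs_det_fderiv_smul volume hG.measurableSet
      (fun z _ => A.hasFDerivAt.hasFDerivWithinAt) (weightedDilation_injective m ht').injOn,
    integral_smul, Complex.real_smul,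
    inv_mul_cancel_left₀ (Complex.ofReal_ne_zero.2 (abs_ne_zero.2 hA_det))]

theorem IsQuasiCircular.preimage_weightedDilation (hG : IsQuasiCircular m G) {c : ℂ}
    (hc : ‖c‖ = 1) : weightedDilation m c ⁻¹' G = G := by
  have hc0 : c ≠ 0 := norm_ne_zero_iff.1 (hc ▸ one_ne_zero)
  refine Subset.antisymm (fun x hx => ?_) fun x hx => hG c hc x hx
  have hmem : weightedDilation m c⁻¹ (weightedDilation m c x) ∈ G :=
    hG c⁻¹ (by rw [norm_inv, hc, inv_one]) _ hx
  rwa [weightedDilation_weightedDilation, inv_mul_cancel₀ hc0, weightedDilation_one] at hmem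

theorem IsQuasiCircular.measurePreserving_weightedDilation (hG : IsQuasiCircular m G)
    (hGo : IsOpen G) {c : ℂ} (hc : ‖c‖ = 1) :
    MeasurePreserving (weightedDilation m c) (volume.restrict G) (volume.restrict G) := by
  have hvol : MeasurePreserving (weightedDilation m c) volume volume :=
    volume_preserving_pi (f := fun i (z : ℂ) => c ^ m i * z) fun i =>
      (rotation ⟨c ^ m i, by simp [Submonoid.unitSphere, hc]⟩).measurePreserving
  simpa only [hG.preimage_weightedDilation hc] using hvol.restrict_preimage hGo.measurableSet

theorem IsQuasiCircular.integrable_comp_weightedDilation (hG : IsQuasiCircular m G)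
    (hGo : IsOpen G) {k : (Fin n → ℂ) → ℂ} (hk : ContinuousOn k G) (hk_int : IntegrableOn k G) :
    Integrable (fun p : ℝ × (Fin n → ℂ) => k (weightedDilation m (circleMap 0 1 p.1) p.2))
      ((volume.restrict (uIoc 0 (2 * Real.pi))).prod (volume.restrict G)) := by
  have hc : ∀ θ, ‖circleMap 0 1 θ‖ = 1 := fun θ => by rw [norm_circleMap_zero, abs_one]
  have hmp := fun θ => hG.measurePreserving_weightedDilation hGo (hc θ)
  have hcont : ContinuousOn
      (fun p : ℝ × (Fin n → ℂ) => k (weightedDilation m (circleMap 0 1 p.1) p.2))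
      (uIoc 0 (2 * Real.pi) ×ˢ G) :=
    hk.comp ((continuous_uncurry_weightedDilation m).comp
      (((continuous_circleMap 0 1).comp continuous_fst).prodMk continuous_snd)).continuousOn
      fun p hp => hG _ (hc _) _ hp.2
  have hmeas := hcont.aestronglyMeasurable (μ := volume) (measurableSet_uIoc.prod hGo.measurableSet)
  rw [Measure.volume_eq_prod, ← Measure.prod_restrict] at hmeas
  have hnorm : ∀ θ, ∫ z in G, ‖k (weightedDilation m (circleMap 0 1 θ) z)‖ = ∫ z in G, ‖k z‖ :=
    fun θ => (hmp θ).integral_comp (measurableEmbedding_weightedDilation m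
      (norm_ne_zero_iff.1 ((hc θ).symm ▸ one_ne_zero))) fun z => ‖k z‖
  have : IsFiniteMeasure (volume.restrict (uIoc 0 (2 * Real.pi))) :=
    ⟨by rw [Measure.restrict_apply_univ]; exact measure_Ioc_lt_top⟩
  rw [integrable_prod_iff hmeas]
  refine ⟨Eventually.of_forall fun θ => (hmp θ).integrable_comp_of_integrable hk_int, ?_⟩
  simp only [hnorm]
  exact integrable_const _

theorem IsQuasiCircular.setIntegral_circleAverage_weightedDilation (hG : IsQuasiCircular m G)
    (hGo : IsOpen G) {k : (Fin n → ℂ) → ℂ} (hk : ContinuousOn k G) (hk_int : IntegrableOn k G) :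
    ∫ z in G, Real.circleAverage (fun c => k (weightedDilation m c z)) 0 1 = ∫ z in G, k z := by
  have hc : ∀ θ, ‖circleMap 0 1 θ‖ = 1 := fun θ => by rw [norm_circleMap_zero, abs_one]
  have hinv : ∀ θ, ∫ z in G, k (weightedDilation m (circleMap 0 1 θ) z) = ∫ z in G, k z :=
    fun θ => (hG.measurePreserving_weightedDilation hGo (hc θ)).integral_comp
      (measurableEmbedding_weightedDilation m (norm_ne_zero_iff.1 ((hc θ).symm ▸ one_ne_zero))) k
  simp only [Real.circleAverage]
  rw [integral_smul, ← intervalIntegral_integral_swap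
    (f := fun θ z => k (weightedDilation m (circleMap 0 1 θ) z))
    (hG.integrable_comp_weightedDilation hGo hk hk_int)]
  simp only [hinv]
  rw [intervalIntegral.integral_const, sub_zero, inv_smul_smul₀ Real.two_pi_pos.ne']

end WeightedDilation

section WeightedComponent

variable {n : ℕ} {m : Fin n → ℕ} {G : Set (Fin n → ℂ)} {h q : (Fin n → ℂ) → ℂ} {d : ℕ}

/-- The part of `h` of weighted degree `d`: the `d`-th Fourier coefficient of `h` along the orbits
of the circle action `c ↦ weightedDilation m c z`. -/
noncomputable def weightedComponent (m : Fin n → ℕ) (d : ℕ) (h : (Fin n → ℂ) → ℂ)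
    (z : Fin n → ℂ) : ℂ :=
  Real.circleAverage (fun c => c⁻¹ ^ d * h (weightedDilation m c z)) 0 1

theorem differentiableOn_weightedComponent (hG : IsQuasiCircular m G) (hGo : IsOpen G)
    (hh : DifferentiableOn ℂ h G) (d : ℕ) : DifferentiableOn ℂ (weightedComponent m d h) G := by
  have hmem : ∀ c ∈ sphere (0 : ℂ) 1, MapsTo (weightedDilation m c) G G := fun c hc z hz =>
    hG c (mem_sphere_zero_iff_norm.1 hc) z hz
  have hinv : ContinuousOn (fun p : (Fin n → ℂ) × ℂ => p.2⁻¹) (G ×ˢ sphere 0 1) :=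
    continuousOn_snd.inv₀ fun p hp => ne_of_mem_sphere hp.2 one_ne_zero
  have hcomp : ContinuousOn (fun p : (Fin n → ℂ) × ℂ => h (weightedDilation m p.2 p.1))
      (G ×ˢ sphere 0 1) :=
    hh.continuousOn.comp
      ((continuous_uncurry_weightedDilation m).comp continuous_swap).continuousOn
      fun p hp => hmem _ hp.2 hp.1
  exact differentiableOn_circleAverage (f := fun z c => c⁻¹ ^ d * h (weightedDilation m c z)) hGo
    one_pos ((hinv.pow d).mul hcomp) fun c hc =>
      (hh.comp (differentiable_weightedDilation m c).differentiableOn (hmem c hc)).const_mul _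

theorem weightedComponent_weightedDilation_of_mem_ball (hm : ∀ i, 0 < m i) {r : ℝ}
    (hh : DifferentiableOn ℂ h (ball 0 r)) (d : ℕ) {t : ℝ} (ht : 0 < t) (ht1 : t ≤ 1)
    {z : Fin n → ℂ} (hz : z ∈ ball 0 r) :
    weightedComponent m d h (weightedDilation m t z) = t ^ d * weightedComponent m d h z := by
  have hd : ∀ c ∈ closedBall (0 : ℂ) 1 \ ball 0 t,
      DifferentiableAt ℂ (fun c => c⁻¹ ^ d * h (weightedDilation m c z)) c := by
    rintro c ⟨hc1, hct⟩
    have hcz := weightedDilation_mem_ball hm (mem_closedBall_zero_iff.1 hc1) hz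
    have hhc : DifferentiableAt ℂ h (weightedDilation m c z) :=
      hh.differentiableAt (isOpen_ball.mem_nhds hcz)
    exact ((differentiableAt_inv fun h0 => hct (h0 ▸ mem_ball_self ht)).pow d).mul
      (hhc.comp c (differentiable_weightedDilation_left m z c))
  have ht0 : (t : ℂ) ^ d ≠ 0 := pow_ne_zero d (Complex.ofReal_ne_zero.2 ht.ne')
  simp only [weightedComponent]
  rw [← circleAverage_eq_of_differentiableAt_annulus ht ht1 hd,
    Real.circleAverage_eq_circleAverage_zero_one (R := t), ← smul_eq_mul,
    ← Real.circleAverage_fun_smul]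
  congr 1
  funext c
  rw [smul_eq_mul, weightedDilation_weightedDilation, add_zero, mul_comm c, mul_inv, mul_pow,
    ← mul_assoc, ← mul_assoc, inv_pow (t : ℂ), mul_inv_cancel₀ ht0, one_mul]

theorem weightedComponent_weightedDilation (hm : ∀ i, 0 < m i) (hG : IsQuasiCircular m G)
    (hGo : IsOpen G) (hGc : IsPreconnected G) (h0 : (0 : Fin n → ℂ) ∈ G)
    (hh : DifferentiableOn ℂ h G) (d : ℕ) {t : ℝ} (ht : 0 < t) (ht1 : t ≤ 1)
    (htG : MapsTo (weightedDilation m t) G G) {z : Fin n → ℂ} (hz : z ∈ G) :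
    weightedComponent m d h (weightedDilation m t z) = t ^ d * weightedComponent m d h z := by
  have hcomp := differentiableOn_weightedComponent hG hGo hh d
  obtain ⟨r, hr, hrG⟩ := Metric.isOpen_iff.1 hGo 0 h0
  refine eqOn_of_preconnected_of_eventuallyEq_holomorphic hGo hGc
    (f := fun z => weightedComponent m d h (weightedDilation m t z))
    (hcomp.comp (differentiable_weightedDilation m t).differentiableOn htG) (hcomp.const_mul _)
    h0 ?_ hz
  filter_upwards [ball_mem_nhds (0 : Fin n → ℂ) hr] with z hz
  exact weightedComponent_weightedDilation_of_mem_ball hm (hh.mono hrG) d ht ht1 hz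

theorem setIntegral_weightedComponent_mul_star (hG : IsQuasiCircular m G) (hGo : IsOpen G)
    (hh : ContinuousOn h G) (hqc : ContinuousOn q G)
    (hhq : IntegrableOn (fun z => h z * star (q z)) G)
    (hq : ∀ c z, q (weightedDilation m c z) = c ^ d * q z) :
    ∫ z in G, weightedComponent m d h z * star (q z) = ∫ z in G, h z * star (q z) := by
  rw [← hG.setIntegral_circleAverage_weightedDilation hGo
    (k := fun z => h z * star (q z)) (hh.mul (continuous_star.comp_continuousOn hqc)) hhq]
  refine integral_congr_ae (Eventually.of_forall fun z => ?_)
  simp only [weightedComponent]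
  rw [mul_comm, ← smul_eq_mul, ← Real.circleAverage_fun_smul]
  refine Real.circleAverage_congr_sphere fun c hc => ?_
  have hstar : star c = c⁻¹ := by
    rw [abs_one, mem_sphere_zero_iff_norm] at hc
    rw [Complex.inv_def, Complex.normSq_eq_norm_sq, hc, one_pow, inv_one, Complex.ofReal_one,
      mul_one, Complex.star_def]
  simp only [hq, star_mul', star_pow, hstar, smul_eq_mul]
  ring

theorem setIntegral_comp_weightedDilation_mul_star (hm : ∀ i, 0 < m i) (hG : IsQuasiCircular m G)
    (hGd : IsBoundedDomain G) (h0 : (0 : Fin n → ℂ) ∈ G) {t : ℝ} (ht : 0 < t) (ht1 : t ≤ 1)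
    {K : Set (Fin n → ℂ)} (hK : IsCompact K) (hKG : K ⊆ G)
    (htK : MapsTo (weightedDilation m t) G K) (hqc : Continuous q)
    (hq : ∀ c z, q (weightedDilation m c z) = c ^ d * q z) (hh : DifferentiableOn ℂ h G)
    (hh_int : IntegrableOn h G) :
    ∫ z in G, h (weightedDilation m t z) * star (q z) =
      t ^ d * ∫ z in G, h z * star (q z) := by
  have hGo := hGd.isOpen
  have htG : MapsTo (weightedDilation m t) G G := fun z hz => hKG (htK hz)
  have hq_bdd : ∃ B, ∀ᵐ z ∂volume.restrict G, ‖star (q z)‖ ≤ B := by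
    obtain ⟨B, hB⟩ := hGd.isBounded.isCompact_closure.exists_bound_of_continuousOn hqc.continuousOn
    exact ⟨B, (ae_restrict_mem hGo.measurableSet).mono fun z hz =>
      (norm_star (q z)).trans_le (hB z (subset_closure hz))⟩
  obtain ⟨B, hB⟩ := hq_bdd
  have hq_meas : AEStronglyMeasurable (fun z => star (q z)) (volume.restrict G) :=
    (continuous_star.comp hqc).aestronglyMeasurable
  have hht : ContinuousOn (fun z => h (weightedDilation m t z)) G :=
    hh.continuousOn.comp (differentiable_weightedDilation m t).continuous.continuousOn htG
  have hht_int : IntegrableOn (fun z => h (weightedDilation m t z)) G := by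
    obtain ⟨M, hM⟩ := hK.exists_bound_of_continuousOn (hh.continuousOn.mono hKG)
    exact IntegrableOn.of_bound hGd.isBounded.measure_lt_top
      (hht.aestronglyMeasurable hGo.measurableSet) M
      ((ae_restrict_mem hGo.measurableSet).mono fun z hz => hM _ (htK hz))
  rw [← setIntegral_weightedComponent_mul_star hG hGo hht hqc.continuousOn
      (hht_int.mul_bdd hq_meas hB) hq,
    ← setIntegral_weightedComponent_mul_star hG hGo hh.continuousOn hqc.continuousOn
      (hh_int.mul_bdd hq_meas hB) hq, ← integral_const_mul]
  refine setIntegral_congr_fun hGo.measurableSet fun z hz => ?_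
  have hcomm : weightedComponent m d (fun z => h (weightedDilation m t z)) z =
      weightedComponent m d h (weightedDilation m t z) := by
    simp only [weightedComponent, weightedDilation_weightedDilation, mul_comm]
  simp only [hcomm, weightedComponent_weightedDilation hm hG hGo hGd.isConnected.isPreconnected h0
    hh d ht ht1 htG hz, mul_assoc]

theorem exists_setIntegral_eq_mul_setIntegral_image_weightedDilation (hm : ∀ i, 0 < m i)
    (hG : IsQuasiCircular m G) (hGd : IsBoundedDomain G) (h0 : (0 : Fin n → ℂ) ∈ G) {t : ℝ}
    (ht : 0 < t) (ht1 : t ≤ 1) {K : Set (Fin n → ℂ)} (hK : IsCompact K) (hKG : K ⊆ G)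
    (htK : MapsTo (weightedDilation m t) G K) (hqc : Continuous q)
    (hq : ∀ c z, q (weightedDilation m c z) = c ^ d * q z) :
    ∃ C : ℂ, ∀ h, DifferentiableOn ℂ h G → IntegrableOn h G →
      ∫ z in G, h z * star (q z) = C * ∫ z in weightedDilation m t '' G, h z * star (q z) := by
  obtain ⟨C, hC⟩ := exists_integral_comp_weightedDilation_eq m hGd.isOpen ht.ne'
  have ht0 : (t : ℂ) ^ d ≠ 0 := pow_ne_zero d (Complex.ofReal_ne_zero.2 ht.ne')
  have ht_star : star ((t : ℂ) ^ d) = (t : ℂ) ^ d := by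
    rw [star_pow, Complex.star_def, Complex.conj_ofReal]
  refine ⟨((t : ℂ) ^ d)⁻¹ * ((t : ℂ) ^ d)⁻¹ * C, fun h hh hh_int => ?_⟩
  have himage : C * ∫ z in weightedDilation m t '' G, h z * star (q z) =
      t ^ d * (t ^ d * ∫ z in G, h z * star (q z)) := by
    rw [← hC fun z => h z * star (q z), ← setIntegral_comp_weightedDilation_mul_star hm hG hGd h0
      ht ht1 hK hKG htK hqc hq hh hh_int, ← integral_const_mul]
    simp only [hq, star_mul', ht_star, mul_left_comm]
  rw [mul_assoc, himage, mul_assoc, inv_mul_cancel_left₀ ht0, inv_mul_cancel_left₀ ht0]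

end WeightedComponent

section Division

theorem exists_differentiableOn_eq_mul_of_locally {E : Type*} [NormedAddCommGroup E]
    [NormedSpace ℂ E] {a b : E → ℂ} {C : Set E} (hC : C ⊆ closure {x ∈ C | b x ≠ 0})
    (hloc : ∀ z ∈ C, ∃ g : E → ℂ, ∀ᶠ x in 𝓝 z,
      x ∈ C ∧ DifferentiableAt ℂ g x ∧ a x = b x * g x) :
    ∃ F : E → ℂ, DifferentiableOn ℂ F C ∧ ∀ z ∈ C, a z = b z * F z := by
  set F : E → ℂ := fun z => limUnder (𝓝[{x ∈ C | b x ≠ 0}] z) fun x => a x / b x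
  have F_eq : ∀ z ∈ C, ∀ g : E → ℂ,
      (∀ᶠ x in 𝓝 z, x ∈ C ∧ DifferentiableAt ℂ g x ∧ a x = b x * g x) → F z = g z := by
    intro z hz g hg
    have : (𝓝[{x ∈ C | b x ≠ 0}] z).NeBot := mem_closure_iff_nhdsWithin_neBot.1 (hC hz)
    have hgz : Tendsto g (𝓝[{x ∈ C | b x ≠ 0}] z) (𝓝 (g z)) :=
      hg.self_of_nhds.2.1.continuousAt.tendsto.mono_left nhdsWithin_le_nhds
    refine (hgz.congr' ?_).limUnder_eq
    filter_upwards [self_mem_nhdsWithin, hg.filter_mono nhdsWithin_le_nhds] with x hbx hgx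
    rw [hgx.2.2, mul_div_cancel_left₀ _ hbx.2]
  choose! g hg using hloc
  have F_eventuallyEq : ∀ z ∈ C, F =ᶠ[𝓝 z] g z := fun z hz =>
    (hg z hz).eventually_nhds.mono fun x hx => F_eq x hx.self_of_nhds.1 _ hx
  refine ⟨F, fun z hz => ?_, fun z hz => ?_⟩
  · exact ((hg z hz).self_of_nhds.2.1.congr_of_eventuallyEq
      (F_eventuallyEq z hz)).differentiableWithinAt
  · rw [(hg z hz).self_of_nhds.2.2, (F_eventuallyEq z hz).self_of_nhds]

theorem analyticOrderAt_le_of_pow_dvd {a b : ℂ → ℂ} {c : ℕ → ℂ → ℂ} {z : ℂ}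
    (ha : AnalyticAt ℂ a z) (hb : AnalyticAt ℂ b z) (hc : ∀ k, AnalyticAt ℂ (c k) z)
    (h : ∀ k, ∀ᶠ x in 𝓝 z, a x ^ k * b x = b x ^ k * c k x)
    (hb0 : analyticOrderAt b z ≠ ⊤) : analyticOrderAt b z ≤ analyticOrderAt a z := by
  obtain ⟨m, hm⟩ := ENat.ne_top_iff_exists.1 hb0
  rw [← hm]
  by_contra! hlt
  obtain ⟨l, hl⟩ := ENat.ne_top_iff_exists.1 (ne_top_of_lt hlt)
  rw [← hl, Nat.cast_lt] at hlt
  have horder : analyticOrderAt (a ^ (m + 1) * b) z =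
      analyticOrderAt (b ^ (m + 1) * c (m + 1)) z := analyticOrderAt_congr (h (m + 1))
  rw [analyticOrderAt_mul (ha.pow _) hb, analyticOrderAt_mul (hb.pow _) (hc _),
    analyticOrderAt_pow ha, analyticOrderAt_pow hb, ← hl, ← hm, nsmul_eq_mul,
    nsmul_eq_mul] at horder
  have hle : ((m + 1 : ℕ) : ℕ∞) * m ≤ (m + 1 : ℕ) * l + m := horder ▸ le_self_add
  have hle' : (m + 1) * m ≤ (m + 1) * l + m := by exact_mod_cast hle
  nlinarith

theorem exists_analyticAt_eq_mul_of_analyticOrderAt_le {a b : ℂ → ℂ} {z : ℂ}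
    (ha : AnalyticAt ℂ a z) (hb : AnalyticAt ℂ b z) (hb0 : analyticOrderAt b z ≠ ⊤)
    (hle : analyticOrderAt b z ≤ analyticOrderAt a z) :
    ∃ g : ℂ → ℂ, AnalyticAt ℂ g z ∧ ∀ᶠ x in 𝓝 z, a x = b x * g x := by
  obtain ⟨m, hm⟩ := ENat.ne_top_iff_exists.1 hb0
  obtain ⟨a', ha', haa'⟩ := (natCast_le_analyticOrderAt ha).1 (hm ▸ hle)
  obtain ⟨b', hb', hb'0, hbb'⟩ := (hb.analyticOrderAt_eq_natCast).1 hm.symm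
  refine ⟨fun x => a' x / b' x, ha'.div hb' hb'0, ?_⟩
  filter_upwards [haa', hbb', hb'.continuousAt.eventually_ne hb'0] with x hax hbx hb'x
  rw [hax, hbx, smul_eq_mul, smul_eq_mul]
  field_simp

theorem exists_differentiableOn_eq_mul_of_pow_dvd_of_complex {C : Set ℂ} (hC : IsOpen C)
    (hCc : IsPreconnected C) {a b : ℂ → ℂ} {c : ℕ → ℂ → ℂ} (ha : DifferentiableOn ℂ a C)
    (hb : DifferentiableOn ℂ b C) (hc : ∀ k, DifferentiableOn ℂ (c k) C)
    (hne : ∃ z ∈ C, b z ≠ 0) (hdvd : ∀ k, ∀ z ∈ C, a z ^ k * b z = b z ^ k * c k z) :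
    ∃ F : ℂ → ℂ, DifferentiableOn ℂ F C ∧ ∀ z ∈ C, a z = b z * F z := by
  obtain ⟨p, hp, hp0⟩ := hne
  refine exists_differentiableOn_eq_mul_of_locally
    (subset_closure_ne_zero_of_holomorphic hC hCc hb hp hp0) fun z hz => ?_
  have hCz := hC.mem_nhds hz
  have haz := ha.analyticAt hCz
  have hbz := hb.analyticAt hCz
  have hfin : analyticOrderAt b z ≠ ⊤ := fun htop => hp0 <|
    (hb.analyticOnNhd hC).eqOn_zero_of_preconnected_of_eventuallyEq_zero hCc hz
      (analyticOrderAt_eq_top.1 htop) hp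
  obtain ⟨g, hg, hab⟩ := exists_analyticAt_eq_mul_of_analyticOrderAt_le haz hbz hfin
    (analyticOrderAt_le_of_pow_dvd haz hbz (fun k => (hc k).analyticAt hCz)
      (fun k => eventually_of_mem hCz (hdvd k)) hfin)
  refine ⟨g, ?_⟩
  filter_upwards [hCz, hg.eventually_analyticAt, hab] with x hxC hgx hax
  exact ⟨hxC, hgx.differentiableAt, hax⟩

variable {E : Type*} [NormedAddCommGroup E] [NormedSpace ℂ E] {C : Set E}

theorem exists_direction_eventually_slice_ne_zero (hC : IsOpen C) (hCc : IsPreconnected C)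
    {f : E → ℂ} (hf : DifferentiableOn ℂ f C) (hne : ∃ z ∈ C, f z ≠ 0) {z₀ : E} (hz₀ : z₀ ∈ C) :
    ∃ v : E, ∀ᶠ ζ : ℂ in 𝓝[≠] 0, f (z₀ + ζ • v) ≠ 0 := by
  obtain ⟨p, hp, hp0⟩ := hne
  obtain ⟨r, hr, hrC⟩ := Metric.isOpen_iff.1 hC z₀ hz₀
  obtain ⟨z₁, ⟨-, hz₁⟩, hz₁r⟩ := Metric.mem_closure_iff.1
    (subset_closure_ne_zero_of_holomorphic hC hCc hf hp hp0 hz₀) r hr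
  set v := z₁ - z₀ with hv
  have hvr : ‖v‖ < r := by rwa [dist_comm, dist_eq_norm] at hz₁r
  have hslice : AnalyticOnNhd ℂ (fun ζ : ℂ => f (z₀ + ζ • v)) (closedBall 0 1) := by
    refine (DifferentiableOn.analyticOnNhd (s := (fun ζ : ℂ => z₀ + ζ • v) ⁻¹' C)
      (hf.comp (by fun_prop) (mapsTo_preimage _ _)) (hC.preimage (by fun_prop))).mono
      fun ζ hζ => hrC ?_
    rw [mem_closedBall_zero_iff] at hζ
    rw [mem_ball, dist_eq_norm, add_sub_cancel_left, norm_smul]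
    nlinarith [norm_nonneg v]
  refine ⟨v, ((hslice 0 (by simp)).eventually_eq_zero_or_eventually_ne_zero).resolve_left
    fun hzero => hz₁ ?_⟩
  have hone := hslice.eqOn_zero_of_preconnected_of_eventuallyEq_zero
    (convex_closedBall _ _).isPreconnected (by simp) hzero (show (1 : ℂ) ∈ closedBall 0 1 by simp)
  simpa [hv] using hone

theorem exists_slice_ne_zero_on_sphere (hC : IsOpen C) (hCc : IsPreconnected C)
    {f : E → ℂ} (hf : DifferentiableOn ℂ f C) (hne : ∃ z ∈ C, f z ≠ 0) {z₀ : E} (hz₀ : z₀ ∈ C) :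
    ∃ v : E, ∃ R : ℝ, 0 < R ∧ ∀ᶠ z in 𝓝 z₀,
      (∀ ζ ∈ closedBall (0 : ℂ) (2 * R), z + ζ • v ∈ C) ∧
      ∀ ζ ∈ sphere (0 : ℂ) R, f (z + ζ • v) ≠ 0 := by
  obtain ⟨v, hv⟩ := exists_direction_eventually_slice_ne_zero hC hCc hf hne hz₀
  have hvC : ∀ᶠ ζ : ℂ in 𝓝 0, z₀ + ζ • v ∈ C :=
    (hC.preimage (by fun_prop : Continuous fun ζ : ℂ => z₀ + ζ • v)).mem_nhds (by simpa using hz₀)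
  obtain ⟨ε, hε, hball⟩ := nhds_basis_closedBall.mem_iff.1
    (hvC.and (eventually_nhdsWithin_iff.1 hv))
  have hR : 2 * (ε / 2) = ε := by ring
  refine ⟨v, ε / 2, by positivity, .and ?_ ?_⟩
  · rw [hR]
    refine (isCompact_closedBall (0 : ℂ) ε).eventually_forall_of_forall_eventually fun ζ hζ => ?_
    exact (hC.preimage (by fun_prop : Continuous fun p : E × ℂ => p.1 + p.2 • v)).mem_nhds
      (hball hζ).1
  · refine (isCompact_sphere (0 : ℂ) (ε / 2)).eventually_forall_of_forall_eventually
      fun ζ hζ => ?_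
    have hζε : ζ ∈ closedBall (0 : ℂ) ε :=
      sphere_subset_closedBall.trans (closedBall_subset_closedBall (by linarith)) hζ
    have hζ0 : ζ ≠ 0 := ne_of_mem_sphere hζ (by positivity)
    have hcont : ContinuousAt (fun p : E × ℂ => f (p.1 + p.2 • v)) (z₀, ζ) :=
      ContinuousAt.comp (x := (z₀, ζ)) (g := f) (f := fun p : E × ℂ => p.1 + p.2 • v)
        (hf.continuousOn.continuousAt (hC.mem_nhds (hball hζε).1)) (by fun_prop)
    exact hcont.eventually_ne ((hball hζε).2 hζ0)

theorem eq_mul_circleAverage_slice {a b : E → ℂ} {c : ℕ → E → ℂ}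
    (ha : DifferentiableOn ℂ a C) (hb : DifferentiableOn ℂ b C)
    (hc : ∀ k, DifferentiableOn ℂ (c k) C)
    (hdvd : ∀ k, ∀ z ∈ C, a z ^ k * b z = b z ^ k * c k z) {z v : E} {R : ℝ} (hR : 0 < R)
    (hzC : ∀ ζ ∈ closedBall (0 : ℂ) (2 * R), z + ζ • v ∈ C)
    (hzb : ∀ ζ ∈ sphere (0 : ℂ) R, b (z + ζ • v) ≠ 0) :
    a z = b z * Real.circleAverage (fun ζ => a (z + ζ • v) / b (z + ζ • v)) 0 R := by
  have hmaps : MapsTo (fun ζ : ℂ => z + ζ • v) (ball 0 (2 * R)) C := fun ζ hζ =>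
    hzC ζ (ball_subset_closedBall hζ)
  have hslice : ∀ {g : E → ℂ}, DifferentiableOn ℂ g C →
      DifferentiableOn ℂ (fun ζ : ℂ => g (z + ζ • v)) (ball 0 (2 * R)) := fun hg =>
    hg.comp (by fun_prop) hmaps
  have hsub : closedBall (0 : ℂ) R ⊆ ball 0 (2 * R) := closedBall_subset_ball (by linarith)
  have hRmem : (R : ℂ) ∈ sphere (0 : ℂ) R := by simp [abs_of_pos hR]
  obtain ⟨q, hq, hqab⟩ := exists_differentiableOn_eq_mul_of_pow_dvd_of_complex isOpen_ball
    (convex_ball _ _).isPreconnected (hslice ha) (hslice hb) (fun k => hslice (hc k))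
    ⟨R, hsub (sphere_subset_closedBall hRmem), hzb R hRmem⟩ fun k ζ hζ => hdvd k _ (hmaps hζ)
  have hmean : Real.circleAverage q 0 R = q 0 := by
    refine DiffContOnCl.circleAverage (hq.diffContOnCl_ball ?_)
    rwa [abs_of_pos hR]
  have hquot : Real.circleAverage (fun ζ => a (z + ζ • v) / b (z + ζ • v)) 0 R =
      Real.circleAverage q 0 R := by
    refine Real.circleAverage_congr_sphere fun ζ hζ => ?_
    rw [abs_of_pos hR] at hζ
    simp only [hqab ζ (hsub (sphere_subset_closedBall hζ)), mul_div_cancel_left₀ _ (hzb ζ hζ)]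
  rw [hquot, hmean]
  simpa using hqab 0 (mem_ball_self (by positivity))

theorem exists_differentiableOn_eq_mul_of_pow_dvd [FiniteDimensional ℂ E] {a b : E → ℂ}
    {c : ℕ → E → ℂ} (hC : IsOpen C) (hCc : IsPreconnected C)
    (ha : DifferentiableOn ℂ a C) (hb : DifferentiableOn ℂ b C)
    (hc : ∀ k, DifferentiableOn ℂ (c k) C) (hne : ∃ z ∈ C, b z ≠ 0)
    (hdvd : ∀ k, ∀ z ∈ C, a z ^ k * b z = b z ^ k * c k z) :
    ∃ F : E → ℂ, DifferentiableOn ℂ F C ∧ ∀ z ∈ C, a z = b z * F z := by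
  have ⟨p, hp, hp0⟩ := hne
  refine exists_differentiableOn_eq_mul_of_locally
    (subset_closure_ne_zero_of_holomorphic hC hCc hb hp hp0) fun z₀ hz₀ => ?_
  obtain ⟨v, R, hR, hev⟩ := exists_slice_ne_zero_on_sphere hC hCc hb hne hz₀
  obtain ⟨N, hN, hNo, hz₀N⟩ := _root_.eventually_nhds_iff.1 hev
  have hsphere : sphere (0 : ℂ) R ⊆ closedBall 0 (2 * R) :=
    sphere_subset_closedBall.trans (closedBall_subset_closedBall (by linarith))
  have hmaps : MapsTo (fun p : E × ℂ => p.1 + p.2 • v) (N ×ˢ sphere 0 R) C := fun p hp =>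
    (hN p.1 hp.1).1 p.2 (hsphere hp.2)
  have hdiff : DifferentiableOn ℂ
      (fun z => Real.circleAverage (fun ζ => a (z + ζ • v) / b (z + ζ • v)) 0 R) N := by
    refine differentiableOn_circleAverage hNo hR ?_ fun ζ hζ => ?_
    · exact (ha.continuousOn.comp (by fun_prop) hmaps).div
        (hb.continuousOn.comp (by fun_prop) hmaps) fun p hp => (hN p.1 hp.1).2 p.2 hp.2
    · have hmapsζ : MapsTo (fun z : E => z + ζ • v) N C := fun z hz =>
        (hN z hz).1 ζ (hsphere hζ)
      simp only [div_eq_mul_inv]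
      exact (ha.comp (by fun_prop) hmapsζ).mul ((hb.comp (by fun_prop) hmapsζ).inv
        fun z hz => (hN z hz).2 ζ hζ)
  refine ⟨_, eventually_of_mem (hNo.mem_nhds hz₀N) fun z hz => ⟨?_,
    (hdiff z hz).differentiableAt (hNo.mem_nhds hz),
    eq_mul_circleAverage_slice ha hb hc hdvd hR (hN z hz).1 (hN z hz).2⟩⟩
  simpa using (hN z hz).1 0 (mem_closedBall_self (by positivity))

end Division

section Extension

variable {n : ℕ} {D G : Set (Fin n → ℂ)} {f : (Fin n → ℂ) → (Fin n → ℂ)} {m : Fin n → ℕ}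

theorem IsBergmanKernel.star_swap {k : (Fin n → ℂ) → (Fin n → ℂ) → ℂ} (hk : IsBergmanKernel D k)
    {z w : Fin n → ℂ} (hz : z ∈ D) (hw : w ∈ D) : star (k w z) = k z w := by
  rw [hk.reproducing _ (hk.mem w hw) z hz, hk.reproducing _ (hk.mem z hz) w hw,
    Complex.star_def, ← integral_conj]
  simp only [map_mul, Complex.conj_conj, mul_comm]

theorem mul_mem_bergmanSpace (hD : IsOpen D) {u v : (Fin n → ℂ) → ℂ} (hu : u ∈ bergmanSpace D)
    (hv : DifferentiableOn ℂ v D) {B : ℝ} (hB : ∀ w ∈ D, ‖v w‖ ≤ B) :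
    (fun w => u w * v w) ∈ bergmanSpace D := by
  refine ⟨hu.1.mul hv, (hu.2.const_mul (B : ℂ)).mono
    ((hu.1.mul hv).continuousOn.aestronglyMeasurable hD.measurableSet) ?_⟩
  filter_upwards [ae_restrict_mem hD.measurableSet] with w hw
  rw [norm_mul, norm_mul, mul_comm, Complex.norm_real]
  gcongr
  exact (hB w hw).trans (le_abs_self B)

theorem IsProperHolomorphic.isOpen_inter_preimage_image_weightedDilation
    (hf : IsProperHolomorphic f D G) (hD : IsOpen D) (hG : IsOpen G) {c : ℂ} (hc : c ≠ 0) :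
    IsOpen (D ∩ f ⁻¹' (weightedDilation m c '' G)) :=
  hf.holomorphic.continuousOn.isOpen_inter_preimage hD (isOpen_image_weightedDilation m hc hG)

theorem IsProperHolomorphic.exists_setIntegral_eq_mul_setIntegral_preimage
    (hf : IsProperHolomorphic f D G) (hD : IsOpen D) (hGd : IsBoundedDomain G)
    (hG : IsQuasiCircular m G) (hm : ∀ i, 0 < m i) (h0 : 0 ∈ G) {K : Set (Fin n → ℂ)}
    (hK : IsCompact K) (hKG : K ⊆ G) {t : ℝ} (ht : 0 < t) (ht1 : t ≤ 1)
    (htK : MapsTo (weightedDilation m t) G K) {q : (Fin n → ℂ) → ℂ} {d : ℕ}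
    (hqc : Continuous q) (hq : ∀ c z, q (weightedDilation m c z) = c ^ d * q z) :
    ∃ C : ℂ, ∀ g ∈ bergmanSpace D,
      ∫ w in D, g w * star (jacobianMatrix f w).det * star (q (f w)) =
        C * ∫ w in D ∩ f ⁻¹' (weightedDilation m t '' G),
          g w * star (jacobianMatrix f w).det * star (q (f w)) := by
  obtain ⟨C, hC⟩ := exists_setIntegral_eq_mul_setIntegral_image_weightedDilation hm hG hGd h0 ht
    ht1 hK hKG htK hqc hq
  obtain ⟨B, hB⟩ := hGd.isBounded.isCompact_closure.exists_bound_of_continuousOn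
    (continuous_star.comp hqc).continuousOn
  refine ⟨C, fun g hg => ?_⟩
  obtain ⟨h, hh, hh_int, hpush⟩ := hf.exists_setIntegral_preimage_eq hD hGd.isOpen
    hGd.isConnected.isPreconnected hGd.isBounded hg
  have hpushq : ∀ V ⊆ G, IsOpen V →
      ∫ w in D ∩ f ⁻¹' V, g w * star (jacobianMatrix f w).det * star (q (f w)) =
        ∫ y in V, h y * star (q y) := fun V hVG hV =>
    hpush V hVG hV (fun y => star (q y)) (continuous_star.comp hqc).continuousOn B
      fun y hy => hB y (subset_closure (hVG hy))
  have htG : weightedDilation m t '' G ⊆ G := htK.image_subset.trans hKG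
  have htG_open := isOpen_image_weightedDilation m (Complex.ofReal_ne_zero.2 ht.ne') hGd.isOpen
  rw [hpushq _ htG htG_open, ← hC h hh hh_int, ← hpushq G subset_rfl hGd.isOpen,
    inter_eq_left.2 hf.mapsTo.subset_preimage]

theorem IsProperHolomorphic.exists_det_mul_comp_eq_setIntegral_preimage
    (hf : IsProperHolomorphic f D G) (hD : IsOpen D) (hGd : IsBoundedDomain G)
    (hG : IsQuasiCircular m G) (hm : ∀ i, 0 < m i) (h0 : 0 ∈ G) {K : Set (Fin n → ℂ)}
    (hK : IsCompact K) (hKG : K ⊆ G) {t : ℝ} (ht : 0 < t) (ht1 : t ≤ 1)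
    (htK : MapsTo (weightedDilation m t) G K) {q : (Fin n → ℂ) → ℂ} {d : ℕ}
    (hqd : Differentiable ℂ q) (hq : ∀ c z, q (weightedDilation m c z) = c ^ d * q z) :
    ∃ C : ℂ, ∀ z ∈ D, (jacobianMatrix f z).det * q (f z) =
      C * ∫ w in D ∩ f ⁻¹' (weightedDilation m t '' G),
        (jacobianMatrix f w).det * q (f w) * bergmanKernel D z w := by
  obtain ⟨C, hC⟩ := hf.exists_setIntegral_eq_mul_setIntegral_preimage hD hGd hG hm h0 hK hKG ht ht1
    htK hqd.continuous hq
  obtain ⟨B, hB⟩ := hGd.isBounded.isCompact_closure.exists_bound_of_continuousOn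
    hqd.continuous.continuousOn
  have hk := isBergmanKernel_bergmanKernel hD
  have hmem := mul_mem_bergmanSpace hD (hf.det_jacobianMatrix_mem_bergmanSpace hD hGd.isOpen
    hGd.isConnected.isPreconnected hGd.isBounded) (hqd.comp_differentiableOn hf.holomorphic)
    fun w hw => hB _ (subset_closure (hf.mapsTo hw))
  have hstar : ∀ z ∈ D, ∀ S ⊆ D, MeasurableSet S →
      star (∫ w in S, bergmanKernel D w z * star (jacobianMatrix f w).det * star (q (f w))) =
        ∫ w in S, (jacobianMatrix f w).det * q (f w) * bergmanKernel D z w := by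
    intro z hz S hSD hS
    rw [Complex.star_def, ← integral_conj]
    refine setIntegral_congr_fun hS fun w hw => ?_
    simp only [map_mul, Complex.star_def, Complex.conj_conj, ← hk.star_swap hz (hSD hw)]
    ring
  have hpre := hf.isOpen_inter_preimage_image_weightedDilation (m := m) hD hGd.isOpen
    (Complex.ofReal_ne_zero.2 ht.ne')
  refine ⟨star C, fun z hz => ?_⟩
  rw [← hstar z hz _ inter_subset_left hpre.measurableSet, ← star_mul', ← hC _ (hk.mem z hz),
    hstar z hz D subset_rfl hD.measurableSet]
  refine (hk.reproducing _ hmem z hz).trans (setIntegral_congr_fun hD.measurableSet fun w hw => ?_)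
  simp only [Function.comp_apply, hk.star_swap hz hw]

theorem BergmanKernelExtends.exists_extension_setIntegral (hker : BergmanKernelExtends D)
    (hD : IsOpen D) {K : Set (Fin n → ℂ)} (hK : IsCompact K) (hKD : K ⊆ D) :
    ∃ U, IsOpen U ∧ closure D ⊆ U ∧ ∀ a : (Fin n → ℂ) → ℂ, ContinuousOn a K →
      ∀ S ⊆ K, MeasurableSet S → ∃ H, DifferentiableOn ℂ H U ∧
        ∀ z ∈ D, H z = ∫ w in S, a w * bergmanKernel D z w := by
  obtain ⟨L, hLo, hKL, hLD, hLc⟩ := exists_open_between_and_isCompact_closure hK hD hKD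
  obtain ⟨U, hU, hDU, Φ, hΦ, hΦk⟩ := hker L hLo hLc hLD
  have hconj : ∀ w ∈ K, star w ∈ conjSet L := fun w hw => ⟨w, hKL hw, rfl⟩
  refine ⟨U, hU, hDU, fun a ha S hSK hS => ⟨fun z => ∫ w in S, a w * Φ (z, star w), ?_, ?_⟩⟩
  · have hrestrict : (volume.restrict S).restrict K = volume.restrict S := by
      rw [Measure.restrict_restrict hK.measurableSet, inter_eq_right.2 hSK]
    rw [← hrestrict]
    refine differentiableOn_setIntegral_of_continuousOn (f := fun z w => Φ (z, star w)) hU hK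
      ?_ (fun w hw => ?_) (ha.integrableOn_compact hK)
    · exact hΦ.continuousOn.comp
        (f := fun p : (Fin n → ℂ) × (Fin n → ℂ) => (p.1, star p.2)) (by fun_prop)
        fun p hp => ⟨hp.1, hconj _ hp.2⟩
    · exact hΦ.comp (f := fun z : Fin n → ℂ => (z, star w)) (by fun_prop)
        fun z hz => ⟨hz, hconj w hw⟩
  · intro z hz
    refine setIntegral_congr_fun hS fun w hw => ?_
    simp only [hΦk z hz _ (hconj w (hSK hw)), star_star]

theorem IsProperHolomorphic.exists_extension_det_mul_comp (hf : IsProperHolomorphic f D G)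
    (hD : IsOpen D) (hker : BergmanKernelExtends D) (hGd : IsBoundedDomain G)
    (hG : IsQuasiCircular m G) (hm : ∀ i, 0 < m i) (h0 : 0 ∈ G) :
    ∃ U, IsOpen U ∧ closure D ⊆ U ∧ ∀ (q : (Fin n → ℂ) → ℂ) (d : ℕ), Differentiable ℂ q →
      (∀ c z, q (weightedDilation m c z) = c ^ d * q z) →
        ∃ H, DifferentiableOn ℂ H U ∧ ∀ z ∈ D, H z = (jacobianMatrix f z).det * q (f z) := by
  obtain ⟨r, hr, hrG⟩ := nhds_basis_closedBall.mem_iff.1 (hGd.isOpen.mem_nhds h0)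
  obtain ⟨t, ht, ht1, htr⟩ := exists_mapsTo_weightedDilation_closedBall hm hGd.isBounded hr
  have hball := isCompact_closedBall (0 : Fin n → ℂ) r
  obtain ⟨U, hU, hDU, hext⟩ := hker.exists_extension_setIntegral hD
    (hf.isCompact_inter_preimage hball hrG) inter_subset_left
  refine ⟨U, hU, hDU, fun q d hqd hq => ?_⟩
  obtain ⟨C, hC⟩ := hf.exists_det_mul_comp_eq_setIntegral_preimage hD hGd hG hm h0 hball hrG ht ht1
    htr hqd hq
  have hcont : ContinuousOn (fun w => (jacobianMatrix f w).det * q (f w)) D :=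
    (differentiableOn_det_jacobianMatrix hD hf.holomorphic).continuousOn.mul
      (hqd.continuous.comp_continuousOn hf.holomorphic.continuousOn)
  have hpre := hf.isOpen_inter_preimage_image_weightedDilation (m := m) hD hGd.isOpen
    (Complex.ofReal_ne_zero.2 ht.ne')
  obtain ⟨H, hH, hHD⟩ := hext _ (hcont.mono inter_subset_left) _
    (inter_subset_inter_right D (preimage_mono htr.image_subset)) hpre.measurableSet
  exact ⟨fun z => C * H z, hH.const_mul C, fun z hz => by simp only [hHD z hz, hC z hz]⟩

theorem exists_extension_of_mul_pow {E : Type*} [NormedAddCommGroup E] [NormedSpace ℂ E]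
    [FiniteDimensional ℂ E] {D V : Set E} (hD : IsOpen D) (hV : IsOpen V) (hVc : IsPreconnected V)
    (hDV : D ⊆ V) {u a : E → ℂ} (ha : ContinuousOn a D) (hu : ∃ p ∈ D, u p ≠ 0)
    (hext : ∀ k : ℕ, ∃ H, DifferentiableOn ℂ H V ∧ ∀ z ∈ D, H z = u z * a z ^ k) :
    ∃ F, DifferentiableOn ℂ F V ∧ EqOn F a D := by
  obtain ⟨p, hp, hp0⟩ := hu
  choose H hH hHD using hext
  have hH0 : ∀ z ∈ D, H 0 z = u z := fun z hz => by simpa using hHD 0 z hz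
  have hH1 : ∀ z ∈ D, H 1 z = u z * a z := fun z hz => by simpa using hHD 1 z hz
  have hH0p : H 0 p ≠ 0 := by rwa [hH0 p hp]
  have hdvd : ∀ k, EqOn (fun z => H 1 z ^ k * H 0 z) (fun z => H 0 z ^ k * H k z) V := by
    refine fun k => eqOn_of_preconnected_of_eventuallyEq_holomorphic hV hVc
      (((hH 1).pow k).mul (hH 0)) (((hH 0).pow k).mul (hH k)) (hDV hp) ?_
    filter_upwards [hD.mem_nhds hp] with z hz
    rw [hH0 z hz, hH1 z hz, hHD k z hz]
    ring
  obtain ⟨F, hF, hF_eq⟩ := exists_differentiableOn_eq_mul_of_pow_dvd hV hVc (hH 1) (hH 0) hH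
    ⟨p, hDV hp, hH0p⟩ hdvd
  have hdense : D ⊆ closure (D ∩ {z ∈ V | H 0 z ≠ 0}) := fun z hz =>
    hD.inter_closure
      ⟨hz, subset_closure_ne_zero_of_holomorphic hV hVc (hH 0) (hDV hp) hH0p (hDV hz)⟩
  refine ⟨F, hF, EqOn.of_subset_closure (fun z hz => ?_) (hF.continuousOn.mono hDV) ha
    inter_subset_left hdense⟩
  refine mul_left_cancel₀ hz.2.2 ?_
  rw [← hF_eq z hz.2.1, hH1 z hz.1, hH0 z hz.1]

theorem mainTheorem5_general (hDo : IsOpen D) (hDc : IsConnected D) (hG : IsBoundedDomain G)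
    (hm_pos : ∀ i, 0 < m i) (hG_circ : IsQuasiCircular m G) (hG_zero : 0 ∈ G)
    (hker : BergmanKernelExtends D) (hf : IsProperHolomorphic f D G) :
    ∃ V : Set (Fin n → ℂ), IsOpen V ∧ closure D ⊆ V ∧
      ∃ F : (Fin n → ℂ) → (Fin n → ℂ), DifferentiableOn ℂ F V ∧ EqOn F f D := by
  obtain ⟨U, hU, hDU, hext⟩ :=
    hf.exists_extension_det_mul_comp hDo hker hG hG_circ hm_pos hG_zero
  have ⟨p, hp, hp0⟩ := hf.exists_det_jacobianMatrix_ne_zero hDo hG.isOpen hDc.nonempty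
  have hDV : closure D ⊆ connectedComponentIn U p :=
    hDc.isPreconnected.closure.subset_connectedComponentIn (subset_closure hp) hDU
  have hcoord : ∀ i, ∃ F, DifferentiableOn ℂ F (connectedComponentIn U p) ∧
      EqOn F (fun z => f z i) D := by
    refine fun i => exists_extension_of_mul_pow
      (u := fun z => (jacobianMatrix f z).det) hDo hU.connectedComponentIn
      isPreconnected_connectedComponentIn (subset_closure.trans hDV)
      ((continuous_apply i).comp_continuousOn hf.holomorphic.continuousOn) ⟨p, hp, hp0⟩ fun k => ?_
    obtain ⟨H, hH, hHD⟩ := hext (fun z => z i ^ k) (m i * k) (by fun_prop)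
      fun c z => by simp only [weightedDilation, mul_pow, pow_mul]
    exact ⟨H, hH.mono (connectedComponentIn_subset _ _), hHD⟩
  choose F hF hFf using hcoord
  exact ⟨_, hU.connectedComponentIn, hDV, fun z i => F i z, differentiableOn_pi.2 hF,
    fun z hz => funext fun i => hFf i hz⟩

end Extension

theorem mainTheorem5 {n : ℕ} (D G : Set (Fin n → ℂ))
    (hD : IsBoundedDomain D) (hG : IsBoundedDomain G)
    (m : Fin n → ℕ) (hm_pos : ∀ i, 0 < m i) (hm_gcd : Finset.univ.gcd m = 1)
    (hG_circ : IsQuasiCircular m G) (hG_zero : 0 ∈ G)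
    (hker : BergmanKernelExtends D)
    (f : (Fin n → ℂ) → (Fin n → ℂ)) (hf : IsProperHolomorphic f D G) :
    ∃ V : Set (Fin n → ℂ), IsOpen V ∧ closure D ⊆ V ∧
      ∃ F : (Fin n → ℂ) → (Fin n → ℂ), DifferentiableOn ℂ F V ∧ EqOn F f D :=
  mainTheorem5_general hD.isOpen hD.isConnected hG hm_pos hG_circ hG_zero hker hf
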